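/- \textbf{Setting.} Let $R_0>0$, let $0\le V\in L^1(\mathbb R^3)$ be radial, and let $0\le W\in L^1(\mathbb R^3\times\mathbb R^3)$ satisfy $W(x,y)=W(y,x)$ and $W(x-y,x-z)=W(y-x,y-z)=W(z-y,z-x)$ for all $x,y,z\in\mathbb R^3$; assume that $V$ and $W$ are supported in the balls of radius $R_0$ centred at the origin of $\mathbb R^3$ and $\mathbb R^6$ respectively. Let $D^1(\mathbb R^d)$ be the space of functions $g\in L^1_{\mathrm{loc}}(\mathbb R^d;\mathbb C)$ that vanish at infinity (i.e. $|\{|g|>t\}|<\infty$ for all $t>0$) and have $\nabla g\in L^2(\mathbb R^d)$. The scattering length $a(V)$ and the three-body scattering energy $b_{\mathcal M}(W)$ are $$8\pi a(V)=\inf_{g\in D^1(\mathbb R^3)}\int_{\mathbb R^3}\big(2|\nabla g|^2+V|1-g|^2\big),\qquad b_{\mathcal M}(W)=\inf_{g\in D^1(\mathbb R^6)}\int_{\mathbb R^6}\big(2|\mathcal M\nabla g|^2+W|1-g|^2\big),$$ $$\mathcal M=\frac1{2\sqrt2}\begin{pmatrix}\sqrt3+1&\sqrt3-1\\ \sqrt3-1&\sqrt3+1\end{pmatrix}\quad\text{acting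 on }\mathbb R^3\times\mathbb R^3 .$$ For $\rho>0$ put $\mathfrak a=\max(a(V),\rho\, b_{\mathcal M}(W))$ and $Y=\rho\mathfrak a^3$. For $\ell>0$ and $n\in\mathbb N_0$ let $$\tilde H_{n,\ell}=\sum_{i=1}^n-\Delta_i+\sum_{1\le i<j\le n}\ell^2V(\ell(x_i-x_j))+\sum_{1\le i<j<k\le n}\ell^2W(\ell(x_i-x_j,x_i-x_k))$$ be the self-adjoint operator on the symmetric functions in $L^2(\Lambda^n)$, $\Lambda=[-1/2,1/2]^3$, with Neumann boundary conditions, i.e. the operator of the corresponding quadratic form on the symmetric functions in $H^1(\Lambda^n)$ with finite interaction energy. \textbf{Proposition (Energy at short length scales).} There is a universal constant $\nu>0$ such that the following holds. Let $1/3<\alpha<12/35$ and $c_1,c_2,K>0$. Then there are constants $C,Y_0>0$, depending only on $\alpha,c_1,c_2,K$, such that for all $V$, $W$, $R_0$, $\rho$ as above with $R_0\le K\mathfrak a$ and $Y\le Y_0$, all $\ell$ with $c_1\mathfrak aY^{-\alpha}\le\ell\le c_2\mathfrak aY^{-\alpha}$, and all integers $0\le n\le 10\rho\ell^3$, one has $$\tilde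 H_{n,\ell}\ \ge\ \frac{4\pi a(V)}{\ell}\,n(n-1)+\frac{b_{\mathcal M}(W)}{6\ell^4}\,n(n-1)(n-2)-C\rho^2\mathfrak a\,\ell^5\,Y^{\nu}$$ in the sense of quadratic forms. -/

import Mathlib

open MeasureTheory
open scoped ContDiff

noncomputable section

namespace BoseGas

/-- One-particle space `ℝ³` with the Euclidean norm. -/
abbrev E3 : Type := EuclideanSpace ℝ (Fin 3)

/-- The `k`-th standard basis vector of `ℝ³`. -/
def unitVec (k : Fin 3) : E3 := EuclideanSpace.single k (1 : ℝ)

/-- Configurations of `n` particles in `ℝ³`; the volume is Lebesgue measure on `ℝ³ⁿ`. -/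
abbrev Config (n : ℕ) : Type := Fin n → E3

/-! ### Weak derivatives -/

section Weak

variable {E : Type*} [NormedAddCommGroup E] [NormedSpace ℝ E]

/-- `φ ∈ C_c^∞(Ω)`, real-valued. -/
structure IsTestFunction (Ω : Set E) (φ : E → ℝ) : Prop where
  smooth : ContDiff ℝ ∞ φ
  compact : HasCompactSupport φ
  supp : tsupport φ ⊆ Ω

variable [MeasureSpace E]

/-- `g` is the weak derivative of `f` in the direction `v` on the open set `Ω`.
It is used only for functions that are locally integrable on `Ω`. -/
def HasWeakDirDeriv (Ω : Set E) (f : E → ℂ) (v : E) (g : E → ℂ) : Prop :=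
  ∀ φ : E → ℝ, IsTestFunction Ω φ →
    ∫ x in Ω, (fderiv ℝ φ x v) • f x = - ∫ x in Ω, φ x • g x

/-- `g ∈ D¹(E)` with weak gradient `G`, where `e` is the standard basis of `E`: `g` is locally
integrable, vanishes at infinity (all level sets `{|g| > t}`, `t > 0`, have finite measure),
and its weak gradient is square integrable. -/
structure MemD1 {ι : Type*} (e : ι → E) (g : E → ℂ) (G : ι → E → ℂ) : Prop where
  locInt : LocallyIntegrable g volume
  vanish : ∀ t : ℝ, 0 < t → volume {x | t < ‖g x‖} < ⊤
  grad_memLp : ∀ i, MemLp (G i) 2 volume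
  weak : ∀ i, HasWeakDirDeriv Set.univ g (e i) (G i)

end Weak

/-! ### Scattering length and three-body scattering energy -/

/-- The infimum over `g ∈ D¹(ℝ³)` of `∫ 2|∇g|² + V|1 - g|²`. -/
def twoBodyScatteringEnergy (V : E3 → ℝ) : ENNReal :=
  ⨅ (g : E3 → ℂ) (G : Fin 3 → E3 → ℂ) (_ : MemD1 unitVec g G),
    ∫⁻ x, ENNReal.ofReal (2 * ∑ k, ‖G k x‖ ^ 2 + V x * ‖1 - g x‖ ^ 2)

/-- The scattering length `a(V)`, with `8π a(V)` the two-body scattering energy. -/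
def scatteringLength (V : E3 → ℝ) : ℝ :=
  (twoBodyScatteringEnergy V).toReal / (8 * Real.pi)

/-- The standard basis of `ℝ³ × ℝ³`, indexed by the factor and the coordinate in it. -/
def pairUnitVec (p : Fin 2 × Fin 3) : E3 × E3 :=
  if p.1 = 0 then (unitVec p.2, 0) else (0, unitVec p.2)

/-- The matrix `𝓜`, acting on `ℝ³ × ℝ³` blockwise. -/
def matM : Matrix (Fin 2) (Fin 2) ℝ :=
  (1 / (2 * √2)) • !![√3 + 1, √3 - 1; √3 - 1, √3 + 1]

/-- `|𝓜 z|²` for `z = (z₁, z₂) ∈ ℂ³ × ℂ³`. -/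
def normSqM (z : Fin 2 × Fin 3 → ℂ) : ℝ :=
  ∑ i, ∑ k, ‖∑ j, (matM i j : ℂ) * z (j, k)‖ ^ 2

/-- The three-body scattering energy `b_𝓜(W)`: the infimum over `g ∈ D¹(ℝ⁶)` of
`∫ 2|𝓜∇g|² + W|1 - g|²`. -/
def threeBodyScatteringEnergy (W : E3 × E3 → ℝ) : ℝ :=
  (⨅ (g : E3 × E3 → ℂ) (G : Fin 2 × Fin 3 → E3 × E3 → ℂ) (_ : MemD1 pairUnitVec g G),
    ∫⁻ x, ENNReal.ofReal (2 * normSqM (fun p => G p x) + W x * ‖1 - g x‖ ^ 2)).toReal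

/-! ### Potentials -/

/-- Assumptions on the potentials. The last two fields say that the supports of `V` and `W` lie
in the closed Euclidean balls of radius `R₀` in `ℝ³` and `ℝ⁶`; in particular they are compact. -/
structure IsAdmissible (V : E3 → ℝ) (W : E3 × E3 → ℝ) (R₀ : ℝ) : Prop where
  V_nonneg : ∀ x, 0 ≤ V x
  V_integrable : Integrable V volume
  V_radial : ∀ x y : E3, ‖x‖ = ‖y‖ → V x = V y
  W_nonneg : ∀ x, 0 ≤ W x
  W_integrable : Integrable W volume
  W_swap : ∀ x y : E3, W (x, y) = W (y, x)
  W_symm₁ : ∀ x y z : E3, W (x - y, x - z) = W (y - x, y - z)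
  W_symm₂ : ∀ x y z : E3, W (x - y, x - z) = W (z - y, z - x)
  R₀_pos : 0 < R₀
  V_supp : ∀ x, V x ≠ 0 → ‖x‖ ≤ R₀
  W_supp : ∀ x y : E3, W (x, y) ≠ 0 → √(‖x‖ ^ 2 + ‖y‖ ^ 2) ≤ R₀

/-- The effective combined scattering length `𝔞 = max(a(V), ρ b_𝓜(W))`. -/
def effLength (V : E3 → ℝ) (W : E3 × E3 → ℝ) (ρ : ℝ) : ℝ :=
  max (scatteringLength V) (ρ * threeBodyScatteringEnergy W)

/-- The diluteness parameter `Y = ρ 𝔞³`. -/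
def diluteness (V : E3 → ℝ) (W : E3 × E3 → ℝ) (ρ : ℝ) : ℝ :=
  ρ * effLength V W ρ ^ 3

/-! ### The rescaled Hamiltonian -/

/-- `(-1/2, 1/2)^{3n}`, the interior of `Λ₁ⁿ`; the boundary is a null set. -/
def unitBox (n : ℕ) : Set (Config n) :=
  {x | ∀ i k, |x i k| < 1 / 2}

/-- The interaction in the rescaled Hamiltonian:
`∑_{i<j} ℓ² V(ℓ(xᵢ-xⱼ)) + ∑_{i<j<k} ℓ² W(ℓ(xᵢ-xⱼ, xᵢ-xₖ))`. -/
def rescaledInteraction (V : E3 → ℝ) (W : E3 × E3 → ℝ) (ℓ : ℝ) {n : ℕ} (x : Config n) : ℝ :=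
  (∑ i, ∑ j ∈ Finset.Ioi i, ℓ ^ 2 * V (ℓ • (x i - x j))) +
    ∑ i, ∑ j ∈ Finset.Ioi i, ∑ k ∈ Finset.Ioi j,
      ℓ ^ 2 * W (ℓ • (x i - x j, x i - x k))

/-- The derivative direction of the `k`-th coordinate of the `i`-th particle. -/
def configUnitVec {n : ℕ} (p : Fin n × Fin 3) : Config n :=
  Pi.single p.1 (unitVec p.2)

/-- `ψ`, with weak gradient `G`, belongs to the form domain of the rescaled Hamiltonian: it is a
bosonic function in `H¹(Λ₁ⁿ)` with finite interaction energy. No condition is put on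
the boundary values, which gives the Neumann realization of the Laplacian. -/
structure MemFormDomain (V : E3 → ℝ) (W : E3 × E3 → ℝ) (ℓ : ℝ) {n : ℕ}
    (ψ : Config n → ℂ) (G : Fin n × Fin 3 → Config n → ℂ) : Prop where
  memLp : MemLp ψ 2 (volume.restrict (unitBox n))
  symm : ∀ σ : Equiv.Perm (Fin n), ∀ᵐ x ∂(volume.restrict (unitBox n)),
    ψ (fun i => x (σ i)) = ψ x
  grad_memLp : ∀ p, MemLp (G p) 2 (volume.restrict (unitBox n))
  weak : ∀ p, HasWeakDirDeriv (unitBox n) ψ (configUnitVec p) (G p)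
  interaction : Integrable (fun x => rescaledInteraction V W ℓ x * ‖ψ x‖ ^ 2)
    (volume.restrict (unitBox n))

/-- The quadratic form `⟨ψ, H̃_{n,ℓ} ψ⟩` of the rescaled Hamiltonian, where `G = ∇ψ`. -/
def rescaledForm (V : E3 → ℝ) (W : E3 × E3 → ℝ) (ℓ : ℝ) {n : ℕ}
    (ψ : Config n → ℂ) (G : Fin n × Fin 3 → Config n → ℂ) : ℝ :=
  (∫ x in unitBox n, ∑ p, ‖G p x‖ ^ 2) +
    ∫ x in unitBox n, rescaledInteraction V W ℓ x * ‖ψ x‖ ^ 2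

/-- The operator inequality `H̃_{n,ℓ} ≥ c` on `L²_s(Λ₁ⁿ)`, where `H̃_{n,ℓ}` is the self-adjoint
operator of the closed form above: `⟨ψ, H̃_{n,ℓ} ψ⟩ ≥ c ‖ψ‖²` on the whole form domain. -/
def RescaledHamiltonianGE (V : E3 → ℝ) (W : E3 × E3 → ℝ) (n : ℕ) (ℓ c : ℝ) : Prop :=
  ∀ (ψ : Config n → ℂ) (G : Fin n × Fin 3 → Config n → ℂ), MemFormDomain V W ℓ ψ G →
    c * ∫ x in unitBox n, ‖ψ x‖ ^ 2 ≤ rescaledForm V W ℓ ψ G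

end BoseGas

end

/-! The three-body term belongs to the error. A bump function at scale `R₀` gives `b_𝓜(W) ≤ C R₀⁴ ≤
C K⁴ 𝔞⁴`, so for `n ≤ 10 ρ ℓ³` the term `b n³ / ℓ⁴` is at most a constant times `ρ² 𝔞 ℓ⁵ Y`. Since
`W ≥ 0`, it may be dropped from the quadratic form, and a two-body bound with relative error of
order `Y ^ ν` remains.

Let `r = (𝔞/ℓ)^{1/8}`; the upper bound on `α` makes `r ρ ℓ³` a positive power of `Y`. For each
particle `i` a cutoff, independent of `x i`, keeps the other particles `2r` apart and at distance
`r` from the boundary, losing mass `O(n r + n² r³)` (`exists_cutoff`). The balls of radius `r` about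
the `x j`, `j ≠ i`, are then disjoint and lie in the box. The kinetic energy of `i` can thus be
distributed over them, while each pair potential is split in halves between its two particles
(`sum_pair_energy_le`). In each ball the energy is at least `4π a(V)/ℓ` times the mass of the cutoff
times `|m|²`, where `m` is a weighted mean of `ψ` over an annulus (`IsCutoff.pair_energy`).

This pair bound has no loss in `a(V)`. Averaging `ψ` over the level sets of `τ = ℓ|x i - x j|` can
only lower the energy (Jensen) and leaves a radial profile `p` on `(0, L)`, `L = rℓ`, with weak
derivative `q`. If `w` is a probability density on `[5L/8, 7L/8]` and `m₀ = ∫ w p`, then `p(t) = m₀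
- ∫_t^∞ b` for `t < L/2`, where `b(u) = q(u) ∫_u^∞ w`. So `g(x) = m₀⁻¹ ∫_{|x|}^∞ b` is a trial
function for the scattering energy: `1 - g = p/m₀` on the support of `V`, and its gradient is at
most `|q|/|m₀|` (`twoBodyScatteringEnergy_mul_le`, `scatteringLength_mul_le`).

It remains to compare `m` with the mean `c` of `ψ` over the box. By Cauchy–Schwarz `|m - c|²` is of
order `D/r³`, `D = ‖ψ - c‖²`, and the Poincaré inequality gives `D ≤ 12 n T` with `T` the kinetic
energy (`poincare_box`). Summed over pairs, the error is of order `e n³ T/(κ r³)`, `e = 4π a(V)/ℓ`.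
A fraction `κ` of the energy, set aside at relative cost `O(κ)`, absorbs it if `e n³ ≪ κ² r³`
(`energy_arithmetic`). With `κ = r` and `e = O(r⁸)` this says that `n r` is small, and the total
relative error is `O(n r + r)`. -/

open scoped ProbabilityTheory

noncomputable section

namespace BoseGas

/-! ### Averages over the fibres of a real function -/

/-- Integration over the fibres of `τ`: a square integrable `f` has an average `p` over the fibres,
which satisfies Jensen's inequality with any weight depending on `τ` only. -/
theorem exists_fiber_average {X : Type*} [MeasurableSpace X] [StandardBorelSpace X] [Nonempty X]
    (m : Measure X) [IsFiniteMeasure m] {τ : X → ℝ} (hτ : Measurable τ) {f : X → ℂ}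
    (hf : MemLp f 2 m) :
    ∃ p : ℝ → ℂ, StronglyMeasurable p ∧
      (∀ w : ℝ → ENNReal, Measurable w →
        ∫⁻ t, w t * ‖p t‖ₑ ^ 2 ∂(m.map τ) ≤ ∫⁻ x, w (τ x) * ‖f x‖ₑ ^ 2 ∂m) ∧
      (∀ h : ℝ → ℂ, Measurable h → Integrable (fun x => h (τ x) * f x) m →
        ∫ x, h (τ x) * f x ∂m = ∫ t, h t * p t ∂(m.map τ)) := by
  -- `m` is disintegrated along `τ`; the average `p t` is the conditional expectation of `f` given
  -- `τ = t`. Kernels integrate pointwise representatives, hence the strongly measurable version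
  -- `f'`.
  set κ := ProbabilityTheory.condDistrib id τ m with hκ
  have hdis : (m.map τ) ⊗ₘ κ = m.map fun a => (τ a, a) :=
    ProbabilityTheory.compProd_map_condDistrib (Y := id) aemeasurable_id
  have hpair : Measurable fun a : X => (τ a, a) := hτ.prodMk measurable_id
  set f' := hf.1.mk f with hf'
  have hf'm : StronglyMeasurable f' := hf.1.stronglyMeasurable_mk
  have hff' : f =ᵐ[m] f' := hf.1.ae_eq_mk
  refine ⟨fun t => ∫ x, f' x ∂(κ t), hf'm.integral_kernel, ?_, ?_⟩
  · intro w hw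
    have h1 : ∫⁻ x, w (τ x) * ‖f x‖ₑ ^ 2 ∂m
        = ∫⁻ t, ∫⁻ x, w t * ‖f' x‖ₑ ^ 2 ∂(κ t) ∂(m.map τ) := by
      have hmeas : Measurable fun z : ℝ × X => w z.1 * ‖f' z.2‖ₑ ^ 2 :=
        (hw.comp measurable_fst).mul ((hf'm.measurable.comp measurable_snd).enorm.pow_const 2)
      rw [← Measure.lintegral_compProd hmeas, hdis, lintegral_map hmeas hpair]
      refine lintegral_congr_ae ?_
      filter_upwards [hff'] with x hx
      simp [hx]
    rw [h1]
    refine lintegral_mono fun t => ?_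
    rw [lintegral_const_mul _ (hf'm.measurable.enorm.pow_const 2)]
    gcongr
    -- Jensen on each fibre: `κ t` is a probability measure, so its `L¹` norm is at most its `L²`
    -- norm.
    have h2 := eLpNorm_le_eLpNorm_of_exponent_le (μ := κ t) (p := 1) (q := 2) (f := f')
      (by norm_num) hf'm.aestronglyMeasurable
    rw [eLpNorm_one_eq_lintegral_enorm] at h2
    calc ‖∫ x, f' x ∂(κ t)‖ₑ ^ 2 ≤ (eLpNorm f' 2 (κ t)) ^ 2 := by
          gcongr
          exact (enorm_integral_le_lintegral_enorm _).trans h2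
      _ = ∫⁻ x, ‖f' x‖ₑ ^ 2 ∂(κ t) := by
          have := eLpNorm_nnreal_pow_eq_lintegral (μ := κ t) (f := f') (p := 2) (by norm_num)
          simpa using this
  · intro h hh hint
    have hmeas : StronglyMeasurable fun z : ℝ × X => h z.1 * f' z.2 :=
      (hh.comp measurable_fst).stronglyMeasurable.mul (hf'm.comp_measurable measurable_snd)
    have h1 : (fun x => h (τ x) * f x) =ᵐ[m] fun x => h (τ x) * f' x := by
      filter_upwards [hff'] with x hx
      rw [hx]
    have hint2 : Integrable (fun z : ℝ × X => h z.1 * f' z.2) ((m.map τ) ⊗ₘ κ) := by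
      rw [hdis, integrable_map_measure hmeas.aestronglyMeasurable hpair.aemeasurable]
      exact hint.congr h1
    rw [integral_congr_ae h1]
    have := Measure.integral_compProd hint2
    rw [hdis, integral_map hpair.aemeasurable hmeas.aestronglyMeasurable] at this
    rw [this]
    refine integral_congr_ae (Filter.Eventually.of_forall fun t => ?_)
    exact integral_const_mul (μ := κ t) (h t) f'

/-! ### Radial functions on `ℝ³` -/

theorem hasFDerivAt_norm_E3 {x : E3} (hx : x ≠ 0) :
    HasFDerivAt (fun y : E3 => ‖y‖) (‖x‖⁻¹ • innerSL ℝ x) x := by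
  have h1 : HasFDerivAt (fun y : E3 => ‖y‖ ^ 2) (2 • innerSL ℝ x) x := by
    simpa using (hasFDerivAt_id x).norm_sq
  have hn : ‖x‖ ^ 2 ≠ 0 := by positivity
  have h2 := h1.sqrt hn
  have h3 : (fun y : E3 => √(‖y‖ ^ 2)) = fun y => ‖y‖ := by
    ext y; exact Real.sqrt_sq (norm_nonneg y)
  rw [h3, Real.sqrt_sq (norm_nonneg x)] at h2
  have h4 : (1 / (2 * ‖x‖)) • 2 • innerSL ℝ x = ‖x‖⁻¹ • innerSL ℝ x := by
    rw [← Nat.cast_smul_eq_nsmul ℝ, smul_smul]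
    congr 1
    push_cast
    field_simp
  rwa [h4] at h2

/-- A smooth function of `‖x‖` that is constant near the origin is smooth. -/
theorem contDiff_comp_norm {B : ℝ → ℝ} (hB : ContDiff ℝ ∞ B) {δ c : ℝ} (hδ : 0 < δ)
    (hc : ∀ t, t < δ → B t = c) : ContDiff ℝ ∞ (fun x : E3 => B ‖x‖) := by
  rw [contDiff_iff_contDiffAt]
  intro x
  by_cases hx : x = 0
  · subst hx
    have : (fun x : E3 => B ‖x‖) =ᶠ[nhds 0] fun _ => c := by
      filter_upwards [Metric.ball_mem_nhds (0 : E3) hδ] with y hy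
      exact hc _ (by simpa using hy)
    exact contDiffAt_const.congr_of_eventuallyEq this
  · exact hB.contDiffAt.comp x (contDiffAt_norm ℝ hx)

theorem fderiv_comp_norm {B : ℝ → ℝ} {x v : E3} (hB : DifferentiableAt ℝ B ‖x‖) (hx : x ≠ 0) :
    fderiv ℝ (fun x : E3 => B ‖x‖) x v = deriv B ‖x‖ * (inner ℝ x v / ‖x‖) := by
  have := (hB.hasDerivAt.comp_hasFDerivAt x (hasFDerivAt_norm_E3 hx)).fderiv
  simp only [Function.comp_def] at this
  rw [this]
  simp
  left; field_simp

theorem inner_unitVec (x : E3) (k : Fin 3) : inner ℝ x (unitVec k) = x k := by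
  simp [unitVec, EuclideanSpace.inner_single_right]

theorem volume_real_ball_E3 : (volume : Measure E3).real (Metric.ball 0 1) = Real.pi * 4 / 3 := by
  rw [measureReal_def, EuclideanSpace.volume_ball_fin_three]
  simp
  positivity

theorem integral_comp_norm_E3 {F : Type*} [NormedAddCommGroup F] [NormedSpace ℝ F] (f : ℝ → F) :
    ∫ x : E3, f ‖x‖ = (4 * Real.pi) • ∫ t in Set.Ioi (0 : ℝ), t ^ 2 • f t := by
  rw [integral_fun_norm_addHaar, volume_real_ball_E3]
  simp only [finrank_euclideanSpace, Fintype.card_fin]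
  rw [← Nat.cast_smul_eq_nsmul ℝ, smul_smul]
  congr 1
  push_cast; ring

theorem integrable_comp_norm_E3 {F : Type*} [NormedAddCommGroup F] [NormedSpace ℝ F] {f : ℝ → F} :
    Integrable (fun x : E3 => f ‖x‖) ↔ IntegrableOn (fun t : ℝ => t ^ 2 • f t) (Set.Ioi 0) := by
  rw [integrable_fun_norm_addHaar]
  simp

theorem setIntegral_ball_comp_norm {F : Type*} [NormedAddCommGroup F] [NormedSpace ℝ F]
    (f : ℝ → F) (L : ℝ) :
    ∫ x in Metric.ball (0 : E3) L, f ‖x‖ = (4 * Real.pi) • ∫ t in Set.Ioo 0 L, t ^ 2 • f t := by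
  rw [← integral_indicator measurableSet_ball]
  have h1 : (fun x : E3 => (Metric.ball (0 : E3) L).indicator (fun x => f ‖x‖) x)
      = fun x : E3 => (Set.Iio L).indicator f ‖x‖ := by
    ext x
    by_cases h : ‖x‖ < L <;> simp [Set.indicator, h]
  rw [h1, integral_comp_norm_E3]
  congr 1
  have h2 : (fun t : ℝ => t ^ 2 • (Set.Iio L).indicator f t)
      = (Set.Iio L).indicator fun t => t ^ 2 • f t := by
    ext t
    by_cases h : t < L <;> simp [Set.indicator, h]
  rw [h2, setIntegral_indicator measurableSet_Iio]
  congr 1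

/-- A property of the norm that holds almost everywhere on `(0, ∞)` holds almost everywhere
on `ℝ³`. -/
theorem ae_comp_norm_E3 {s : Set ℝ} (h : volume (s ∩ Set.Ioi 0) = 0) :
    ∀ᵐ x : E3, ‖x‖ ∉ s := by
  have h1 : ∫ x : E3, (s.indicator (fun _ => (1 : ℝ))) ‖x‖ = 0 := by
    rw [integral_comp_norm_E3]
    have : ∫ t in Set.Ioi (0 : ℝ), t ^ 2 • s.indicator (fun _ => (1 : ℝ)) t = 0 := by
      refine integral_eq_zero_of_ae ?_
      rw [Filter.EventuallyEq, ae_restrict_iff' measurableSet_Ioi]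
      filter_upwards [measure_eq_zero_iff_ae_notMem.1 h] with t ht h0
      have : t ∉ s := fun h => ht ⟨h, h0⟩
      simp [this]
    rw [this, smul_zero]
  have h2 : Integrable (fun x : E3 => (s.indicator (fun _ => (1 : ℝ))) ‖x‖) := by
    rw [integrable_comp_norm_E3]
    refine (integrableOn_zero (ε' := ℝ)).congr_fun_ae ?_
    rw [Filter.EventuallyEq, ae_restrict_iff' measurableSet_Ioi]
    filter_upwards [measure_eq_zero_iff_ae_notMem.1 h] with t ht h0
    have : t ∉ s := fun h => ht ⟨h, h0⟩
    simp [this]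
  rw [integral_eq_zero_iff_of_nonneg (fun x => Set.indicator_nonneg (by simp) _) h2] at h1
  filter_upwards [h1] with x hx hxs
  simp [hxs] at hx

/-! ### Radial functions in `D¹(ℝ³)` -/

theorem integrableOn_ball_comp_norm {F : Type*} [NormedAddCommGroup F] [NormedSpace ℝ F]
    {f : ℝ → F} {L : ℝ} :
    IntegrableOn (fun x : E3 => f ‖x‖) (Metric.ball 0 L) ↔
      IntegrableOn (fun t : ℝ => t ^ 2 • f t) (Set.Ioo 0 L) := by
  rw [integrableOn_fun_norm_addHaar]
  simp

theorem volume_real_ball_radius {t : ℝ} (ht : 0 < t) :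
    (volume : Measure E3).real (Metric.ball 0 t) = t ^ 3 * (Real.pi * 4 / 3) := by
  rw [measureReal_def, EuclideanSpace.volume_ball_fin_three, ENNReal.toReal_mul,
    ENNReal.toReal_pow, ENNReal.toReal_ofReal ht.le, ENNReal.toReal_ofReal (by positivity)]

/-- The layer-cake kernel `1_{‖x‖ < t} b(t)`. -/
def layerKernel (b : ℝ → ℂ) (z : E3 × ℝ) : ℂ := {z : E3 × ℝ | ‖z.1‖ < z.2}.indicator (fun z => b z.2) z

theorem stronglyMeasurable_layerKernel {b : ℝ → ℂ} (hb : StronglyMeasurable b) :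
    StronglyMeasurable (layerKernel b) :=
  (hb.comp_measurable measurable_snd).indicator
    (measurableSet_lt (measurable_norm.comp measurable_fst) measurable_snd)

theorem layerKernel_fst (b : ℝ → ℂ) (x : E3) :
    (fun t => layerKernel b (x, t)) = (Set.Ioi ‖x‖).indicator b := by
  ext t; simp [layerKernel, Set.indicator]

theorem layerKernel_snd (b : ℝ → ℂ) (t : ℝ) :
    (fun x => layerKernel b (x, t)) = (Metric.ball 0 t).indicator fun _ => b t := by
  ext x; simp [layerKernel, Set.indicator]

/-- By Tonelli: the ball of radius `t` has volume `4πt³/3`, so the total mass of the kernel is a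
third of the integral of `|b(‖x‖)| ‖x‖`. -/
theorem integrable_layerKernel {b : ℝ → ℂ} (hb : StronglyMeasurable b)
    (hsupp : ∀ t, t ≤ 0 → b t = 0) (hint : Integrable fun x : E3 => ‖b ‖x‖‖ * ‖x‖) :
    Integrable (layerKernel b) (volume.prod volume) := by
  rw [integrable_prod_iff' (stronglyMeasurable_layerKernel hb).aestronglyMeasurable]
  constructor
  · refine Filter.Eventually.of_forall fun t => ?_
    rw [layerKernel_snd, integrable_indicator_iff measurableSet_ball]
    exact integrableOn_const measure_ball_lt_top.ne
  · have h1 : ∀ t : ℝ, ∫ x : E3, ‖layerKernel b (x, t)‖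
        = (Set.Ioi 0).indicator (fun t => (Real.pi * 4 / 3) * (t ^ 2 • (‖b t‖ * t))) t := by
      intro t
      have h2 : ∀ x : E3, ‖layerKernel b (x, t)‖ = (Metric.ball 0 t).indicator (fun _ => ‖b t‖) x := by
        intro x
        rw [show layerKernel b (x, t) = (Metric.ball 0 t).indicator (fun _ => b t) x from
          congrFun (layerKernel_snd b t) x, norm_indicator_eq_indicator_norm]
      simp_rw [h2]
      rw [integral_indicator measurableSet_ball, setIntegral_const]
      by_cases ht : 0 < t
      · rw [volume_real_ball_radius ht, Set.indicator_of_mem (by exact ht)]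
        simp only [smul_eq_mul]; ring
      · rw [hsupp t (not_lt.1 ht)]; simp [ht]
    simp_rw [h1]
    rw [integrable_indicator_iff measurableSet_Ioi]
    exact ((integrable_comp_norm_E3 (f := fun t => ‖b t‖ * t)).1 hint).integrable.const_mul _

/-- Fubini for the layer-cake kernel. It moves the tail integral of `b` onto integrals of `D` over
balls; for `D` a partial derivative these are boundary fluxes. -/
theorem integral_mul_layer {b : ℝ → ℂ}
    (hK : Integrable (layerKernel b) (volume.prod volume)) {D : E3 → ℂ} (hD : Continuous D)
    {C : ℝ} (hC : ∀ x, ‖D x‖ ≤ C) :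
    ∫ x : E3, D x * ∫ t in Set.Ioi ‖x‖, b t = ∫ t, b t * ∫ x in Metric.ball (0 : E3) t, D x := by
  have h1 : Integrable (fun z : E3 × ℝ => D z.1 * layerKernel b z) (volume.prod volume) :=
    hK.bdd_mul (c := C) (hD.comp continuous_fst).aestronglyMeasurable
      (Filter.Eventually.of_forall fun z => hC z.1)
  have h2 := integral_integral_swap (f := fun x t => D x * layerKernel b (x, t)) h1
  calc _ = ∫ x : E3, ∫ t, D x * layerKernel b (x, t) := by
        refine integral_congr_ae (Filter.Eventually.of_forall fun x => ?_)
        simp only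
        rw [integral_const_mul, layerKernel_fst, integral_indicator measurableSet_Ioi]
    _ = _ := by
        rw [h2]
        refine integral_congr_ae (Filter.Eventually.of_forall fun t => ?_)
        simp only
        have : (fun x => D x * layerKernel b (x, t))
            = (Metric.ball 0 t).indicator fun x => b t * D x := by
          ext x
          rw [show layerKernel b (x, t) = (Metric.ball 0 t).indicator (fun _ => b t) x from
            congrFun (layerKernel_snd b t) x]
          by_cases h : x ∈ Metric.ball (0 : E3) t
          · simp only [Set.indicator_of_mem h]; ring
          · simp only [Set.indicator_of_notMem h]; ring
        rw [this, integral_indicator measurableSet_ball, integral_const_mul]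

theorem hasDerivAt_integral_Ioi {β : ℝ → ℝ} (hβ : Continuous β) (hβi : Integrable β) (s : ℝ) :
    HasDerivAt (fun u => ∫ t in Set.Ioi u, β t) (-β s) s := by
  have h0 : ∀ u, ∫ t in Set.Ioi u, β t = (∫ t in Set.Ioi 0, β t) - ∫ t in (0 : ℝ)..u, β t := by
    intro u
    have h1 := intervalIntegral.integral_Iic_add_Ioi (b := u) hβi.integrableOn hβi.integrableOn
    have h2 := intervalIntegral.integral_Iic_add_Ioi (b := (0 : ℝ)) hβi.integrableOn
      hβi.integrableOn
    have h3 := intervalIntegral.integral_Iic_sub_Iic (a := 0) (b := u) hβi.integrableOn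
      hβi.integrableOn
    linarith
  have h1 : HasDerivAt (fun u => ∫ t in (0 : ℝ)..u, β t) (β s) s :=
    intervalIntegral.integral_hasDerivAt_right (hβ.intervalIntegrable _ _)
      (hβ.stronglyMeasurableAtFilter _ _) hβ.continuousAt
  rw [funext h0]
  exact h1.const_sub _

theorem contDiff_integral_Ioi {β : ℝ → ℝ} (hβ : ContDiff ℝ ∞ β) (hβi : Integrable β) :
    ContDiff ℝ ∞ (fun u => ∫ t in Set.Ioi u, β t) := by
  rw [contDiff_infty_iff_deriv]
  refine ⟨fun s => (hasDerivAt_integral_Ioi hβ.continuous hβi s).differentiableAt, ?_⟩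
  rw [show deriv (fun u => ∫ t in Set.Ioi u, β t) = fun s => -β s from
    funext fun s => (hasDerivAt_integral_Ioi hβ.continuous hβi s).deriv]
  exact hβ.neg

theorem exists_pos_forall_lt_eq_zero {β : ℝ → ℝ} {L : ℝ} (hβs : tsupport β ⊆ Set.Ioo 0 L) :
    ∃ δ > 0, ∀ t, t < δ → β t = 0 := by
  have h0 : (0 : ℝ) ∉ tsupport β := fun h => lt_irrefl _ (hβs h).1
  have : (tsupport β)ᶜ ∈ nhds (0 : ℝ) := (isClosed_tsupport β).isOpen_compl.mem_nhds h0
  obtain ⟨δ, hδ, hsub⟩ := Metric.mem_nhds_iff.1 this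
  refine ⟨δ, hδ, fun t ht => ?_⟩
  by_contra hne
  have hmem : t ∈ tsupport β := subset_tsupport _ hne
  exact hsub (by simpa [abs_of_pos (hβs hmem).1] using ht) hmem

/-- Integration by parts against a smooth radial function with derivative `-β(‖x‖) x_k/‖x‖`. -/
theorem integral_fderiv_mul_layer_smooth {φ : E3 → ℝ} (hφ : IsTestFunction Set.univ φ) (k : Fin 3)
    {β : ℝ → ℝ} (hβ : ContDiff ℝ ∞ β) (hβc : HasCompactSupport β) {L : ℝ}
    (hβs : tsupport β ⊆ Set.Ioo 0 L) :
    ∫ x : E3, fderiv ℝ φ x (unitVec k) * ∫ t in Set.Ioi ‖x‖, β t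
      = ∫ x : E3, φ x * (β ‖x‖ * (x k / ‖x‖)) := by
  have hβi : Integrable β := hβ.continuous.integrable_of_hasCompactSupport hβc
  set B : ℝ → ℝ := fun s => ∫ t in Set.Ioi s, β t with hBdef
  have hBd : ∀ s, HasDerivAt B (-β s) s := hasDerivAt_integral_Ioi hβ.continuous hβi
  have hBs : ContDiff ℝ ∞ B := contDiff_integral_Ioi hβ hβi
  obtain ⟨δ, hδ, hδβ⟩ := exists_pos_forall_lt_eq_zero hβs
  -- The profile is constant near `0`, so composing it with the norm gives a function that is smooth
  -- also at the origin, and classical integration by parts applies.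
  have hBconst : ∀ t, t < δ → B t = ∫ t, β t := by
    intro t ht
    have h1 := intervalIntegral.integral_Iic_add_Ioi (b := t) hβi.integrableOn hβi.integrableOn
    have h2 : ∫ s in Set.Iic t, β s = 0 :=
      setIntegral_eq_zero_of_forall_eq_zero fun s (hs : s ≤ t) => hδβ s (lt_of_le_of_lt hs ht)
    simp only [hBdef]
    linarith
  have hg := contDiff_comp_norm hBs hδ hBconst
  have hφ' : Continuous fun x => fderiv ℝ φ x (unitVec k) :=
    (hφ.smooth.continuous_fderiv (by simp)).clm_apply continuous_const
  have hg' : Continuous fun x => fderiv ℝ (fun x : E3 => B ‖x‖) x (unitVec k) :=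
    (hg.continuous_fderiv (by simp)).clm_apply continuous_const
  have hcφ' : HasCompactSupport fun x => fderiv ℝ φ x (unitVec k) :=
    hφ.compact.fderiv_apply (𝕜 := ℝ) _
  have key := integral_mul_fderiv_eq_neg_fderiv_mul_of_integrable (μ := (volume : Measure E3))
    (f := φ) (g := fun x => B ‖x‖) (v := unitVec k) (𝕜 := ℝ)
    ((hφ'.mul hg.continuous).integrable_of_hasCompactSupport hcφ'.mul_right)
    ((hφ.smooth.continuous.mul hg').integrable_of_hasCompactSupport hφ.compact.mul_right)
    ((hφ.smooth.continuous.mul hg.continuous).integrable_of_hasCompactSupport hφ.compact.mul_right)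
    (fun x _ => (hφ.smooth.differentiable (by simp)) x)
    (fun x _ => (hg.differentiable (by simp)) x)
  rw [eq_neg_iff_add_eq_zero, add_comm, ← eq_neg_iff_add_eq_zero, ← integral_neg] at key
  rw [key]
  refine integral_congr_ae ?_
  filter_upwards [Measure.ae_ne volume (0 : E3)] with x hx
  rw [fderiv_comp_norm (hBd _).differentiableAt hx, (hBd _).deriv, inner_unitVec]
  ring

theorem integrable_radial_of_memLp {b : ℝ → ℂ} {L : ℝ} (hsupp : ∀ t, L ≤ t → b t = 0)
    (hb : MemLp (fun x : E3 => b ‖x‖) 2) : Integrable fun x : E3 => b ‖x‖ := by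
  rw [← integrableOn_iff_integrable_of_support_subset (s := Metric.ball 0 L)]
  · have : IsFiniteMeasure ((volume : Measure E3).restrict (Metric.ball 0 L)) :=
      ⟨by simpa using measure_ball_lt_top (μ := (volume : Measure E3)) (x := 0) (r := L)⟩
    exact (hb.restrict _).integrable (by norm_num)
  · intro x hx
    by_contra h
    exact hx (hsupp _ (by simpa using h))

theorem integrable_norm_mul_norm_of_memLp {b : ℝ → ℂ} {L : ℝ} (hsupp : ∀ t, L ≤ t → b t = 0)
    (hb : MemLp (fun x : E3 => b ‖x‖) 2) : Integrable fun x : E3 => ‖b ‖x‖‖ * ‖x‖ := by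
  have h1 := (integrable_radial_of_memLp hsupp hb).norm.const_mul L
  refine h1.mono' (hb.1.norm.mul continuous_norm.aestronglyMeasurable) ?_
  refine Filter.Eventually.of_forall fun x => ?_
  rw [Real.norm_of_nonneg (by positivity), mul_comm]
  by_cases hx : L ≤ ‖x‖
  · simp [hsupp _ hx]
  · gcongr
    exact (not_le.1 hx).le

/-- A radial function whose radial derivative `-b` is square integrable and supported in `(0, L)`
belongs to `D¹(ℝ³)`. -/
theorem memD1_radial {b : ℝ → ℂ} {L : ℝ} (hbm : StronglyMeasurable b)
    (hsupp : ∀ t, t ∉ Set.Ioo 0 L → b t = 0) (hb : MemLp (fun x : E3 => b ‖x‖) 2) :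
    MemD1 unitVec (fun x : E3 => ∫ t in Set.Ioi ‖x‖, b t)
      (fun k x => -(b ‖x‖ * ((x k / ‖x‖ : ℝ) : ℂ))) := by
  have hs0 : ∀ t, t ≤ 0 → b t = 0 := fun t ht => hsupp t fun h => absurd h.1 (not_lt.2 ht)
  have hsL : ∀ t, L ≤ t → b t = 0 := fun t ht => hsupp t fun h => absurd h.2 (not_lt.2 ht)
  have hK := integrable_layerKernel hbm hs0 (integrable_norm_mul_norm_of_memLp hsL hb)
  have hgint : Integrable (fun x : E3 => ∫ t in Set.Ioi ‖x‖, b t) := by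
    refine hK.integral_prod_left.congr (Filter.Eventually.of_forall fun x => ?_)
    simp only
    rw [layerKernel_fst, integral_indicator measurableSet_Ioi]
  have hcoord : ∀ (k : Fin 3) (x : E3), |x k / ‖x‖| ≤ 1 := by
    intro k x
    rw [abs_div, abs_norm]
    refine div_le_one_of_le₀ ?_ (norm_nonneg _)
    simpa using PiLp.norm_apply_le x k
  have hcm : ∀ k : Fin 3, Measurable fun x : E3 => x k / ‖x‖ := fun k => by fun_prop
  refine ⟨hgint.locallyIntegrable, fun t ht => hgint.measure_norm_gt_lt_top ht, fun k => ?_,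
    fun k φ hφ => ?_⟩
  · refine hb.mono ((hb.1.mul (Complex.measurable_ofReal.comp (hcm k)).aestronglyMeasurable).neg) ?_
    refine Filter.Eventually.of_forall fun x => ?_
    rw [norm_neg, norm_mul, Complex.norm_real, Real.norm_eq_abs]
    exact mul_le_of_le_one_right (norm_nonneg _) (hcoord k x)
  · simp only [Measure.restrict_univ, Complex.real_smul]
    set m : Measure E3 := volume.restrict (Metric.ball 0 L) with hm
    have : IsFiniteMeasure m := ⟨by
      simpa [hm] using measure_ball_lt_top (μ := (volume : Measure E3)) (x := 0) (r := L)⟩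
    obtain ⟨Cφ, hCφ⟩ := hφ.compact.exists_bound_of_continuous hφ.smooth.continuous
    have hφ' : Continuous fun x => fderiv ℝ φ x (unitVec k) :=
      (hφ.smooth.continuous_fderiv (by simp)).clm_apply continuous_const
    have hcφ' : HasCompactSupport fun x => fderiv ℝ φ x (unitVec k) :=
      hφ.compact.fderiv_apply (𝕜 := ℝ) _
    obtain ⟨CD, hCD⟩ := hcφ'.exists_bound_of_continuous hφ'
    set D : E3 → ℂ := fun x => ((fderiv ℝ φ x (unitVec k) : ℝ) : ℂ) with hDdef
    have hDc : Continuous D := Complex.continuous_ofReal.comp hφ'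
    have hDi : Integrable D := (hφ'.integrable_of_hasCompactSupport hcφ').ofReal
    have hDb : ∀ x, ‖D x‖ ≤ CD := fun x => by simpa [hDdef] using hCD x
    -- `f` is the flux density of `φ` in direction `k` through spheres about the origin; its fibre
    -- average `p` is the mean over the sphere.
    set f : E3 → ℂ := fun x => ((φ x * (x k / ‖x‖) : ℝ) : ℂ) with hfdef
    have hfm : Measurable f :=
      Complex.measurable_ofReal.comp (hφ.smooth.continuous.measurable.mul (hcm k))
    have hfb : ∀ x, ‖f x‖ ≤ Cφ := fun x => by
      rw [hfdef, Complex.norm_real, norm_mul, Real.norm_eq_abs (_ / _)]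
      exact (mul_le_of_le_one_right (norm_nonneg _) (hcoord k x)).trans (hCφ x)
    have hf2 : MemLp f 2 m := MemLp.of_bound hfm.aestronglyMeasurable Cφ
      (Filter.Eventually.of_forall hfb)
    obtain ⟨p, hpm, hpJ, hpI⟩ := exists_fiber_average m measurable_norm hf2
    have hpolar : ∀ h : ℝ → ℂ, Measurable h → Integrable (fun x => h ‖x‖ * f x) m →
        ∫ x, h ‖x‖ * f x ∂m = ∫ t in Set.Ioo 0 L, h t * ((4 * Real.pi * t ^ 2 : ℝ) * p t) := by
      intro h hh hi
      rw [hpI h hh hi, integral_map (f := fun t => h t * p t) measurable_norm.aemeasurable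
        (hh.stronglyMeasurable.mul hpm).aestronglyMeasurable,
        setIntegral_ball_comp_norm (fun t => h t * p t) L, ← integral_smul]
      refine integral_congr_ae (Filter.Eventually.of_forall fun t => ?_)
      simp only [Complex.real_smul]; push_cast; ring
    have hp2 : MemLp (fun x : E3 => p ‖x‖) 2 m := by
      refine ⟨(hpm.comp_measurable measurable_norm).aestronglyMeasurable, ?_⟩
      have h1 := hpJ (fun _ => 1) measurable_const
      rw [lintegral_map (by fun_prop (disch := exact hpm.measurable)) measurable_norm] at h1
      have h2 := hf2.2
      rw [eLpNorm_lt_top_iff_lintegral_rpow_enorm_lt_top (by norm_num) (by norm_num)] at h2 ⊢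
      simp only [one_mul] at h1
      simpa using h1.trans_lt (by simpa using h2)
    have hpint : IntegrableOn (fun t : ℝ => t ^ 2 • p t) (Set.Ioo 0 L) :=
      integrableOn_ball_comp_norm.1 (hp2.integrable (by norm_num))
    set F : ℝ → ℂ := fun t => ∫ x in Metric.ball (0 : E3) t, D x with hFdef
    have hFm : StronglyMeasurable F := by
      have h1 : StronglyMeasurable fun z : ℝ × E3 =>
          {z : ℝ × E3 | ‖z.2‖ < z.1}.indicator (fun z => D z.2) z :=
        (hDc.stronglyMeasurable.comp_measurable measurable_snd).indicator
          (measurableSet_lt (measurable_norm.comp measurable_snd) measurable_fst)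
      have h2 := h1.integral_prod_right' (ν := (volume : Measure E3))
      convert h2 using 1
      ext t
      simp only [hFdef]
      rw [← integral_indicator measurableSet_ball]
      congr 1 with x
      simp [Set.indicator]
    have hFb : ∀ t, ‖F t‖ ≤ ∫ x, ‖D x‖ := fun t =>
      (norm_integral_le_integral_norm _).trans
        (setIntegral_le_integral hDi.norm (Filter.Eventually.of_forall fun x => norm_nonneg _))
    have hFint : IntegrableOn F (Set.Ioo 0 L) :=
      Measure.integrableOn_of_bounded (by simp) hFm.aestronglyMeasurable
        (Filter.Eventually.of_forall hFb)
    have hpint' : IntegrableOn (fun t => ((4 * Real.pi * t ^ 2 : ℝ) : ℂ) * p t) (Set.Ioo 0 L) := by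
      refine (hpint.const_mul (4 * Real.pi : ℂ)).congr ?_
      refine Filter.Eventually.of_forall fun t => ?_
      simp only [Complex.real_smul]; push_cast; ring
    have hdiff : IntegrableOn (fun t => F t - (4 * Real.pi * t ^ 2 : ℝ) * p t) (Set.Ioo 0 L) :=
      hFint.sub hpint'
    -- The divergence theorem on almost every ball: the integral of `∂_k φ` over the ball equals the
    -- flux `4πt² p(t)`. Smooth `β` suffice to identify the two functions of `t`; the identity then
    -- integrates against the merely square integrable `b`.
    have hFp : ∀ᵐ t : ℝ, t ∈ Set.Ioo 0 L → F t - (4 * Real.pi * t ^ 2 : ℝ) * p t = 0 := by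
      refine isOpen_Ioo.ae_eq_zero_of_integral_contDiff_smul_eq_zero hdiff.locallyIntegrableOn ?_
      intro β hβ hβc hβs
      have hβ0 : ∀ t, t ∉ Set.Ioo 0 L → β t = 0 := fun t ht => by
        by_contra h
        exact ht (hβs (subset_tsupport _ h))
      obtain ⟨Cβ, hCβ⟩ := hβc.exists_bound_of_continuous hβ.continuous
      have hβ2 : MemLp (fun x : E3 => ((β ‖x‖ : ℝ) : ℂ)) 2 := by
        have h1 : Continuous fun x : E3 => ((β ‖x‖ : ℝ) : ℂ) :=
          Complex.continuous_ofReal.comp (hβ.continuous.comp continuous_norm)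
        refine h1.memLp_of_hasCompactSupport (HasCompactSupport.intro
          (isCompact_closedBall (0 : E3) L) fun x hx => ?_)
        rw [hβ0 ‖x‖ fun h => hx (by simpa using h.2.le), Complex.ofReal_zero]
      have hβm : StronglyMeasurable fun t => ((β t : ℝ) : ℂ) :=
        (Complex.continuous_ofReal.comp hβ.continuous).stronglyMeasurable
      have hKβ := integrable_layerKernel (b := fun t => ((β t : ℝ) : ℂ)) hβm
        (fun t ht => by rw [hβ0 t fun h => absurd h.1 (not_lt.2 ht), Complex.ofReal_zero])
        (integrable_norm_mul_norm_of_memLp (b := fun t => ((β t : ℝ) : ℂ)) (L := L)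
          (fun t ht => by rw [hβ0 t fun h => absurd h.2 (not_lt.2 ht), Complex.ofReal_zero]) hβ2)
      have e1 := integral_mul_layer hKβ hDc hDb
      have e2 := integral_fderiv_mul_layer_smooth hφ k hβ hβc hβs
      have e3 := hpolar (fun t => ((β t : ℝ) : ℂ)) hβm.measurable (by
        refine (hf2.integrable (by norm_num)).bdd_mul (c := Cβ)
          (hβm.comp_measurable measurable_norm).aestronglyMeasurable ?_
        exact Filter.Eventually.of_forall fun x => by simpa using hCβ ‖x‖)
      have e4 : ∫ x, D x * ∫ t in Set.Ioi ‖x‖, ((β t : ℝ) : ℂ)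
          = ∫ x, ((β ‖x‖ : ℝ) : ℂ) * f x ∂m := by
        rw [hm, setIntegral_eq_integral_of_forall_compl_eq_zero]
        · simp only [hDdef, integral_complex_ofReal, ← Complex.ofReal_mul, hfdef]
          rw [e2]
          congr 2 with x
          ring
        · intro x hx
          rw [hβ0 ‖x‖ fun h => hx (by simpa using h.2)]
          simp
      rw [e4, e3] at e1
      have e5 : ∫ t, ((β t : ℝ) : ℂ) * F t = ∫ t in Set.Ioo 0 L, ((β t : ℝ) : ℂ) * F t := by
        rw [setIntegral_eq_integral_of_forall_compl_eq_zero]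
        intro t ht
        rw [hβ0 t ht]; simp
      have e6 : ∫ t, β t • (F t - (4 * Real.pi * t ^ 2 : ℝ) * p t)
          = ∫ t in Set.Ioo 0 L, β t • (F t - (4 * Real.pi * t ^ 2 : ℝ) * p t) := by
        rw [setIntegral_eq_integral_of_forall_compl_eq_zero]
        intro t ht
        rw [hβ0 t ht]; simp
      rw [e6]
      simp only [Complex.real_smul, mul_sub]
      rw [integral_sub, ← e5, ← e1, sub_self]
      · exact hFint.bdd_mul (c := Cβ) hβm.aestronglyMeasurable
          (Filter.Eventually.of_forall fun x => by simpa using hCβ x)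
      · exact hpint'.bdd_mul (c := Cβ) hβm.aestronglyMeasurable
          (Filter.Eventually.of_forall fun x => by simpa using hCβ x)
    have e1 := integral_mul_layer hK hDc hDb
    have e3 := hpolar b hbm.measurable (by
      refine Integrable.mul_bdd (c := Cφ)
        ((integrable_radial_of_memLp hsL hb).restrict) hfm.aestronglyMeasurable
        (Filter.Eventually.of_forall hfb))
    have e4 : ∫ t, b t * F t = ∫ t in Set.Ioo 0 L, b t * F t := by
      rw [setIntegral_eq_integral_of_forall_compl_eq_zero]
      intro t ht
      rw [hsupp t ht]; simp
    rw [e1, e4]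
    have e5 : ∫ t in Set.Ioo 0 L, b t * F t
        = ∫ t in Set.Ioo 0 L, b t * ((4 * Real.pi * t ^ 2 : ℝ) * p t) := by
      refine setIntegral_congr_ae measurableSet_Ioo ?_
      filter_upwards [hFp] with t ht hmem
      rw [sub_eq_zero.1 (ht hmem)]
    rw [e5, ← e3, hm, setIntegral_eq_integral_of_forall_compl_eq_zero, ← integral_neg]
    · refine integral_congr_ae (Filter.Eventually.of_forall fun x => ?_)
      simp only [hfdef]; push_cast; ring
    · intro x hx
      rw [hsL ‖x‖ (by simpa using hx)]; simp

/-! ### The scattering length bounds the energy of radial profiles -/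

/-- A smooth function supported away from the origin, divided by `t ^ 3`, is smooth. -/
theorem contDiff_div_cube {η : ℝ → ℝ} (hη : ContDiff ℝ ∞ η) {δ : ℝ} (hδ : 0 < δ)
    (h0 : ∀ t, t < δ → η t = 0) : ContDiff ℝ ∞ fun t => η t / t ^ 3 := by
  rw [contDiff_iff_contDiffAt]
  intro t
  by_cases ht : t < δ
  · have : (fun t => η t / t ^ 3) =ᶠ[nhds t] fun _ => 0 := by
      filter_upwards [Iio_mem_nhds ht] with s hs
      rw [h0 s hs, zero_div]
    exact contDiffAt_const.congr_of_eventuallyEq this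
  · have h3 : t ^ 3 ≠ 0 := pow_ne_zero _ (by linarith [not_lt.1 ht])
    exact hη.contDiffAt.div (contDiffAt_id.pow 3) h3

theorem tsupport_subset_Icc {η : ℝ → ℝ} {c d : ℝ} (h1 : ∀ t, t < c → η t = 0)
    (h2 : ∀ t, d < t → η t = 0) : tsupport η ⊆ Set.Icc c d := by
  refine closure_minimal (fun t ht => ?_) isClosed_Icc
  by_contra h
  rw [Set.mem_Icc, not_and_or, not_le, not_le] at h
  rcases h with h | h
  · exact ht (h1 t h)
  · exact ht (h2 t h)

/-- The radial field `ζ(‖x‖) x` has divergence `3ζ + tζ' = t⁻² (t³ζ)'`. Taking `ζ = η/t³` therefore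
prescribes the divergence as `η'` against the radial measure. -/
theorem deriv_div_cube {η : ℝ → ℝ} (hη : ContDiff ℝ ∞ η) {t : ℝ} (ht : 0 < t) :
    t ^ 2 * (3 * (η t / t ^ 3) + t * deriv (fun t => η t / t ^ 3) t) = deriv η t := by
  have h1 : HasDerivAt η (deriv η t) t := ((hη.differentiable (by simp)) t).hasDerivAt
  have h2 := (h1.div (hasDerivAt_pow 3 t) (by positivity)).deriv
  have h3 : deriv (fun t => η t / t ^ 3) t = deriv (η / fun t => t ^ 3) t := rfl
  rw [h3, h2]
  field_simp
  push_cast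
  ring

/-- A weak form of the one-dimensional fundamental theorem of calculus: if `q` is the weak radial
derivative of the profile `p` on `(0, L)`, then `p` is the average of `p` with weight `w` minus the
integral of `q` with the cutoff `∫_t^∞ w`. -/
theorem radial_profile_eq {L : ℝ} (hL : 0 < L) {w : ℝ → ℝ} (hw : ContDiff ℝ ∞ w)
    (hws : ∀ t, t ∉ Set.Icc (5 * L / 8) (7 * L / 8) → w t = 0) (hwi : ∫ t, w t = 1)
    {p q : ℝ → ℂ} (hp : IntegrableOn (fun x : E3 => p ‖x‖) (Metric.ball 0 L))
    (hid : ∀ ζ : ℝ → ℝ, ContDiff ℝ ∞ ζ → HasCompactSupport ζ → tsupport ζ ⊆ Set.Ioo 0 L →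
      ∫ x in Metric.ball (0 : E3) L, ((3 * ζ ‖x‖ + ‖x‖ * deriv ζ ‖x‖ : ℝ) : ℂ) * p ‖x‖
        = -∫ x in Metric.ball (0 : E3) L, ((ζ ‖x‖ * ‖x‖ : ℝ) : ℂ) * q ‖x‖)
    {b : ℝ → ℂ} (hbdef : b = (Set.Ioo 0 L).indicator fun t => ((∫ s in Set.Ioi t, w s : ℝ) : ℂ) * q t)
    (hK : Integrable (layerKernel b) (volume.prod volume))
    (hP : IntegrableOn (fun x : E3 => ∫ t in Set.Ioi ‖x‖, b t) (Metric.ball 0 L)) :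
    ∀ᵐ t : ℝ, t ∈ Set.Ioo 0 (L / 2) →
      p t - (∫ t in Set.Ioo 0 L, (w t : ℂ) * p t) + ∫ s in Set.Ioi t, b s = 0 := by
  set m₀ := ∫ t in Set.Ioo 0 L, (w t : ℂ) * p t with hm₀
  set M : ℝ → ℝ := fun t => ∫ s in Set.Ioi t, w s with hM
  have hwc : HasCompactSupport w := HasCompactSupport.intro isCompact_Icc hws
  have hwint : Integrable w := hw.continuous.integrable_of_hasCompactSupport hwc
  have hMs : ContDiff ℝ ∞ M := contDiff_integral_Ioi hw hwint
  have hMd : ∀ t, HasDerivAt M (-w t) t := hasDerivAt_integral_Ioi hw.continuous hwint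
  have hM0 : ∀ t, 7 * L / 8 ≤ t → M t = 0 := fun t ht =>
    setIntegral_eq_zero_of_forall_eq_zero fun s (hs : t < s) => hws s fun h => by linarith [h.2]
  have hM1 : ∀ t, t ≤ 5 * L / 8 → M t = 1 := fun t ht => by
    rw [← hwi]
    refine setIntegral_eq_integral_of_forall_compl_eq_zero fun s hs => ?_
    by_cases h : s = 5 * L / 8
    · have hc : Filter.Tendsto w (nhdsWithin s (Set.Iio s)) (nhds (w s)) :=
        hw.continuous.continuousAt.tendsto.mono_left nhdsWithin_le_nhds
      have hz : Filter.Tendsto w (nhdsWithin s (Set.Iio s)) (nhds 0) := by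
        refine tendsto_const_nhds.congr' ?_
        filter_upwards [self_mem_nhdsWithin] with u hu
        rw [hws u fun h' => by have := h'.1; rw [← h] at this; exact absurd hu (not_lt.2 this)]
      exact tendsto_nhds_unique hc hz
    · exact hws s fun h' => h (le_antisymm ((not_lt.1 hs).trans ht) h'.1)
  have hp2 : IntegrableOn (fun t : ℝ => t ^ 2 • p t) (Set.Ioo 0 L) :=
    integrableOn_ball_comp_norm.1 hp
  have hP2 : IntegrableOn (fun t : ℝ => t ^ 2 • ∫ s in Set.Ioi t, b s) (Set.Ioo 0 L) :=
    integrableOn_ball_comp_norm.1 hP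
  have ht2 : IntegrableOn (fun t : ℝ => ((t ^ 2 : ℝ) : ℂ) * m₀) (Set.Ioo 0 L) :=
    (Continuous.integrableOn_Icc (by fun_prop)).mono_set Set.Ioo_subset_Icc_self
  have hfint : IntegrableOn (fun t : ℝ => ((t ^ 2 : ℝ) : ℂ) * (p t - m₀ + ∫ s in Set.Ioi t, b s))
      (Set.Ioo 0 L) := by
    refine ((hp2.sub ht2).add hP2).congr (Filter.Eventually.of_forall fun t => ?_)
    simp only [Pi.add_apply, Pi.sub_apply, Complex.real_smul]; ring
  have hsubset : Set.Ioo 0 (L / 2) ⊆ Set.Ioo 0 L := Set.Ioo_subset_Ioo_right (by linarith)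
  have hae : ∀ᵐ t : ℝ, t ∈ Set.Ioo 0 (L / 2) →
      ((t ^ 2 : ℝ) : ℂ) * (p t - m₀ + ∫ s in Set.Ioi t, b s) = 0 := by
    refine isOpen_Ioo.ae_eq_zero_of_integral_contDiff_smul_eq_zero
      (hfint.mono_set hsubset).locallyIntegrableOn ?_
    intro x hx hxc hxs
    have hx0 : ∀ t, t ∉ Set.Ioo 0 (L / 2) → x t = 0 := fun t ht => by
      by_contra h
      exact ht (hxs (subset_tsupport _ h))
    obtain ⟨δ, hδ, hxδ⟩ := exists_pos_forall_lt_eq_zero hxs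
    obtain ⟨Cx, hCx⟩ := hxc.exists_bound_of_continuous hx.continuous
    set y : ℝ → ℝ := fun t => t ^ 2 * x t with hy
    have hys : ContDiff ℝ ∞ y := (contDiff_id.pow 2).mul hx
    have hyc : HasCompactSupport y := hxc.mul_left
    have hyint : Integrable y := hys.continuous.integrable_of_hasCompactSupport hyc
    have hy0 : ∀ t, t ∉ Set.Ioo 0 (L / 2) → y t = 0 := fun t ht => by simp [hy, hx0 t ht]
    set I := ∫ t, y t with hI
    set Ξ : ℝ → ℝ := fun t => I - ∫ s in Set.Ioi t, y s with hΞ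
    have hΞd : ∀ t, HasDerivAt Ξ (y t) t := fun t => by
      simpa using (hasDerivAt_integral_Ioi hys.continuous hyint t).const_sub I
    have hΞs : ContDiff ℝ ∞ Ξ := contDiff_const.sub (contDiff_integral_Ioi hys hyint)
    have hΞIic : ∀ t, Ξ t = ∫ s in Set.Iic t, y s := fun t => by
      have := intervalIntegral.integral_Iic_add_Ioi (b := t) hyint.integrableOn hyint.integrableOn
      simp only [hΞ]; linarith
    have hΞ0 : ∀ t, t < δ → Ξ t = 0 := fun t ht => by
      rw [hΞIic]
      refine setIntegral_eq_zero_of_forall_eq_zero fun s (hs : s ≤ t) => ?_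
      simp [hy, hxδ s (lt_of_le_of_lt hs ht)]
    have hΞ1 : ∀ t, L / 2 ≤ t → Ξ t = I := fun t ht => by
      simp only [hΞ]
      rw [setIntegral_eq_zero_of_forall_eq_zero, sub_zero]
      intro s (hs : t < s)
      exact hy0 s fun h => by linarith [h.2]
    -- `η` is a compactly supported primitive of `y - I w`: `M = 1` wherever `y ≠ 0`, and `Ξ = I` on
    -- the support of `w`. Subtracting `I w` compensates the mean of `y` and produces the term `m₀`.
    set η : ℝ → ℝ := fun t => M t * Ξ t with hη
    have hηs : ContDiff ℝ ∞ η := hMs.mul hΞs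
    have hηd : ∀ t, deriv η t = y t - I * w t := by
      intro t
      have h1 : deriv η t = -w t * Ξ t + M t * y t := ((hMd t).mul (hΞd t)).deriv
      rw [h1]
      rcases le_total t (L / 2) with ht | ht
      · rw [hM1 t (by linarith), hws t fun h => by linarith [h.1]]; ring
      · rw [hΞ1 t ht, hy0 t fun h => by linarith [h.2]]; ring
    have hη0 : ∀ t, t < δ → η t = 0 := fun t ht => by simp [hη, hΞ0 t ht]
    have hηL : ∀ t, 7 * L / 8 < t → η t = 0 := fun t ht => by simp [hη, hM0 t ht.le]
    have hsuppζ : tsupport (fun t => η t / t ^ 3) ⊆ Set.Icc δ (7 * L / 8) :=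
      tsupport_subset_Icc (fun t ht => by simp [hη0 t ht]) (fun t ht => by simp [hηL t ht])
    have key := hid (fun t => η t / t ^ 3) (contDiff_div_cube hηs hδ hη0)
      (HasCompactSupport.of_support_subset_isCompact isCompact_Icc
        ((subset_tsupport _).trans hsuppζ))
      (hsuppζ.trans fun t ht => ⟨lt_of_lt_of_le hδ ht.1, by linarith [ht.2]⟩)
    rw [setIntegral_ball_comp_norm
        (fun s => ((3 * (η s / s ^ 3) + s * deriv (fun t => η t / t ^ 3) s : ℝ) : ℂ) * p s),
      setIntegral_ball_comp_norm (fun s => ((η s / s ^ 3 * s : ℝ) : ℂ) * q s), ← smul_neg] at key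
    have key2 := smul_right_injective ℂ (mul_pos four_pos Real.pi_pos).ne' key
    have k1 : ∫ t in Set.Ioo 0 L,
        t ^ 2 • (((3 * (η t / t ^ 3) + t * deriv (fun t => η t / t ^ 3) t : ℝ) : ℂ) * p t)
        = ∫ t in Set.Ioo 0 L, (((x t : ℝ) : ℂ) * (t ^ 2 • p t) - (I : ℂ) * ((w t : ℂ) * p t)) := by
      refine setIntegral_congr_fun measurableSet_Ioo fun t ht => ?_
      have := deriv_div_cube hηs ht.1
      rw [hηd] at this
      simp only [Complex.real_smul]
      rw [← mul_assoc, ← Complex.ofReal_mul, this]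
      simp only [hy]; push_cast; ring
    have k2 : ∫ t in Set.Ioo 0 L, t ^ 2 • (((η t / t ^ 3 * t : ℝ) : ℂ) * q t)
        = ∫ t, b t * (Ξ t : ℂ) := by
      rw [← setIntegral_eq_integral_of_forall_compl_eq_zero (s := Set.Ioo 0 L)
        (f := fun t => b t * (Ξ t : ℂ))]
      · refine setIntegral_congr_fun measurableSet_Ioo fun t ht => ?_
        have h0 : t ≠ 0 := (Set.mem_Ioo.1 ht).1.ne'
        simp only [hbdef, Set.indicator_of_mem ht, Complex.real_smul]
        rw [← mul_assoc, ← Complex.ofReal_mul]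
        have : t ^ 2 * (η t / t ^ 3 * t) = M t * Ξ t := by
          simp only [hη]; field_simp
        rw [this]; push_cast; ring
      · intro t ht
        rw [hbdef, Set.indicator_of_notMem ht, zero_mul]
    -- Fubini again: `4π Ξ(t)` is the integral of `x(‖z‖)` over the ball of radius `t`.
    have k3 : ∫ t, b t * (Ξ t : ℂ) = ∫ t in Set.Ioo 0 L, ((x t : ℝ) : ℂ) * (t ^ 2 • ∫ s in Set.Ioi t, b s) := by
      have hDc : Continuous fun z : E3 => ((x ‖z‖ : ℝ) : ℂ) :=
        Complex.continuous_ofReal.comp (hx.continuous.comp continuous_norm)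
      have e := integral_mul_layer hK hDc (C := Cx) fun z => by simpa using hCx ‖z‖
      rw [integral_comp_norm_E3 (fun t => ((x t : ℝ) : ℂ) * ∫ s in Set.Ioi t, b s)] at e
      have e2 : ∀ t, ∫ z in Metric.ball (0 : E3) t, ((x ‖z‖ : ℝ) : ℂ) = (4 * Real.pi : ℝ) • (Ξ t : ℂ) := by
        intro t
        rw [setIntegral_ball_comp_norm (fun s => ((x s : ℝ) : ℂ))]
        congr 1
        rw [hΞIic, integral_Iic_eq_integral_Iio, ← integral_complex_ofReal,
          setIntegral_eq_of_subset_of_forall_sdiff_eq_zero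
          measurableSet_Iio (s := Set.Ioo 0 t) (fun s hs => hs.2)]
        · refine integral_congr_ae (Filter.Eventually.of_forall fun s => ?_)
          simp [hy]
        · intro s hs
          rw [hy0 s fun h => hs.2 ⟨h.1, hs.1⟩, Complex.ofReal_zero]
      have e3 : ∀ t, b t * ∫ z in Metric.ball (0 : E3) t, ((x ‖z‖ : ℝ) : ℂ)
          = (4 * Real.pi : ℝ) • (b t * (Ξ t : ℂ)) := fun t => by
        rw [e2, mul_smul_comm]
      simp_rw [e3] at e
      rw [integral_smul] at e
      have e4 := smul_right_injective ℂ (mul_pos four_pos Real.pi_pos).ne' e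
      rw [← e4]
      rw [setIntegral_eq_of_subset_of_forall_sdiff_eq_zero measurableSet_Ioi (s := Set.Ioo 0 L)
        (fun s hs => hs.1)]
      · refine integral_congr_ae (Filter.Eventually.of_forall fun t => ?_)
        simp only [Complex.real_smul]; ring
      · intro s hs
        have : x s = 0 := hx0 s fun h => hs.2 ⟨h.1, by linarith [h.2]⟩
        simp [this]
    rw [k1, k2, k3] at key2
    have hxm : AEStronglyMeasurable (fun t => ((x t : ℝ) : ℂ)) (volume.restrict (Set.Ioo 0 L)) :=
      (Complex.continuous_ofReal.comp hx.continuous).aestronglyMeasurable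
    have hxb : ∀ᵐ t ∂(volume.restrict (Set.Ioo 0 L)), ‖((x t : ℝ) : ℂ)‖ ≤ Cx :=
      Filter.Eventually.of_forall fun t => by simpa using hCx t
    have i1 : IntegrableOn (fun t => ((x t : ℝ) : ℂ) * (t ^ 2 • p t)) (Set.Ioo 0 L) :=
      hp2.bdd_mul hxm hxb
    have i2 : IntegrableOn (fun t => (w t : ℂ) * p t) (Set.Ioo 0 L) := by
      obtain ⟨Cw, hCw⟩ := hwc.exists_bound_of_continuous hw.continuous
      have h1 : ∀ t : ℝ, (w t : ℂ) * p t = ((w t / t ^ 2 : ℝ) : ℂ) * (t ^ 2 • p t) := fun t => by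
        by_cases ht : t = 0
        · rw [hws t fun h => by rw [ht] at h; linarith [h.1]]; simp
        · have : (t : ℂ) ≠ 0 := by exact_mod_cast ht
          rw [Complex.real_smul]; push_cast; field_simp
      simp_rw [h1]
      refine hp2.bdd_mul (c := Cw / (5 * L / 8) ^ 2) ?_ (Filter.Eventually.of_forall fun t => ?_)
      · exact (Complex.measurable_ofReal.comp
          (hw.continuous.measurable.div (measurable_id.pow_const 2))).aestronglyMeasurable
      · rw [Complex.norm_real, norm_div, norm_pow, Real.norm_eq_abs t, sq_abs]
        by_cases ht : t ∈ Set.Icc (5 * L / 8) (7 * L / 8)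
        · have := ht.1
          have h0 : 0 ≤ Cw := (norm_nonneg _).trans (hCw t)
          gcongr
          exact hCw t
        · rw [hws t ht]
          have h0 : 0 ≤ Cw := (norm_nonneg _).trans (hCw t)
          simp only [norm_zero, zero_div]; positivity
    have i3 : IntegrableOn (fun t => ((x t : ℝ) : ℂ) * (t ^ 2 • ∫ s in Set.Ioi t, b s))
      (Set.Ioo 0 L) := hP2.bdd_mul hxm hxb
    have i4 : IntegrableOn (fun t => ((y t : ℝ) : ℂ) * m₀) (Set.Ioo 0 L) :=
      (hyint.ofReal.mul_const m₀).integrableOn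
    rw [integral_sub i1 (i2.const_mul _), integral_const_mul, ← hm₀] at key2
    have hIy : (I : ℂ) = ∫ t in Set.Ioo 0 L, ((y t : ℝ) : ℂ) := by
      rw [hI, ← integral_complex_ofReal, setIntegral_eq_integral_of_forall_compl_eq_zero]
      intro t ht
      rw [hy0 t fun h => ht (hsubset h), Complex.ofReal_zero]
    rw [← setIntegral_eq_integral_of_forall_compl_eq_zero (s := Set.Ioo 0 L)]
    · have hsplit : ∀ t, x t • (((t ^ 2 : ℝ) : ℂ) * (p t - m₀ + ∫ s in Set.Ioi t, b s))
          = ((x t : ℝ) : ℂ) * (t ^ 2 • p t) - ((y t : ℝ) : ℂ) * m₀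
            + ((x t : ℝ) : ℂ) * (t ^ 2 • ∫ s in Set.Ioi t, b s) := fun t => by
        simp only [Complex.real_smul, hy]; push_cast; ring
      simp_rw [hsplit]
      have i5 : IntegrableOn (fun t => ((x t : ℝ) : ℂ) * (t ^ 2 • p t) - ((y t : ℝ) : ℂ) * m₀)
        (Set.Ioo 0 L) := i1.sub i4
      rw [integral_add i5 i3, integral_sub i1 i4, integral_mul_const, ← hIy, key2]
      ring
    · intro t ht
      rw [hx0 t fun h => ht (hsubset h), zero_smul]
  filter_upwards [hae] with t ht hmem
  have h0 : ((t ^ 2 : ℝ) : ℂ) ≠ 0 := by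
    have : (t : ℝ) ≠ 0 := hmem.1.ne'
    exact_mod_cast pow_ne_zero 2 this
  exact (mul_eq_zero.1 (ht hmem)).resolve_left h0

/-- The scattering energy is bounded by the energy of every radial profile `p` with weak derivative
`q` on `(0, L)`, normalized by its average outside the range of the potential. -/
theorem twoBodyScatteringEnergy_mul_le {V : E3 → ℝ} {R₀ L : ℝ} (hL : 0 < L)
    (hR : R₀ < L / 2) (hVs : ∀ x, V x ≠ 0 → ‖x‖ ≤ R₀) {w : ℝ → ℝ} (hw : ContDiff ℝ ∞ w)
    (hw0 : ∀ t, 0 ≤ w t) (hws : ∀ t, t ∉ Set.Icc (5 * L / 8) (7 * L / 8) → w t = 0)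
    (hwi : ∫ t, w t = 1) {p q : ℝ → ℂ} (hqm : StronglyMeasurable q)
    (hp : MemLp (fun x : E3 => p ‖x‖) 2 (volume.restrict (Metric.ball 0 L)))
    (hq : MemLp (fun x : E3 => q ‖x‖) 2 (volume.restrict (Metric.ball 0 L)))
    (hid : ∀ ζ : ℝ → ℝ, ContDiff ℝ ∞ ζ → HasCompactSupport ζ → tsupport ζ ⊆ Set.Ioo 0 L →
      ∫ x in Metric.ball (0 : E3) L, ((3 * ζ ‖x‖ + ‖x‖ * deriv ζ ‖x‖ : ℝ) : ℂ) * p ‖x‖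
        = -∫ x in Metric.ball (0 : E3) L, ((ζ ‖x‖ * ‖x‖ : ℝ) : ℂ) * q ‖x‖) :
    twoBodyScatteringEnergy V * ‖∫ t in Set.Ioo 0 L, (w t : ℂ) * p t‖ₑ ^ 2
      ≤ ∫⁻ x in Metric.ball (0 : E3) L,
          (2 * ‖q ‖x‖‖ₑ ^ 2 + ENNReal.ofReal (V x) * ‖p ‖x‖‖ₑ ^ 2) := by
  have hfin : IsFiniteMeasure ((volume : Measure E3).restrict (Metric.ball 0 L)) :=
    ⟨by simpa using measure_ball_lt_top (μ := (volume : Measure E3)) (x := 0) (r := L)⟩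
  have hwc : HasCompactSupport w := HasCompactSupport.intro isCompact_Icc hws
  have hwint : Integrable w := hw.continuous.integrable_of_hasCompactSupport hwc
  set M : ℝ → ℝ := fun t => ∫ s in Set.Ioi t, w s with hM
  have hMc : Continuous M := (contDiff_integral_Ioi hw hwint).continuous
  have hM0 : ∀ t, 0 ≤ M t := fun t => setIntegral_nonneg measurableSet_Ioi fun s _ => hw0 s
  have hM1 : ∀ t, M t ≤ 1 := fun t => by
    rw [← hwi]
    exact setIntegral_le_integral hwint (Filter.Eventually.of_forall hw0)
  -- Since `0 ≤ M ≤ 1`, replacing `q` by `b` does not increase the gradient energy.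
  set b : ℝ → ℂ := (Set.Ioo 0 L).indicator fun t => ((M t : ℝ) : ℂ) * q t with hb
  have hbm : StronglyMeasurable b :=
    ((Complex.continuous_ofReal.comp hMc).stronglyMeasurable.mul hqm).indicator measurableSet_Ioo
  have hbsupp : ∀ t, t ∉ Set.Ioo 0 L → b t = 0 := fun t ht => Set.indicator_of_notMem ht _
  have hbq : ∀ x : E3, ‖b ‖x‖‖ ≤ ‖(Metric.ball (0 : E3) L).indicator (fun x => q ‖x‖) x‖ := by
    intro x
    by_cases hx : ‖x‖ ∈ Set.Ioo 0 L
    · rw [hb, Set.indicator_of_mem hx, Set.indicator_of_mem (by simpa using hx.2), norm_mul,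
        Complex.norm_real, Real.norm_of_nonneg (hM0 _)]
      exact mul_le_of_le_one_left (norm_nonneg _) (hM1 _)
    · rw [hbsupp _ hx, norm_zero]; positivity
  have hb2 : MemLp (fun x : E3 => b ‖x‖) 2 :=
    ((memLp_indicator_iff_restrict measurableSet_ball).2 hq).mono
      (hbm.comp_measurable measurable_norm).aestronglyMeasurable (Filter.Eventually.of_forall hbq)
  have hsL : ∀ t, L ≤ t → b t = 0 := fun t ht => hbsupp t fun h => absurd h.2 (not_lt.2 ht)
  have hK := integrable_layerKernel hbm (fun t ht => hbsupp t fun h => absurd h.1 (not_lt.2 ht))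
    (integrable_norm_mul_norm_of_memLp hsL hb2)
  have hD := memD1_radial hbm hbsupp hb2
  have hP : IntegrableOn (fun x : E3 => ∫ t in Set.Ioi ‖x‖, b t) (Metric.ball 0 L) :=
    (hD.locInt.integrableOn_isCompact (isCompact_closedBall 0 L)).mono_set
      Metric.ball_subset_closedBall
  have hprof := radial_profile_eq hL hw hws hwi (hp.integrable (by norm_num)) hid hb hK hP
  set m₀ := ∫ t in Set.Ioo 0 L, (w t : ℂ) * p t with hm₀
  by_cases hm : m₀ = 0
  · simp [hm]
  have hae : ∀ᵐ x : E3, V x ≠ 0 → p ‖x‖ - m₀ + ∫ s in Set.Ioi ‖x‖, b s = 0 := by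
    have h1 := ae_comp_norm_E3 (s := {t | ¬(t ∈ Set.Ioo 0 (L / 2) →
        p t - m₀ + ∫ s in Set.Ioi t, b s = 0)})
      (measure_mono_null Set.inter_subset_left (ae_iff.1 hprof))
    filter_upwards [h1, Measure.ae_ne volume (0 : E3)] with x hx hx0 hVx
    have h2 : ‖x‖ ∈ Set.Ioo 0 (L / 2) → p ‖x‖ - m₀ + ∫ s in Set.Ioi ‖x‖, b s = 0 := by
      by_contra h; exact hx h
    exact h2 ⟨norm_pos_iff.2 hx0, (hVs x hVx).trans_lt hR⟩
  -- The trial function is `m₀⁻¹ ∫_{‖x‖}^∞ b`; by `hae`, one minus it equals `p/m₀` almost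
  -- everywhere on the support of `V`.
  have hD' := memD1_radial (b := fun t => m₀⁻¹ * b t) (L := L) (hbm.const_mul _)
    (fun t ht => by rw [hbsupp t ht, mul_zero]) (hb2.const_mul m₀⁻¹)
  have hle : twoBodyScatteringEnergy V ≤ _ := iInf₂_le_of_le _ _ (iInf_le_of_le hD' le_rfl)
  have hm2 : ‖m₀‖ₑ ^ 2 ≠ 0 := by simpa using hm
  have hm2' : ‖m₀‖ₑ ^ 2 ≠ ⊤ := by simp
  rw [← ENNReal.le_div_iff_mul_le (Or.inl hm2) (Or.inl hm2')]
  refine hle.trans ?_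
  rw [div_eq_mul_inv, ← lintegral_mul_const' _ _ (by simpa using hm2), ← lintegral_indicator measurableSet_ball]
  refine lintegral_mono_ae ?_
  filter_upwards [hae] with x hx
  have hmpos : 0 < ‖m₀‖ := norm_pos_iff.2 hm
  have hconv : ∀ z : ℂ, ENNReal.ofReal (‖m₀⁻¹‖ ^ 2 * ‖z‖ ^ 2) = ‖z‖ₑ ^ 2 * (‖m₀‖ₑ ^ 2)⁻¹ := by
    intro z
    rw [← ofReal_norm, ← ofReal_norm, ← ENNReal.ofReal_pow (norm_nonneg _),
      ← ENNReal.ofReal_pow (norm_nonneg _), ← ENNReal.ofReal_inv_of_pos (by positivity),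
      ← ENNReal.ofReal_mul (by positivity), norm_inv, inv_pow, mul_comm]
  have hgrad : ∑ k : Fin 3, ‖-(m₀⁻¹ * b ‖x‖ * ((x k / ‖x‖ : ℝ) : ℂ))‖ ^ 2
      ≤ ‖m₀⁻¹‖ ^ 2 * ‖b ‖x‖‖ ^ 2 := by
    have h1 : ∀ k : Fin 3, ‖-(m₀⁻¹ * b ‖x‖ * ((x k / ‖x‖ : ℝ) : ℂ))‖ ^ 2
        = ‖m₀⁻¹‖ ^ 2 * ‖b ‖x‖‖ ^ 2 * (‖x k‖ ^ 2 / ‖x‖ ^ 2) := fun k => by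
      rw [norm_neg, norm_mul, norm_mul, Complex.norm_real, norm_div, norm_norm]; ring
    simp_rw [h1]
    rw [← Finset.mul_sum, ← Finset.sum_div, ← EuclideanSpace.norm_sq_eq]
    exact mul_le_of_le_one_right (by positivity) (div_self_le_one _)
  have hint : ∫ t in Set.Ioi ‖x‖, m₀⁻¹ * b t = m₀⁻¹ * ∫ t in Set.Ioi ‖x‖, b t :=
    integral_const_mul _ _
  by_cases hxL : x ∈ Metric.ball (0 : E3) L
  · rw [Set.indicator_of_mem hxL]
    have hV : V x * ‖1 - ∫ t in Set.Ioi ‖x‖, m₀⁻¹ * b t‖ ^ 2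
        = V x * (‖m₀⁻¹‖ ^ 2 * ‖p ‖x‖‖ ^ 2) := by
      by_cases hVx : V x = 0
      · rw [hVx, zero_mul, zero_mul]
      · have h2 : (1 : ℂ) - m₀⁻¹ * ∫ t in Set.Ioi ‖x‖, b t = m₀⁻¹ * p ‖x‖ := by
          have := hx hVx
          have h3 : p ‖x‖ = m₀ - ∫ t in Set.Ioi ‖x‖, b t := by linear_combination this
          rw [h3]; field_simp
        rw [hint, h2, norm_mul, mul_pow]
    rw [hV]
    refine ENNReal.ofReal_add_le.trans ?_
    rw [add_mul]
    refine add_le_add ?_ ?_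
    · have h4 : ‖b ‖x‖‖ ^ 2 ≤ ‖q ‖x‖‖ ^ 2 := by
        have := hbq x
        rw [Set.indicator_of_mem hxL] at this
        gcongr
      rw [ENNReal.ofReal_mul two_pos.le, ENNReal.ofReal_ofNat, mul_assoc, ← hconv]
      gcongr
      exact hgrad.trans (by gcongr)
    · rw [ENNReal.ofReal_mul' (by positivity), mul_assoc, ← hconv]
  · have hLx : L ≤ ‖x‖ := by simpa using hxL
    have hV : V x = 0 := by
      by_contra h
      linarith [hVs x h]
    rw [Set.indicator_of_notMem hxL, hsL _ hLx, hV]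
    simp

/-- A radial integrable potential has a measurable profile. -/
theorem exists_measurable_profile {V : E3 → ℝ} (hVi : Integrable V)
    (hVr : ∀ x y : E3, ‖x‖ = ‖y‖ → V x = V y) :
    ∃ v : ℝ → ℝ, Measurable v ∧
      volume ({t : ℝ | V (t • unitVec 0) ≠ v t} ∩ Set.Ioi 0) = 0 := by
  have hu : ‖unitVec 0‖ = 1 := by simp [unitVec]
  have h1 : V = fun x : E3 => (fun t : ℝ => V (t • unitVec 0)) ‖x‖ := by
    ext x
    exact hVr _ _ (by simp [norm_smul, hu])
  rw [h1] at hVi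
  replace hVi := (integrable_comp_norm_E3 (f := fun t : ℝ => V (t • unitVec 0))).1 hVi
  have h2 : AEMeasurable (fun t : ℝ => V (t • unitVec 0)) (volume.restrict (Set.Ioi 0)) := by
    have h3 := hVi.integrable.aestronglyMeasurable.aemeasurable
    have h4 : AEMeasurable (fun t : ℝ => (t ^ 2)⁻¹ * (t ^ 2 • V (t • unitVec 0)))
        (volume.restrict (Set.Ioi 0)) := ((measurable_id.pow_const 2).inv.aemeasurable).mul h3
    refine h4.congr ?_
    rw [Filter.EventuallyEq, ae_restrict_iff' measurableSet_Ioi]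
    refine Filter.Eventually.of_forall fun t (ht : 0 < t) => ?_
    simp only [smul_eq_mul]
    field_simp
  refine ⟨h2.mk _, h2.measurable_mk, ?_⟩
  have h5 := h2.ae_eq_mk
  rw [Filter.EventuallyEq, ae_restrict_iff' measurableSet_Ioi, ae_iff] at h5
  refine measure_mono_null (fun t ht => ?_) h5
  simp only [Set.mem_ofPred_eq, Classical.not_imp]
  exact ⟨ht.2, ht.1⟩

/-- The scattering length bounds the energy of a function `ψ` on a measure space with a radial
variable `τ`, distributed as the norm in a ball of `ℝ³`, if `Q` is the weak radial derivative of
`ψ`. -/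
theorem scatteringLength_mul_le {V : E3 → ℝ} (hV0 : ∀ x, 0 ≤ V x) (hVi : Integrable V)
    (hVr : ∀ x y : E3, ‖x‖ = ‖y‖ → V x = V y) {R₀ L : ℝ} (hL : 0 < L)
    (hR : R₀ < L / 2) (hVs : ∀ x, V x ≠ 0 → ‖x‖ ≤ R₀) {w : ℝ → ℝ} (hw : ContDiff ℝ ∞ w)
    (hw0 : ∀ t, 0 ≤ w t) (hws : ∀ t, t ∉ Set.Icc (5 * L / 8) (7 * L / 8) → w t = 0)
    (hwi : ∫ t, w t = 1)
    {X : Type*} [MeasurableSpace X] [StandardBorelSpace X] [Nonempty X]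
    (m : Measure X) [IsFiniteMeasure m] {τ : X → ℝ} (hτ : Measurable τ) {θ : ℝ} (hθ : 0 < θ)
    (hmap : m.map τ =
      ENNReal.ofReal θ • ((volume : Measure E3).restrict (Metric.ball 0 L)).map norm)
    {ψ Q : X → ℂ} (hψ : MemLp ψ 2 m) (hQ : MemLp Q 2 m)
    (hint : Integrable (fun x => V (τ x • unitVec 0) * ‖ψ x‖ ^ 2) m)
    (hid : ∀ ζ : ℝ → ℝ, ContDiff ℝ ∞ ζ → HasCompactSupport ζ → tsupport ζ ⊆ Set.Ioo 0 L →
      ∫ x, ((3 * ζ (τ x) + τ x * deriv ζ (τ x) : ℝ) : ℂ) * ψ x ∂m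
        = -∫ x, ((ζ (τ x) * τ x : ℝ) : ℂ) * Q x ∂m) :
    8 * Real.pi * scatteringLength V *
        (‖∫ x, ((w (τ x) / (4 * Real.pi * τ x ^ 2) : ℝ) : ℂ) * ψ x ∂m‖ ^ 2 / θ)
      ≤ ∫ x, (2 * ‖Q x‖ ^ 2 + V (τ x • unitVec 0) * ‖ψ x‖ ^ 2) ∂m := by
  have hu : ‖unitVec 0‖ = 1 := by simp [unitVec]
  set lam := ((volume : Measure E3).restrict (Metric.ball 0 L)).map norm with hlam
  have hfin : IsFiniteMeasure ((volume : Measure E3).restrict (Metric.ball 0 L)) :=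
    ⟨by simpa using measure_ball_lt_top (μ := (volume : Measure E3)) (x := 0) (r := L)⟩
  have hc0 : ENNReal.ofReal θ ≠ 0 := by simpa using hθ
  obtain ⟨p, hpm, hpJ, hpI⟩ := exists_fiber_average m hτ hψ
  obtain ⟨q, hqm, hqJ, hqI⟩ := exists_fiber_average m hτ hQ
  rw [hmap] at hpJ hpI hqJ hqI
  have hmem : ∀ {f : X → ℂ} {g : ℝ → ℂ}, MemLp f 2 m → StronglyMeasurable g →
      (∀ w : ℝ → ENNReal, Measurable w →
        ∫⁻ t, w t * ‖g t‖ₑ ^ 2 ∂(ENNReal.ofReal θ • lam) ≤ ∫⁻ x, w (τ x) * ‖f x‖ₑ ^ 2 ∂m) →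
      MemLp (fun x : E3 => g ‖x‖) 2 (volume.restrict (Metric.ball 0 L)) := by
    intro f g hf hg hJ
    refine ⟨(hg.comp_measurable measurable_norm).aestronglyMeasurable, ?_⟩
    have h1 := hJ (fun _ => 1) measurable_const
    have h2 := hf.2
    rw [eLpNorm_lt_top_iff_lintegral_rpow_enorm_lt_top (by norm_num) (by norm_num)] at h2 ⊢
    rw [lintegral_smul_measure, hlam,
      lintegral_map (by fun_prop (disch := exact hg.measurable)) measurable_norm] at h1
    simp only [one_mul] at h1
    have h3 := h1.trans_lt (by simpa using h2)
    simpa using ENNReal.lt_top_of_mul_ne_top_right h3.ne hc0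
  have hp2 := hmem hψ hpm hpJ
  have hq2 := hmem hQ hqm hqJ
  have hpush : ∀ (h g : ℝ → ℂ), Measurable h → StronglyMeasurable g →
      ∫ t, h t * g t ∂(ENNReal.ofReal θ • lam)
        = (θ : ℂ) * ∫ x in Metric.ball (0 : E3) L, h ‖x‖ * g ‖x‖ := by
    intro h g hh hg
    rw [integral_smul_measure, ENNReal.toReal_ofReal hθ.le, hlam,
      integral_map (f := fun t => h t * g t) measurable_norm.aemeasurable
        (hh.stronglyMeasurable.mul hg).aestronglyMeasurable, Complex.real_smul]
  have hθc : (θ : ℂ) ≠ 0 := by exact_mod_cast hθ.ne'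
  have hbdd : ∀ {f : X → ℂ} (h : ℝ → ℝ), MemLp f 2 m → Measurable h → (∃ C, ∀ t, ‖h t‖ ≤ C) →
      Integrable (fun x => ((h (τ x) : ℝ) : ℂ) * f x) m := by
    intro f h hf hh ⟨C, hC⟩
    refine (hf.integrable (by norm_num)).bdd_mul (c := C)
      (Complex.measurable_ofReal.comp (hh.comp hτ)).aestronglyMeasurable ?_
    exact Filter.Eventually.of_forall fun x => by simpa using hC (τ x)
  -- The coefficients in the weak identity depend on `τ` only, so the identity passes to the fibre
  -- averages `p` and `q`. The factor `θ` appears on both sides and cancels.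
  have hE := twoBodyScatteringEnergy_mul_le hL hR hVs hw hw0 hws hwi hqm hp2 hq2 (by
    intro ζ hζ hζc hζs
    have hdc : Continuous (deriv ζ) := hζ.continuous_deriv (by simp)
    have c1 : Continuous fun t => 3 * ζ t + t * deriv ζ t :=
      (continuous_const.mul hζ.continuous).add (continuous_id.mul hdc)
    have c2 : Continuous fun t => ζ t * t := hζ.continuous.mul continuous_id
    have s1 : HasCompactSupport fun t => 3 * ζ t + t * deriv ζ t :=
      hζc.mul_left.add hζc.deriv.mul_left
    have s2 : HasCompactSupport fun t => ζ t * t := hζc.mul_right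
    have key := hid ζ hζ hζc hζs
    have k1 := hpI (fun t => ((3 * ζ t + t * deriv ζ t : ℝ) : ℂ))
      (Complex.measurable_ofReal.comp c1.measurable)
      (hbdd (fun t => 3 * ζ t + t * deriv ζ t) hψ c1.measurable (s1.exists_bound_of_continuous c1))
    have k2 := hqI (fun t => ((ζ t * t : ℝ) : ℂ)) (Complex.measurable_ofReal.comp c2.measurable)
      (hbdd (fun t => ζ t * t) hQ c2.measurable (s2.exists_bound_of_continuous c2))
    rw [k1, k2,
      hpush (fun t => ((3 * ζ t + t * deriv ζ t : ℝ) : ℂ)) _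
        (Complex.measurable_ofReal.comp c1.measurable) hpm,
      hpush (fun t => ((ζ t * t : ℝ) : ℂ)) _ (Complex.measurable_ofReal.comp c2.measurable) hqm, ← mul_neg] at key
    exact mul_left_cancel₀ hθc key)
  set m₀ := ∫ t in Set.Ioo 0 L, (w t : ℂ) * p t with hm₀
  have hwc : HasCompactSupport w := HasCompactSupport.intro isCompact_Icc hws
  have hum : Measurable fun t : ℝ => w t / (4 * Real.pi * t ^ 2) :=
    hw.continuous.measurable.div (measurable_const.mul (measurable_id.pow_const 2))
  have hmean : ∫ x, ((w (τ x) / (4 * Real.pi * τ x ^ 2) : ℝ) : ℂ) * ψ x ∂m = θ * m₀ := by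
    have k1 := hpI (fun t => ((w t / (4 * Real.pi * t ^ 2) : ℝ) : ℂ))
      (Complex.measurable_ofReal.comp hum) (hbdd _ hψ hum (by
        obtain ⟨Cw, hCw⟩ := hwc.exists_bound_of_continuous hw.continuous
        refine ⟨Cw / (4 * Real.pi * (5 * L / 8) ^ 2), fun t => ?_⟩
        have h0 : 0 ≤ Cw := (norm_nonneg _).trans (hCw t)
        by_cases ht : t ∈ Set.Icc (5 * L / 8) (7 * L / 8)
        · have h5 := ht.1
          have ht0 : 0 < t := by linarith
          rw [norm_div, Real.norm_of_nonneg (by positivity : 0 ≤ 4 * Real.pi * t ^ 2)]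
          gcongr
          exact hCw t
        · rw [hws t ht, zero_div, norm_zero]; positivity))
    rw [k1, hpush (fun t => ((w t / (4 * Real.pi * t ^ 2) : ℝ) : ℂ)) _ (Complex.measurable_ofReal.comp hum) hpm,
      setIntegral_ball_comp_norm (fun t => ((w t / (4 * Real.pi * t ^ 2) : ℝ) : ℂ) * p t),
      ← integral_smul, hm₀]
    congr 1
    refine setIntegral_congr_fun measurableSet_Ioo fun t ht => ?_
    have ht0 : (t : ℂ) ≠ 0 := by exact_mod_cast (Set.mem_Ioo.1 ht).1.ne'
    have hpi : (Real.pi : ℂ) ≠ 0 := by exact_mod_cast Real.pi_ne_zero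
    simp only [Complex.real_smul]
    push_cast
    field_simp
  obtain ⟨v, hvm, hv⟩ := exists_measurable_profile hVi hVr
  have hVv : ∀ᵐ x : E3, V x = v ‖x‖ := by
    filter_upwards [ae_comp_norm_E3 hv] with x hx
    have h1 : V (‖x‖ • unitVec 0) = v ‖x‖ := by by_contra h; exact hx h
    rw [← h1]
    exact hVr _ _ (by simp [norm_smul, hu])
  -- The exceptional set of the profile is null but possibly not measurable, hence the measurable
  -- hull; the half-line `t ≤ 0` is added because the profile is controlled for `t > 0` only.
  have hVτ : ∀ᵐ x ∂m, V (τ x • unitVec 0) = v (τ x) := by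
    set N := toMeasurable volume ({t : ℝ | V (t • unitVec 0) ≠ v t} ∩ Set.Ioi 0) with hN
    have hN0 : volume N = 0 := by rw [hN, measure_toMeasurable, hv]
    have h1 : (m.map τ) (N ∪ Set.Iic 0) = 0 := by
      have hNm : MeasurableSet (N ∪ Set.Iic 0) := (measurableSet_toMeasurable _ _).union measurableSet_Iic
      rw [hmap, Measure.smul_apply, hlam, Measure.map_apply measurable_norm hNm]
      have h2 := ae_comp_norm_E3 (s := N) (measure_mono_null Set.inter_subset_left hN0)
      have h3 : ∀ᵐ x : E3, x ∉ norm ⁻¹' (N ∪ Set.Iic 0) := by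
        filter_upwards [h2, Measure.ae_ne volume (0 : E3)] with x hx hx0 hmem
        rcases hmem with h | h
        · exact hx h
        · exact hx0 (norm_le_zero_iff.1 h)
      rw [Measure.absolutelyContinuous_of_le Measure.restrict_le_self
        (measure_eq_zero_iff_ae_notMem.2 h3), smul_zero]
    have h2 : ∀ᵐ x ∂m, τ x ∉ N ∪ Set.Iic 0 :=
      ae_of_ae_map hτ.aemeasurable (measure_eq_zero_iff_ae_notMem.1 h1)
    filter_upwards [h2] with x hx
    by_contra hne
    by_cases h0 : τ x ≤ 0
    · exact hx (Or.inr h0)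
    · exact hx (Or.inl (subset_toMeasurable _ _ ⟨hne, not_le.1 h0⟩))
  have hofv : Measurable fun t => ENNReal.ofReal (v t) := hvm.ennreal_ofReal
  have hen : ∀ {g : ℝ → ℂ}, StronglyMeasurable g → Measurable fun t => ‖g t‖ₑ ^ 2 :=
    fun hg => hg.measurable.enorm.pow_const 2
  have hEup : ENNReal.ofReal θ * ∫⁻ x in Metric.ball (0 : E3) L,
        (2 * ‖q ‖x‖‖ₑ ^ 2 + ENNReal.ofReal (V x) * ‖p ‖x‖‖ₑ ^ 2)
      ≤ ∫⁻ x, (2 * ‖Q x‖ₑ ^ 2 + ENNReal.ofReal (V (τ x • unitVec 0)) * ‖ψ x‖ₑ ^ 2) ∂m := by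
    have e1 : ∫⁻ x in Metric.ball (0 : E3) L,
        (2 * ‖q ‖x‖‖ₑ ^ 2 + ENNReal.ofReal (V x) * ‖p ‖x‖‖ₑ ^ 2)
        = ∫⁻ t, (2 * ‖q t‖ₑ ^ 2 + ENNReal.ofReal (v t) * ‖p t‖ₑ ^ 2) ∂lam := by
      rw [hlam, lintegral_map
        (f := fun t => 2 * ‖q t‖ₑ ^ 2 + ENNReal.ofReal (v t) * ‖p t‖ₑ ^ 2) (((hen hqm).const_mul 2).add (hofv.mul (hen hpm))) measurable_norm]
      refine lintegral_congr_ae (ae_restrict_of_ae ?_)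
      filter_upwards [hVv] with x hx
      rw [hx]
    have e2 : ∫⁻ x, (2 * ‖Q x‖ₑ ^ 2 + ENNReal.ofReal (V (τ x • unitVec 0)) * ‖ψ x‖ₑ ^ 2) ∂m
        = ∫⁻ x, 2 * ‖Q x‖ₑ ^ 2 ∂m + ∫⁻ x, ENNReal.ofReal (v (τ x)) * ‖ψ x‖ₑ ^ 2 ∂m := by
      rw [lintegral_add_left' ((hQ.1.enorm.pow_const 2).const_mul 2)]
      congr 1
      refine lintegral_congr_ae ?_
      filter_upwards [hVτ] with x hx
      rw [hx]
    rw [e1, e2, ← smul_eq_mul, ← lintegral_smul_measure,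
      lintegral_add_left ((hen hqm).const_mul 2)]
    exact add_le_add (hqJ (fun _ => 2) measurable_const) (hpJ _ hofv)
  have hreal : ∫⁻ x, (2 * ‖Q x‖ₑ ^ 2 + ENNReal.ofReal (V (τ x • unitVec 0)) * ‖ψ x‖ₑ ^ 2) ∂m
      = ENNReal.ofReal (∫ x, (2 * ‖Q x‖ ^ 2 + V (τ x • unitVec 0) * ‖ψ x‖ ^ 2) ∂m) := by
    have hQi : Integrable (fun x => 2 * ‖Q x‖ ^ 2) m := (hQ.integrable_norm_pow (by norm_num)).const_mul 2
    rw [ofReal_integral_eq_lintegral_ofReal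
      (f := fun x => 2 * ‖Q x‖ ^ 2 + V (τ x • unitVec 0) * ‖ψ x‖ ^ 2) (hQi.add hint) (Filter.Eventually.of_forall fun x =>
      add_nonneg (by positivity) (mul_nonneg (hV0 _) (by positivity)))]
    refine lintegral_congr fun x => ?_
    rw [ENNReal.ofReal_add (by positivity) (mul_nonneg (hV0 _) (by positivity)),
      ENNReal.ofReal_mul (by positivity), ENNReal.ofReal_mul (hV0 _),
      ENNReal.ofReal_pow (norm_nonneg _), ENNReal.ofReal_pow (norm_nonneg _), ofReal_norm,
      ofReal_norm, ENNReal.ofReal_ofNat]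
  have hfinal : ENNReal.ofReal θ * (twoBodyScatteringEnergy V * ‖m₀‖ₑ ^ 2)
      ≤ ENNReal.ofReal (∫ x, (2 * ‖Q x‖ ^ 2 + V (τ x • unitVec 0) * ‖ψ x‖ ^ 2) ∂m) :=
    hreal ▸ (mul_le_mul_right hE _).trans hEup
  have hnn : 0 ≤ ∫ x, (2 * ‖Q x‖ ^ 2 + V (τ x • unitVec 0) * ‖ψ x‖ ^ 2) ∂m :=
    integral_nonneg fun x => add_nonneg (by positivity) (mul_nonneg (hV0 _) (by positivity))
  -- Only the right side has to be finite: an infinite scattering energy would become `0` under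
  -- `toReal`, which is harmless for a lower bound.
  have htr := ENNReal.toReal_mono ENNReal.ofReal_ne_top hfinal
  rw [ENNReal.toReal_ofReal hnn, ENNReal.toReal_mul, ENNReal.toReal_mul, ENNReal.toReal_pow,
    ENNReal.toReal_ofReal hθ.le, toReal_enorm] at htr
  rw [hmean, norm_mul, Complex.norm_real, Real.norm_of_nonneg hθ.le]
  refine le_trans (le_of_eq ?_) htr
  unfold scatteringLength
  field_simp

section

/-! ### Resampling coordinates -/

section Resample

variable {ι α : Type*} [Fintype ι] [DecidableEq ι] [MeasurableSpace α]

/-- Exchanging some coordinates of two independent configurations preserves the measure. -/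
theorem measurePreserving_piecewise_swap (ν : Measure α) [SigmaFinite ν] (s : Finset ι) :
    MeasurePreserving (fun z : (ι → α) × (ι → α) => (s.piecewise z.2 z.1, s.piecewise z.1 z.2))
      ((Measure.pi fun _ => ν).prod (Measure.pi fun _ => ν))
      ((Measure.pi fun _ => ν).prod (Measure.pi fun _ => ν)) := by
  have he := measurePreserving_arrowProdEquivProdArrow α α ι (fun _ => ν) (fun _ => ν)
  have hf : ∀ i, MeasurePreserving (fun a : α × α => if i ∈ s then a.swap else a)
      (ν.prod ν) (ν.prod ν) := by
    intro i
    by_cases h : i ∈ s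
    · simp only [h, if_true]; exact Measure.measurePreserving_swap
    · simp only [h, if_false]; exact MeasurePreserving.id _
  have hpi := measurePreserving_pi (fun _ : ι => ν.prod ν) (fun _ : ι => ν.prod ν) hf
  have := he.comp (hpi.comp (he.symm _))
  convert this using 1
  ext z i <;>
  by_cases h : i ∈ s <;>
  simp [h, MeasurableEquiv.arrowProdEquivProdArrow, Equiv.arrowProdEquivProdArrow]

theorem measurePreserving_update_swap (ν : Measure α) [SigmaFinite ν] (i : ι) :
    MeasurePreserving (fun z : (ι → α) × (ι → α) =>
        (Function.update z.1 i (z.2 i), Function.update z.2 i (z.1 i)))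
      ((Measure.pi fun _ => ν).prod (Measure.pi fun _ => ν))
      ((Measure.pi fun _ => ν).prod (Measure.pi fun _ => ν)) := by
  simpa [Finset.piecewise_singleton] using measurePreserving_piecewise_swap ν {i}

theorem measurePreserving_update (ν : Measure α) [IsProbabilityMeasure ν] (i : ι) :
    MeasurePreserving (fun z : (ι → α) × (ι → α) => Function.update z.1 i (z.2 i))
      ((Measure.pi fun _ => ν).prod (Measure.pi fun _ => ν)) (Measure.pi fun _ => ν) :=
  measurePreserving_fst.comp (measurePreserving_update_swap ν i)

end Resample

/-! ### The Poincaré inequality on the unit cube -/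

section Poincare

/-- Lebesgue measure on `(-1/2, 1/2)`. -/
def unitInterval : Measure ℝ := volume.restrict (Set.Ioo (-(1 / 2)) (1 / 2))

instance : IsProbabilityMeasure unitInterval := ⟨by simp [unitInterval]; norm_num⟩

variable {ι : Type*} [Fintype ι]

/-- Lebesgue measure on the cube `(-1/2, 1/2)^ι`. -/
def unitCube (ι : Type*) [Fintype ι] : Measure (ι → ℝ) := Measure.pi fun _ => unitInterval

instance : IsProbabilityMeasure (unitCube ι) := by unfold unitCube; infer_instance

theorem unitCube_eq : unitCube ι = volume.restrict (Metric.ball 0 (1 / 2)) := by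
  have h : Metric.ball (0 : ι → ℝ) (1 / 2) = Set.univ.pi fun _ => Set.Ioo (-(1 / 2)) (1 / 2) := by
    ext x
    simp only [Metric.mem_ball, dist_zero_right, Set.mem_pi, Set.mem_univ, true_implies,
      Set.mem_Ioo]
    rw [pi_norm_lt_iff (by norm_num)]
    simp only [Real.norm_eq_abs, abs_lt]
  rw [h, volume_pi, Measure.restrict_pi_pi]
  rfl

/-- A smooth probability density supported in `[-1/4, 1/4]`. -/
theorem exists_density : ∃ d : ℝ → ℝ, ContDiff ℝ ∞ d ∧ (∀ t, 0 ≤ d t) ∧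
    (∀ t, 1 / 4 < |t| → d t = 0) ∧ ∫ t, d t = 1 := by
  let f : ContDiffBump (0 : ℝ) := ⟨1 / 8, 1 / 4, by norm_num, by norm_num⟩
  refine ⟨f.normed volume, f.contDiff_normed, f.nonneg_normed, fun t ht => ?_,
    f.integral_normed⟩
  have : t ∉ Function.support (f.normed volume) := by
    rw [f.support_normed_eq]
    have h4 : (4 : ℝ)⁻¹ ≤ |t| := by linarith
    simpa [f] using h4
  simpa using this

variable [DecidableEq ι] {d : ℝ → ℝ} {p : ι} {ζ : (ι → ℝ) → ℝ} {c : ℝ}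

/-- The primitive in direction `p` of `ζ - d(x_p) ∫ ζ dx_p`. -/
def linePrimitive (d : ℝ → ℝ) (p : ι) (ζ : (ι → ℝ) → ℝ) (x : ι → ℝ) : ℝ :=
  (∫ t in Set.Ioi (x p), d t) * (∫ t, ζ (Function.update x p t)) -
    ∫ t in Set.Ioi (x p), ζ (Function.update x p t)

theorem contDiff_update_line (hζ : ContDiff ℝ ∞ ζ) :
    ContDiff ℝ ∞ fun z : (ι → ℝ) × ℝ => ζ (Function.update z.1 p z.2) := by
  refine hζ.comp ?_
  rw [contDiff_pi]
  intro i
  by_cases h : i = p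
  · subst h; simpa using contDiff_snd
  · simp only [Function.update_of_ne h]
    exact (contDiff_apply ℝ ℝ i).comp contDiff_fst

theorem continuous_line (hζ : ContDiff ℝ ∞ ζ) (x : ι → ℝ) :
    Continuous fun t => ζ (Function.update x p t) :=
  (contDiff_update_line hζ).continuous.comp (Continuous.prodMk_right x)

theorem line_eq_zero (hc : ∀ x, c < ‖x‖ → ζ x = 0) (x : ι → ℝ) {t : ℝ} (ht : c < |t|) :
    ζ (Function.update x p t) = 0 := by
  refine hc _ (lt_of_lt_of_le ht ?_)
  simpa using norm_le_pi_norm (Function.update x p t) p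

theorem integrable_line (hζ : ContDiff ℝ ∞ ζ) (hc : ∀ x, c < ‖x‖ → ζ x = 0) (x : ι → ℝ) :
    Integrable fun t => ζ (Function.update x p t) := by
  refine (continuous_line hζ x).integrable_of_hasCompactSupport
    (HasCompactSupport.intro (isCompact_closedBall (0 : ℝ) c) fun t ht => ?_)
  exact line_eq_zero hc x (by simpa using ht)

/-- Both line integrals of `ζ` are convolutions with a parameter, against `1` and against the
indicator of a half-line, with the common compact set `|t| ≤ c` carrying `ζ`. Smoothness of such
convolutions applies. -/
theorem contDiff_linePrimitive (hd : ContDiff ℝ ∞ d) (hdi : Integrable d)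
    (hζ : ContDiff ℝ ∞ ζ) (hc : ∀ x, c < ‖x‖ → ζ x = 0) :
    ContDiff ℝ ∞ (linePrimitive d p ζ) := by
  have hpc : ContDiff ℝ ∞ fun x : ι → ℝ => x p := contDiff_apply ℝ ℝ p
  have conv : ∀ (f : ℝ → ℝ) (v : (ι → ℝ) → ℝ), LocallyIntegrable f volume → ContDiff ℝ ∞ v →
      ContDiff ℝ ∞ fun x : ι → ℝ => ∫ t, f t * ζ (Function.update x p (v x - t)) := by
    intro f v hf hv
    rw [← contDiffOn_univ]
    have := contDiffOn_convolution_right_with_param_comp (𝕜 := ℝ) (μ := (volume : Measure ℝ))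
      (n := ⊤) (ContinuousLinearMap.mul ℝ ℝ) (s := Set.univ) (v := v) hv.contDiffOn (f := f)
      (g := fun x t => ζ (Function.update x p t)) isOpen_univ (isCompact_closedBall (0 : ℝ) c)
      (fun x t _ ht => line_eq_zero hc x (by simpa using ht)) hf
      (contDiff_update_line hζ).contDiffOn
    exact this
  have h1 : ContDiff ℝ ∞ fun x : ι → ℝ => ∫ t, ζ (Function.update x p t) := by
    have := conv (fun _ => 1) (fun _ => 0) (locallyIntegrable_const 1) contDiff_const
    convert this using 2 with x
    simp only [one_mul]
    exact (integral_sub_left_eq_self (fun t => ζ (Function.update x p t)) volume 0).symm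
  have h2 : ContDiff ℝ ∞ fun x : ι → ℝ => ∫ t in Set.Ioi (x p), ζ (Function.update x p t) := by
    have := conv ((Set.Iio 0).indicator fun _ => 1) (fun x => x p)
      ((locallyIntegrable_const (1 : ℝ)).indicator measurableSet_Iio) hpc
    convert this using 2 with x
    rw [← integral_indicator measurableSet_Ioi,
      ← integral_sub_left_eq_self _ volume (x p)]
    congr 1 with t
    by_cases ht : t < 0
    · simp [Set.indicator, ht]
    · have : ¬ x p < x p - t := by linarith
      simp only [Set.indicator, Set.mem_Ioi, Set.mem_Iio, ht, this, if_false, zero_mul]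
  exact (((contDiff_integral_Ioi hd hdi).comp hpc).mul h1).sub h2

theorem fderiv_linePrimitive (hd : ContDiff ℝ ∞ d) (hdi : Integrable d)
    (hζ : ContDiff ℝ ∞ ζ) (hc : ∀ x, c < ‖x‖ → ζ x = 0) (x : ι → ℝ) :
    fderiv ℝ (linePrimitive d p ζ) x (Pi.single p 1)
      = ζ x - d (x p) * ∫ t, ζ (Function.update x p t) := by
  have hdiff : DifferentiableAt ℝ (linePrimitive d p ζ) x :=
    (contDiff_linePrimitive hd hdi hζ hc).differentiable (by simp) x
  rw [← hdiff.lineDeriv_eq_fderiv]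
  refine HasLineDerivAt.lineDeriv ?_
  unfold HasLineDerivAt
  have hup : ∀ s t : ℝ, Function.update (x + s • (Pi.single p 1 : ι → ℝ)) p t = Function.update x p t := by
    intro s t
    ext i
    by_cases h : i = p
    · subst h; simp
    · simp [h]
  have hco : ∀ s : ℝ, (x + s • (Pi.single p 1 : ι → ℝ)) p = x p + s := fun s => by simp
  have hlp : ∀ s : ℝ, linePrimitive d p ζ (x + s • (Pi.single p 1 : ι → ℝ))
      = (∫ t in Set.Ioi (x p + s), d t) * (∫ t, ζ (Function.update x p t))
        - ∫ t in Set.Ioi (x p + s), ζ (Function.update x p t) := by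
    intro s
    simp only [linePrimitive, hup, hco]
  simp_rw [hlp]
  have h1 : HasDerivAt (fun s : ℝ => ∫ t in Set.Ioi (x p + s), d t) (-d (x p)) 0 := by
    have := (hasDerivAt_integral_Ioi hd.continuous hdi (x p + 0)).comp_const_add (x p) 0
    simpa using this
  have h2 : HasDerivAt (fun s : ℝ => ∫ t in Set.Ioi (x p + s), ζ (Function.update x p t))
      (-ζ x) 0 := by
    have := (hasDerivAt_integral_Ioi (continuous_line (p := p) hζ x) (integrable_line hζ hc x)
      (x p + 0)).comp_const_add (x p) 0
    simpa using this
  have h3 := (h1.mul_const (∫ t, ζ (Function.update x p t))).sub h2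
  exact h3.congr_deriv (by ring)

/-- Beyond the support to the right, both tail integrals vanish; to the left they are the full
integrals and cancel because `∫ d = 1`. This is why the multiple of `d` is subtracted from `ζ`: the
primitive becomes an admissible test function. -/
theorem linePrimitive_eq_zero (hds : ∀ t, 1 / 4 < |t| → d t = 0) (hd1 : ∫ t, d t = 1)
    (hc4 : 1 / 4 ≤ c) (hc : ∀ x, c < ‖x‖ → ζ x = 0) {x : ι → ℝ} (hx : c < ‖x‖) :
    linePrimitive d p ζ x = 0 := by
  obtain ⟨i, hi⟩ : ∃ i, c < |x i| := by
    by_contra h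
    push Not at h
    exact absurd hx (not_lt.2 ((pi_norm_le_iff_of_nonneg (by linarith)).2 h))
  by_cases hip : i = p
  · subst hip
    rcases lt_abs.1 hi with h | h
    · have e1 : ∫ t in Set.Ioi (x i), d t = 0 :=
        setIntegral_eq_zero_of_forall_eq_zero fun t (ht : x i < t) =>
          hds t (lt_abs.2 (Or.inl (by linarith)))
      have e2 : ∫ t in Set.Ioi (x i), ζ (Function.update x i t) = 0 :=
        setIntegral_eq_zero_of_forall_eq_zero fun t (ht : x i < t) =>
          line_eq_zero hc x (lt_abs.2 (Or.inl (by linarith)))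
      rw [linePrimitive, e1, e2]; ring
    · have e1 : ∫ t in Set.Ioi (x i), d t = 1 := by
        rw [← hd1]
        refine setIntegral_eq_integral_of_forall_compl_eq_zero fun t ht => ?_
        have : t ≤ x i := not_lt.1 ht
        exact hds t (lt_abs.2 (Or.inr (by linarith)))
      have e2 : ∫ t in Set.Ioi (x i), ζ (Function.update x i t)
          = ∫ t, ζ (Function.update x i t) := by
        refine setIntegral_eq_integral_of_forall_compl_eq_zero fun t ht => ?_
        have : t ≤ x i := not_lt.1 ht
        exact line_eq_zero hc x (lt_abs.2 (Or.inr (by linarith)))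
      rw [linePrimitive, e1, e2]; ring
  · have hz : ∀ t, ζ (Function.update x p t) = 0 := fun t => by
      refine hc _ (lt_of_lt_of_le hi ?_)
      simpa [Function.update_of_ne hip] using norm_le_pi_norm (Function.update x p t) i
    simp [linePrimitive, hz]

end Poincare

end

/-! ### Representation of a function on a line by its weak derivative -/

section

section Poincare

variable {ι : Type*} [Fintype ι] {d : ℝ → ℝ} {p : ι}

/-- The kernel representing `ψ - ∫ d(t) ψ dt` by the derivative of `ψ`. -/
def lineKernel (d : ℝ → ℝ) (s t : ℝ) : ℝ := (Set.Ioi t).indicator 1 s - ∫ u in Set.Ioi t, d u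

theorem measurable_lineKernel (hd : ContDiff ℝ ∞ d) (hdi : Integrable d) :
    Measurable fun z : ℝ × ℝ => lineKernel d z.1 z.2 := by
  refine Measurable.sub ?_ ((contDiff_integral_Ioi hd hdi).continuous.measurable.comp measurable_snd)
  have : Measurable fun z : ℝ × ℝ => {z : ℝ × ℝ | z.2 < z.1}.indicator (1 : ℝ × ℝ → ℝ) z :=
    measurable_one.indicator (measurableSet_lt measurable_snd measurable_fst)
  exact this

/-- The kernel is the difference of an indicator and a tail probability, both in `[0, 1]`. -/
theorem abs_lineKernel_le (hdi : Integrable d) (hd0 : ∀ t, 0 ≤ d t) (hd1 : ∫ t, d t = 1) (s t : ℝ) :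
    |lineKernel d s t| ≤ 1 := by
  have h0 : 0 ≤ ∫ u in Set.Ioi t, d u := setIntegral_nonneg measurableSet_Ioi fun u _ => hd0 u
  have h1 : ∫ u in Set.Ioi t, d u ≤ 1 := by
    rw [← hd1]; exact setIntegral_le_integral hdi (Filter.Eventually.of_forall hd0)
  unfold lineKernel
  by_cases h : t < s
  · rw [Set.indicator_of_mem (by exact h), Pi.one_apply, abs_le]; constructor <;> linarith
  · rw [Set.indicator_of_notMem (by exact h), abs_le]; constructor <;> linarith

theorem integral_comp_of_measurePreserving {X Y : Type*} [MeasurableSpace X] [MeasurableSpace Y]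
    {μ : Measure X} {ν : Measure Y} {T : X → Y} (hT : MeasurePreserving T μ ν) {F : Y → ℂ}
    (hF : AEStronglyMeasurable F ν) : ∫ x, F (T x) ∂μ = ∫ y, F y ∂ν := by
  rw [← hT.map_eq, integral_map hT.aemeasurable (hT.map_eq ▸ hF)]

theorem integral_unitCube_eval {f : ℝ → ℝ} (hf : Measurable f)
    (hs : ∀ t, 1 / 2 ≤ |t| → f t = 0) : ∫ y, f (y p) ∂(unitCube ι) = ∫ t, f t := by
  have h := measurePreserving_eval (fun _ : ι => unitInterval) p
  have h1 : ∫ y, f (y p) ∂(unitCube ι) = ∫ t, f t ∂unitInterval := by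
    rw [← h.map_eq, integral_map h.aemeasurable hf.aestronglyMeasurable]
    rfl
  rw [h1, unitInterval, setIntegral_eq_integral_of_forall_compl_eq_zero]
  intro t ht
  refine hs t ?_
  by_contra hlt
  rw [not_le, abs_lt] at hlt
  exact ht ⟨hlt.1, hlt.2⟩

variable [DecidableEq ι]

/-- A weakly differentiable function is the sum of a function independent of the coordinate `p` and
an integral of its derivative in direction `p`. -/
theorem line_representation (hd : ContDiff ℝ ∞ d) (hd0 : ∀ t, 0 ≤ d t)
    (hds : ∀ t, 1 / 4 < |t| → d t = 0) (hd1 : ∫ t, d t = 1) {ψ G : (ι → ℝ) → ℂ}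
    (hψ : MemLp ψ 2 (unitCube ι)) (hG : MemLp G 2 (unitCube ι))
    (hweak : HasWeakDirDeriv (Metric.ball 0 (1 / 2)) ψ (Pi.single p 1) G) :
    ∀ᵐ x ∂(unitCube ι), ψ x
      = (∫ y, (d (y p) : ℂ) * ψ (Function.update x p (y p)) ∂(unitCube ι))
        + ∫ y, (lineKernel d (x p) (y p) : ℂ) * G (Function.update x p (y p)) ∂(unitCube ι) := by
  set μ := unitCube ι with hμ
  have hdc : HasCompactSupport d := HasCompactSupport.intro (isCompact_closedBall (0 : ℝ) (1 / 4))
    fun t ht => hds t (by simpa using ht)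
  have hdi : Integrable d := hd.continuous.integrable_of_hasCompactSupport hdc
  obtain ⟨Cd, hCd⟩ := hdc.exists_bound_of_continuous hd.continuous
  have hT : MeasurePreserving (fun z : (ι → ℝ) × (ι → ℝ) =>
      (Function.update z.1 p (z.2 p), Function.update z.2 p (z.1 p))) (μ.prod μ) (μ.prod μ) :=
    measurePreserving_update_swap unitInterval p
  have hU : MeasurePreserving (fun z : (ι → ℝ) × (ι → ℝ) => Function.update z.1 p (z.2 p))
      (μ.prod μ) μ := measurePreserving_update unitInterval p
  have hψi : Integrable ψ μ := hψ.integrable (by norm_num)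
  have hGi : Integrable G μ := hG.integrable (by norm_num)
  have hψU : Integrable (fun z : (ι → ℝ) × (ι → ℝ) => ψ (Function.update z.1 p (z.2 p)))
      (μ.prod μ) := hU.integrable_comp_of_integrable hψi
  have hGU : Integrable (fun z : (ι → ℝ) × (ι → ℝ) => G (Function.update z.1 p (z.2 p)))
      (μ.prod μ) := hU.integrable_comp_of_integrable hGi
  have hkm := measurable_lineKernel hd hdi
  have hkm' : Measurable fun z : (ι → ℝ) × (ι → ℝ) => lineKernel d (z.1 p) (z.2 p) :=
    hkm.comp (f := fun z : (ι → ℝ) × (ι → ℝ) => (z.1 p, z.2 p)) (by fun_prop)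
  have hdm' : Measurable fun z : (ι → ℝ) × (ι → ℝ) => d (z.2 p) :=
    hd.continuous.measurable.comp ((measurable_pi_apply p).comp measurable_snd)
  have hdψ : Integrable (fun z : (ι → ℝ) × (ι → ℝ) =>
      (d (z.2 p) : ℂ) * ψ (Function.update z.1 p (z.2 p))) (μ.prod μ) :=
    hψU.bdd_mul (c := Cd) (Complex.measurable_ofReal.comp hdm').aestronglyMeasurable
      (Filter.Eventually.of_forall fun z => by simpa using hCd (z.2 p))
  have hkG : Integrable (fun z : (ι → ℝ) × (ι → ℝ) =>
      (lineKernel d (z.1 p) (z.2 p) : ℂ) * G (Function.update z.1 p (z.2 p))) (μ.prod μ) :=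
    hGU.bdd_mul (c := 1) (Complex.measurable_ofReal.comp hkm').aestronglyMeasurable
      (Filter.Eventually.of_forall fun z => by
        simpa using abs_lineKernel_le hdi hd0 hd1 (z.1 p) (z.2 p))
  set A : (ι → ℝ) → ℂ := fun x => ∫ y, (d (y p) : ℂ) * ψ (Function.update x p (y p)) ∂μ with hA
  set H : (ι → ℝ) → ℂ := fun x =>
    ∫ y, (lineKernel d (x p) (y p) : ℂ) * G (Function.update x p (y p)) ∂μ with hH
  have hAi : Integrable A μ := hdψ.integral_prod_left
  have hHi : Integrable H μ := hkG.integral_prod_left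
  have hmain : ∀ᵐ x : ι → ℝ, x ∈ Metric.ball (0 : ι → ℝ) (1 / 2) → ψ x - A x - H x = 0 := by
    have hint : Integrable (fun x => ψ x - A x - H x) μ := (hψi.sub hAi).sub hHi
    refine Metric.isOpen_ball.ae_eq_zero_of_integral_contDiff_smul_eq_zero
      (IntegrableOn.locallyIntegrableOn (by rw [IntegrableOn, ← unitCube_eq]; exact hint)) ?_
    intro ζ hζ hζc hζs
    -- One radius `c < 1/2` serves both `ζ` and the density `d`, whose support is in `[-1/4, 1/4]`.
    obtain ⟨c, hc4, hc2, hc⟩ : ∃ c, 1 / 4 ≤ c ∧ c < 1 / 2 ∧ ∀ x, c < ‖x‖ → ζ x = 0 := by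
      obtain ⟨c', hc', hsub⟩ := exists_lt_subset_ball (isClosed_tsupport ζ) hζs
      refine ⟨max c' (1 / 4), le_max_right _ _, max_lt hc' (by norm_num), fun x hx => ?_⟩
      by_contra h
      have h1 := hsub (subset_tsupport _ h)
      rw [mem_ball_zero_iff] at h1
      exact absurd ((le_max_left _ _).trans_lt hx) (not_lt.2 h1.le)
    obtain ⟨Cζ, hCζ⟩ := hζc.exists_bound_of_continuous hζ.continuous
    have hζm : ∀ f : (ι → ℝ) × (ι → ℝ) → (ι → ℝ), Measurable f →
        AEStronglyMeasurable (fun z => ((ζ (f z) : ℝ) : ℂ)) (μ.prod μ) := fun f hf =>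
      (Complex.measurable_ofReal.comp (hζ.continuous.measurable.comp hf)).aestronglyMeasurable
    have hζb : ∀ f : (ι → ℝ) × (ι → ℝ) → (ι → ℝ), ∀ᵐ z ∂(μ.prod μ), ‖((ζ (f z) : ℝ) : ℂ)‖ ≤ Cζ :=
      fun f => Filter.Eventually.of_forall fun z => by simpa using hCζ (f z)
    have hζ1 : ∀ {F : (ι → ℝ) → ℂ}, Integrable F μ → Integrable (fun x => ((ζ x : ℝ) : ℂ) * F x) μ :=
      fun hF => hF.bdd_mul (c := Cζ)
        (Complex.measurable_ofReal.comp hζ.continuous.measurable).aestronglyMeasurable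
        (Filter.Eventually.of_forall fun z => by simpa using hCζ z)
    have hupd : ∀ x y : ι → ℝ, Function.update (Function.update x p (y p)) p
        (x p) = x := fun x y => by simp
    have iA : Integrable (fun z : (ι → ℝ) × (ι → ℝ) => ((ζ z.1 : ℝ) : ℂ) *
        ((d (z.2 p) : ℂ) * ψ (Function.update z.1 p (z.2 p)))) (μ.prod μ) :=
      hdψ.bdd_mul (hζm _ measurable_fst) (hζb _)
    have hZ : ∀ x : ι → ℝ, ∫ y, ((ζ (Function.update x p (y p)) : ℝ) : ℂ) *
        ((d (x p) : ℂ) * ψ x) ∂μ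
        = ((d (x p) * ∫ t, ζ (Function.update x p t) : ℝ) : ℂ) * ψ x := by
      intro x
      rw [integral_mul_const, ← integral_unitCube_eval (ι := ι) (p := p)
        (continuous_line hζ x).measurable (fun t ht => line_eq_zero hc x (by linarith)),
        integral_complex_ofReal]
      push_cast; ring
    have eA : ∫ x, ((ζ x : ℝ) : ℂ) * A x ∂μ
        = ∫ x, ((d (x p) * ∫ t, ζ (Function.update x p t) : ℝ) : ℂ) * ψ x ∂μ := by
      -- Exchanging the `p`-th coordinates of `x` and `y` preserves the product measure; it turns
      -- the updated argument of `ψ` into `x` and moves the update onto `ζ`.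
      have i2 := hT.integrable_comp_of_integrable iA
      have e := integral_comp_of_measurePreserving hT iA.aestronglyMeasurable
      have e1 := integral_prod _ iA
      have e2 := integral_prod _ i2
      simp only [Function.comp_def] at e2
      rw [e, e1] at e2
      simp only [integral_const_mul] at e2
      rw [e2]
      refine integral_congr_ae (Filter.Eventually.of_forall fun x => ?_)
      simp only [hupd, Function.update_self]
      exact hZ x
    have eH : ∫ x, ((ζ x : ℝ) : ℂ) * H x ∂μ
        = -∫ x, ((linePrimitive d p ζ x : ℝ) : ℂ) * G x ∂μ := by
      have i1 : Integrable (fun z : (ι → ℝ) × (ι → ℝ) => ((ζ z.1 : ℝ) : ℂ) *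
          ((lineKernel d (z.1 p) (z.2 p) : ℂ) * G (Function.update z.1 p (z.2 p)))) (μ.prod μ) :=
        hkG.bdd_mul (hζm _ measurable_fst) (hζb _)
      have i2 := hT.integrable_comp_of_integrable i1
      have e := integral_comp_of_measurePreserving hT i1.aestronglyMeasurable
      have e1 := integral_prod _ i1
      have e2 := integral_prod _ i2
      simp only [Function.comp_def] at e2
      rw [e, e1] at e2
      simp only [integral_const_mul] at e2
      rw [e2, ← integral_neg]
      refine integral_congr_ae (Filter.Eventually.of_forall fun x => ?_)
      simp only [hupd, Function.update_self]
      simp only [← mul_assoc, ← Complex.ofReal_mul]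
      rw [integral_mul_const, integral_complex_ofReal, ← neg_mul, ← Complex.ofReal_neg]
      congr 2
      have hsm : ∀ t, 1 / 2 ≤ |t| → ζ (Function.update x p t) = 0 := fun t ht =>
        line_eq_zero hc x (by linarith)
      have hkx : Measurable fun t => ζ (Function.update x p t) * lineKernel d t (x p) :=
        (continuous_line hζ x).measurable.mul 
          (hkm.comp (f := fun t : ℝ => (t, x p)) (by fun_prop))
      rw [integral_unitCube_eval (ι := ι) (p := p)
        (f := fun t => ζ (Function.update x p t) * lineKernel d t (x p)) hkx
        (fun t ht => by rw [hsm t ht, zero_mul])]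
      have hsplit : ∀ t, ζ (Function.update x p t) * lineKernel d t (x p)
          = (Set.Ioi (x p)).indicator (fun t => ζ (Function.update x p t)) t
            - (∫ u in Set.Ioi (x p), d u) * ζ (Function.update x p t) := by
        intro t
        by_cases ht : x p < t
        · simp only [lineKernel, Set.indicator, Set.mem_Ioi, ht, if_true, Pi.one_apply]; ring
        · simp only [lineKernel, Set.indicator, Set.mem_Ioi, ht, if_false]; ring
      have hli := integrable_line (p := p) hζ hc x
      simp_rw [hsplit]
      rw [integral_sub (hli.indicator measurableSet_Ioi) (hli.const_mul _), integral_const_mul,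
        integral_indicator measurableSet_Ioi, linePrimitive]
      ring
    have hηt : IsTestFunction (Metric.ball (0 : ι → ℝ) (1 / 2)) (linePrimitive d p ζ) := by
      have hsub : tsupport (linePrimitive d p ζ) ⊆ Metric.closedBall 0 c := by
        refine closure_minimal (fun x hx => ?_) Metric.isClosed_closedBall
        by_contra h
        exact hx (linePrimitive_eq_zero hds hd1 hc4 hc (by simpa using h))
      exact ⟨contDiff_linePrimitive hd hdi hζ hc,
        HasCompactSupport.of_support_subset_isCompact (isCompact_closedBall 0 c)
          ((subset_tsupport _).trans hsub), hsub.trans (Metric.closedBall_subset_ball hc2)⟩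
    -- Testing with the line primitive, whose derivative is `ζ - d(x p) ∫ ζ`, yields `ψ - A` on one
    -- side and the kernel integral of `G` on the other.
    have key := hweak _ hηt
    rw [← unitCube_eq, ← hμ] at key
    simp only [fderiv_linePrimitive hd hdi hζ hc, Complex.real_smul] at key
    have hζcube : ∀ F : (ι → ℝ) → ℂ, ∫ x, ζ x • F x = ∫ x, ((ζ x : ℝ) : ℂ) * F x ∂μ := by
      intro F
      rw [hμ, unitCube_eq, setIntegral_eq_integral_of_forall_compl_eq_zero]
      · simp only [Complex.real_smul]
      · intro x hx
        have : ζ x = 0 := by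
          by_contra h
          exact hx (hζs (subset_tsupport _ h))
        simp [this]
    rw [hζcube]
    simp only [mul_sub]
    have j1 : Integrable (fun x => ((ζ x : ℝ) : ℂ) * ψ x - ((ζ x : ℝ) : ℂ) * A x) μ :=
      (hζ1 hψi).sub (hζ1 hAi)
    rw [integral_sub j1 (hζ1 hHi), integral_sub (hζ1 hψi) (hζ1 hAi), eH, ← key, eA,
      ← integral_sub (hζ1 hψi), sub_eq_zero]
    · refine integral_congr_ae (Filter.Eventually.of_forall fun x => ?_)
      simp only; push_cast; ring
    · have i2 := (hT.integrable_comp_of_integrable iA).integral_prod_left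
      refine i2.congr (Filter.Eventually.of_forall fun x => ?_)
      simp only [Function.comp_def, hupd, Function.update_self]
      exact hZ x
  change ∀ᵐ x ∂μ, ψ x = A x + H x
  rw [hμ, unitCube_eq, ae_restrict_iff' measurableSet_ball]
  filter_upwards [hmain] with x hx hmem
  linear_combination hx hmem

end Poincare

end

/-! ### The Poincaré inequality by resampling coordinates one at a time -/

section

theorem eLpNorm_two_sq {X : Type*} [MeasurableSpace X] {μ : Measure X} (f : X → ℂ) :
    eLpNorm f 2 μ ^ 2 = ∫⁻ x, ‖f x‖ₑ ^ 2 ∂μ := by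
  have := eLpNorm_nnreal_pow_eq_lintegral (μ := μ) (f := f) (p := 2) (by norm_num)
  simpa using this

theorem lintegral_enorm_sq_eq {X : Type*} [MeasurableSpace X] {μ : Measure X} {f : X → ℂ}
    (hf : MemLp f 2 μ) : ∫⁻ x, ‖f x‖ₑ ^ 2 ∂μ = ENNReal.ofReal (∫ x, ‖f x‖ ^ 2 ∂μ) := by
  rw [ofReal_integral_eq_lintegral_ofReal hf.norm.integrable_sq
    (Filter.Eventually.of_forall fun x => by positivity)]
  refine lintegral_congr fun x => ?_
  rw [ENNReal.ofReal_pow (norm_nonneg _), ofReal_norm]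

theorem enorm_integral_sq_le {Y : Type*} [MeasurableSpace Y] {ν : Measure Y}
    [IsProbabilityMeasure ν] {f : Y → ℂ} (hf : AEStronglyMeasurable f ν) :
    ‖∫ y, f y ∂ν‖ₑ ^ 2 ≤ ∫⁻ y, ‖f y‖ₑ ^ 2 ∂ν := by
  rw [← eLpNorm_two_sq]
  gcongr
  calc ‖∫ y, f y ∂ν‖ₑ ≤ ∫⁻ y, ‖f y‖ₑ ∂ν := enorm_integral_le_lintegral_enorm f
    _ = eLpNorm f 1 ν := eLpNorm_one_eq_lintegral_enorm.symm
    _ ≤ eLpNorm f 2 ν := eLpNorm_le_eLpNorm_of_exponent_le (by norm_num) hf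

/-- Averaging over an independent variable is a contraction in `L²`. -/
theorem eLpNorm_integral_le {X Y : Type*} [MeasurableSpace X] [MeasurableSpace Y]
    {μ : Measure X} {ν : Measure Y} [SFinite μ] [IsProbabilityMeasure ν] {f : X × Y → ℂ}
    (hf : AEStronglyMeasurable f (μ.prod ν)) :
    eLpNorm (fun x => ∫ y, f (x, y) ∂ν) 2 μ ≤ eLpNorm f 2 (μ.prod ν) := by
  rw [← (ENNReal.pow_right_strictMono (n := 2) (by norm_num)).le_iff_le, eLpNorm_two_sq, eLpNorm_two_sq,
    lintegral_prod _ (hf.enorm.pow_const 2)]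
  refine lintegral_mono_ae ?_
  filter_upwards [hf.prodMk_left] with x hx
  exact enorm_integral_sq_le hx

section Poincare

variable {ι : Type*} [Fintype ι] [DecidableEq ι] {d : ℝ → ℝ} {p : ι}

/-- In the line representation the first summand does not depend on the coordinate `p` and cancels
in the difference. The kernel is bounded by `1`, so each of the two remaining terms has norm at most
that of `G`. -/
theorem eLpNorm_sub_update_le {ψ G : (ι → ℝ) → ℂ}
    (hψ : MemLp ψ 2 (unitCube ι)) (hG : MemLp G 2 (unitCube ι))
    (hweak : HasWeakDirDeriv (Metric.ball 0 (1 / 2)) ψ (Pi.single p 1) G) :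
    eLpNorm (fun z : (ι → ℝ) × (ι → ℝ) => ψ z.1 - ψ (Function.update z.1 p (z.2 p))) 2
      ((unitCube ι).prod (unitCube ι)) ≤ 2 * eLpNorm G 2 (unitCube ι) := by
  obtain ⟨d, hd, hd0, hds, hd1⟩ := exists_density
  set μ := unitCube ι with hμ
  have hrep := line_representation hd hd0 hds hd1 hψ hG hweak
  have hdc : HasCompactSupport d := HasCompactSupport.intro (isCompact_closedBall (0 : ℝ) (1 / 4))
    fun t ht => hds t (by simpa using ht)
  have hdi : Integrable d := hd.continuous.integrable_of_hasCompactSupport hdc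
  set A : (ι → ℝ) → ℂ := fun x => ∫ y, (d (y p) : ℂ) * ψ (Function.update x p (y p)) ∂μ with hA
  set H : (ι → ℝ) → ℂ := fun x =>
    ∫ y, (lineKernel d (x p) (y p) : ℂ) * G (Function.update x p (y p)) ∂μ with hH
  have hU : MeasurePreserving (fun z : (ι → ℝ) × (ι → ℝ) => Function.update z.1 p (z.2 p))
      (μ.prod μ) μ := measurePreserving_update unitInterval p
  have hkm : Measurable fun z : (ι → ℝ) × (ι → ℝ) => lineKernel d (z.1 p) (z.2 p) :=
    (measurable_lineKernel hd hdi).comp (f := fun z : (ι → ℝ) × (ι → ℝ) => (z.1 p, z.2 p))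
      (by fun_prop)
  have hkG : AEStronglyMeasurable (fun z : (ι → ℝ) × (ι → ℝ) =>
      (lineKernel d (z.1 p) (z.2 p) : ℂ) * G (Function.update z.1 p (z.2 p))) (μ.prod μ) :=
    (Complex.measurable_ofReal.comp hkm).aestronglyMeasurable.mul
      (hG.1.comp_measurePreserving hU)
  have hHm : AEStronglyMeasurable H μ := hkG.integral_prod_right'
  have hHle : eLpNorm H 2 μ ≤ eLpNorm G 2 μ := by
    refine (eLpNorm_integral_le hkG).trans ?_
    rw [← eLpNorm_comp_measurePreserving hG.1 hU]
    refine eLpNorm_mono fun z => ?_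
    rw [norm_mul, Complex.norm_real, Real.norm_eq_abs]
    exact mul_le_of_le_one_left (norm_nonneg _) (abs_lineKernel_le hdi hd0 hd1 _ _)
  have hAu : ∀ x t, A (Function.update x p t) = A x := fun x t => by
    simp only [hA, Function.update_idem]
  have hae : (fun z : (ι → ℝ) × (ι → ℝ) => ψ z.1 - ψ (Function.update z.1 p (z.2 p)))
      =ᵐ[μ.prod μ] fun z => H z.1 - H (Function.update z.1 p (z.2 p)) := by
    have h1 := (measurePreserving_fst (μ := μ) (ν := μ)).quasiMeasurePreserving.ae hrep
    have h2 := hU.quasiMeasurePreserving.ae hrep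
    filter_upwards [h1, h2] with z hz1 hz2
    have e1 : ψ z.1 = A z.1 + H z.1 := hz1
    have e2 : ψ (Function.update z.1 p (z.2 p)) = A z.1 + H (Function.update z.1 p (z.2 p)) := by
      rw [← hAu z.1 (z.2 p)]; exact hz2
    rw [e1, e2]; ring
  rw [eLpNorm_congr_ae hae]
  have f1 : AEStronglyMeasurable (fun z : (ι → ℝ) × (ι → ℝ) => H z.1) (μ.prod μ) :=
    hHm.comp_measurePreserving measurePreserving_fst
  have f2 : AEStronglyMeasurable (fun z : (ι → ℝ) × (ι → ℝ) =>
    H (Function.update z.1 p (z.2 p))) (μ.prod μ) := hHm.comp_measurePreserving hU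
  refine (eLpNorm_sub_le f1 f2 (by norm_num)).trans ?_
  have g1 := eLpNorm_comp_measurePreserving (p := 2) hHm
    (measurePreserving_fst (μ := μ) (ν := μ))
  have g2 := eLpNorm_comp_measurePreserving (p := 2) hHm hU
  simp only [Function.comp_def] at g1 g2
  rw [g1, g2, two_mul]
  gcongr

/-- A telescoping argument: the coordinates are replaced one after another, and each replacement is
the one-coordinate estimate composed with a measure preserving exchange of the coordinates already
treated. -/
theorem eLpNorm_sub_piecewise_le {ψ : (ι → ℝ) → ℂ} {G : ι → (ι → ℝ) → ℂ}
    (hψ : MemLp ψ 2 (unitCube ι)) (hG : ∀ p, MemLp (G p) 2 (unitCube ι))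
    (hweak : ∀ p, HasWeakDirDeriv (Metric.ball 0 (1 / 2)) ψ (Pi.single p 1) (G p))
    (s : Finset ι) :
    eLpNorm (fun z : (ι → ℝ) × (ι → ℝ) => ψ z.1 - ψ (s.piecewise z.2 z.1)) 2
      ((unitCube ι).prod (unitCube ι)) ≤ ∑ p ∈ s, 2 * eLpNorm (G p) 2 (unitCube ι) := by
  induction s using Finset.induction_on with
  | empty => simp
  | insert p s hp ih =>
    rw [Finset.sum_insert hp, add_comm]
    have hT : MeasurePreserving _ ((unitCube ι).prod (unitCube ι))
      ((unitCube ι).prod (unitCube ι)) := measurePreserving_piecewise_swap unitInterval s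
    have hU : MeasurePreserving (fun z : (ι → ℝ) × (ι → ℝ) => Function.update z.1 p (z.2 p))
      ((unitCube ι).prod (unitCube ι)) (unitCube ι) := measurePreserving_update unitInterval p
    have m1 : AEStronglyMeasurable (fun z : (ι → ℝ) × (ι → ℝ) => ψ z.1)
        ((unitCube ι).prod (unitCube ι)) := hψ.1.comp_measurePreserving measurePreserving_fst
    have m2 : AEStronglyMeasurable (fun z : (ι → ℝ) × (ι → ℝ) =>
        ψ (Function.update z.1 p (z.2 p))) ((unitCube ι).prod (unitCube ι)) :=
      hψ.1.comp_measurePreserving hU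
    have m3 := m1.comp_measurePreserving hT
    have m4 := (m1.sub m2).comp_measurePreserving hT
    have e := eLpNorm_comp_measurePreserving (p := 2) (m1.sub m2) hT
    have hsplit : (fun z : (ι → ℝ) × (ι → ℝ) => ψ z.1 - ψ ((insert p s).piecewise z.2 z.1))
        = (fun z => ψ z.1 - ψ (s.piecewise z.2 z.1)) +
          ((fun z : (ι → ℝ) × (ι → ℝ) => ψ z.1 - ψ (Function.update z.1 p (z.2 p))) ∘
            fun z => (s.piecewise z.2 z.1, s.piecewise z.1 z.2)) := by
      ext z
      simp [Finset.piecewise_insert, hp]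
    rw [hsplit]
    refine (eLpNorm_add_le (m1.sub m3) m4 (by norm_num)).trans (add_le_add ih ?_)
    refine (le_of_eq e).trans ?_
    exact eLpNorm_sub_update_le hψ (hG p) (hweak p)

/-- With all coordinates resampled, `z.2` is an independent copy. Averaging over it gives the
deviation from the mean, and Cauchy–Schwarz over the coordinates turns the squared sum of norms into
`Fintype.card ι` times the sum of squares. -/
theorem poincare_unitCube {ψ : (ι → ℝ) → ℂ} {G : ι → (ι → ℝ) → ℂ}
    (hψ : MemLp ψ 2 (unitCube ι)) (hG : ∀ p, MemLp (G p) 2 (unitCube ι))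
    (hweak : ∀ p, HasWeakDirDeriv (Metric.ball 0 (1 / 2)) ψ (Pi.single p 1) (G p)) :
    ∫ x, ‖ψ x - ∫ y, ψ y ∂(unitCube ι)‖ ^ 2 ∂(unitCube ι)
      ≤ 4 * Fintype.card ι * ∑ p, ∫ x, ‖G p x‖ ^ 2 ∂(unitCube ι) := by
  set μ := unitCube ι with hμ
  have hψi : Integrable ψ μ := hψ.integrable (by norm_num)
  have h := eLpNorm_sub_piecewise_le hψ hG hweak Finset.univ
  simp only [Finset.piecewise_univ] at h
  rw [← Finset.mul_sum] at h
  have m1 : AEStronglyMeasurable (fun z : (ι → ℝ) × (ι → ℝ) => ψ z.1 - ψ z.2) (μ.prod μ) :=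
    (hψ.1.comp_measurePreserving measurePreserving_fst).sub
      (hψ.1.comp_measurePreserving measurePreserving_snd)
  have h2 := (eLpNorm_integral_le m1).trans h
  have e : (fun x => ∫ y, (ψ x - ψ y) ∂μ) = fun x => ψ x - ∫ y, ψ y ∂μ := by
    ext x
    rw [integral_sub (integrable_const _) hψi]; simp
  rw [e] at h2
  have h3 : eLpNorm (fun x => ψ x - ∫ y, ψ y ∂μ) 2 μ ^ 2
      ≤ (2 * ∑ p, eLpNorm (G p) 2 μ) ^ 2 := by gcongr
  have hD : MemLp (fun x => ψ x - ∫ y, ψ y ∂μ) 2 μ := hψ.sub (memLp_const _)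
  have hreal : ∀ p, eLpNorm (G p) 2 μ = ENNReal.ofReal (√(∫ x, ‖G p x‖ ^ 2 ∂μ)) := by
    intro p
    rw [← ENNReal.pow_right_strictMono (n := 2) (by norm_num) |>.injective.eq_iff,
      eLpNorm_two_sq, lintegral_enorm_sq_eq (hG p), ← ENNReal.ofReal_pow (Real.sqrt_nonneg _),
      Real.sq_sqrt (integral_nonneg fun x => by positivity)]
  rw [eLpNorm_two_sq, lintegral_enorm_sq_eq hD] at h3
  simp_rw [hreal] at h3
  rw [← ENNReal.ofReal_sum_of_nonneg (fun _ _ => Real.sqrt_nonneg _),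
    ← ENNReal.ofReal_ofNat, ← ENNReal.ofReal_mul (by norm_num), ← ENNReal.ofReal_pow (by positivity),
    ENNReal.ofReal_le_ofReal_iff (by positivity)] at h3
  refine h3.trans ?_
  rw [mul_pow]
  have := sq_sum_le_card_mul_sum_sq (s := (Finset.univ : Finset ι))
    (f := fun p => √(∫ x, ‖G p x‖ ^ 2 ∂μ))
  simp only [Finset.card_univ] at this
  have e2 : ∀ p, √(∫ x, ‖G p x‖ ^ 2 ∂μ) ^ 2 = ∫ x, ‖G p x‖ ^ 2 ∂μ := fun p =>
    Real.sq_sqrt (integral_nonneg fun x => by positivity)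
  simp_rw [e2] at this
  linarith

end Poincare

end

/-! ### Configurations of particles in Cartesian coordinates -/

section

theorem measurePreserving_curry_pi {ι κ α : Type*} [Fintype ι] [Fintype κ] [MeasurableSpace α]
    (ν : Measure α) [SigmaFinite ν] :
    MeasurePreserving (Function.curry : (ι × κ → α) → ι → κ → α)
      (Measure.pi fun _ => ν) (Measure.pi fun _ => Measure.pi fun _ => ν) := by
  have hm : Measurable (Function.curry : (ι × κ → α) → ι → κ → α) :=
    (MeasurableEquiv.curry ι κ α).measurable
  refine ⟨hm, ?_⟩
  symm
  refine Measure.pi_eq_generateFrom (fun _ => generateFrom_pi) (fun _ => isPiSystem_pi)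
    (fun _ => Measure.FiniteSpanningSetsIn.pi fun _ => ν.toFiniteSpanningSetsIn) ?_
  intro s hs
  choose t ht using hs
  have hst : ∀ i, s i = Set.univ.pi (t i) := fun i => ((ht i).2).symm
  have htm : ∀ i k, MeasurableSet (t i k) := fun i k => (ht i).1 k (Set.mem_univ k)
  rw [Measure.map_apply hm (MeasurableSet.univ_pi fun i => by
    rw [hst]; exact MeasurableSet.univ_pi (htm i))]
  have : Function.curry ⁻¹' Set.univ.pi s = Set.univ.pi fun p : ι × κ => t p.1 p.2 := by
    ext x
    simp [hst, Set.mem_pi, Function.curry]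
  rw [this, Measure.pi_pi, Fintype.prod_prod_type]
  simp [hst, Measure.pi_pi]

/-! ### The box -/

/-- The open unit cube in `ℝ³`. -/
def cube : Set E3 := {z | ∀ k, |z k| < 1 / 2}

/-- Lebesgue measure on the unit cube. -/
def cubeMeasure : Measure E3 := volume.restrict cube

/-- Lebesgue measure on the configurations in the unit cube. -/
def boxMeasure (n : ℕ) : Measure (Config n) := Measure.pi fun _ => cubeMeasure

theorem toLp_preimage_cube : (WithLp.toLp 2 : (Fin 3 → ℝ) → E3) ⁻¹' cube = Metric.ball 0 (1 / 2) := by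
  ext x
  rw [mem_ball_zero_iff, pi_norm_lt_iff (by norm_num)]
  rfl

theorem isOpen_cube : IsOpen cube := by
  have : cube = ⋂ k, {z : E3 | |z k| < 1 / 2} := by ext; simp [cube]
  rw [this]
  exact isOpen_iInter_of_finite fun k => isOpen_lt (by fun_prop) continuous_const

theorem measurePreserving_toLp_cube :
    MeasurePreserving (WithLp.toLp 2 : (Fin 3 → ℝ) → E3) (unitCube (Fin 3)) cubeMeasure := by
  rw [unitCube_eq, ← toLp_preimage_cube]
  exact (PiLp.volume_preserving_toLp (Fin 3)).restrict_preimage isOpen_cube.measurableSet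

instance : IsProbabilityMeasure cubeMeasure :=
  ⟨by rw [← measurePreserving_toLp_cube.measure_preimage MeasurableSet.univ.nullMeasurableSet]; simp⟩

variable {n : ℕ}

instance : IsProbabilityMeasure (boxMeasure n) := by unfold boxMeasure; infer_instance

theorem unitBox_eq_pi : unitBox n = Set.univ.pi fun _ => cube := by
  ext x; simp [unitBox, cube]

theorem boxMeasure_eq : boxMeasure n = volume.restrict (unitBox n) := by
  rw [unitBox_eq_pi, volume_pi, Measure.restrict_pi_pi]
  rfl

/-- Coordinates on the space of configurations. -/
def coordEquiv (n : ℕ) : (Fin n × Fin 3 → ℝ) ≃L[ℝ] Config n :=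
  ((LinearEquiv.curry ℝ ℝ (Fin n) (Fin 3)).trans
    (LinearEquiv.piCongrRight fun _ => (WithLp.linearEquiv 2 ℝ (Fin 3 → ℝ)).symm)).toContinuousLinearEquiv

theorem coordEquiv_apply (y : Fin n × Fin 3 → ℝ) (i : Fin n) :
    coordEquiv n y i = WithLp.toLp 2 (fun k => y (i, k)) := rfl

theorem coordEquiv_single (p : Fin n × Fin 3) :
    coordEquiv n (Pi.single p 1) = configUnitVec p := by
  ext i k
  rw [coordEquiv_apply, configUnitVec]
  by_cases hi : i = p.1
  · subst hi
    by_cases hk : k = p.2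
    · subst hk; simp [unitVec]
    · have : ¬ (p.1, k) = p := fun h => hk (by rw [← h])
      simp [unitVec, hk, this]
  · have : ¬ (i, k) = p := fun h => hi (by rw [← h])
    simp [hi, this]

theorem measurePreserving_coordEquiv :
    MeasurePreserving (coordEquiv n) (unitCube (Fin n × Fin 3)) (boxMeasure n) := by
  have h1 : MeasurePreserving (Function.curry : (Fin n × Fin 3 → ℝ) → Fin n → Fin 3 → ℝ)
    (unitCube (Fin n × Fin 3)) (Measure.pi fun _ => unitCube (Fin 3)) :=
    measurePreserving_curry_pi unitInterval
  have h2 := measurePreserving_pi (fun _ : Fin n => unitCube (Fin 3)) (fun _ => cubeMeasure)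
    (fun _ => measurePreserving_toLp_cube)
  exact h2.comp h1

theorem coordEquiv_mem_unitBox {y : Fin n × Fin 3 → ℝ} :
    coordEquiv n y ∈ unitBox n ↔ y ∈ Metric.ball 0 (1 / 2) := by
  rw [mem_ball_zero_iff, pi_norm_lt_iff (by norm_num), Prod.forall]
  rfl

/-- Test functions are transported by the inverse of the linear coordinate map, which preserves the
measure and sends basis vectors to basis vectors. -/
theorem hasWeakDirDeriv_coordEquiv {ψ G : Config n → ℂ} {p : Fin n × Fin 3}
    (h : HasWeakDirDeriv (unitBox n) ψ (configUnitVec p) G) :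
    HasWeakDirDeriv (Metric.ball 0 (1 / 2)) (fun y => ψ (coordEquiv n y)) (Pi.single p 1)
      (fun y => G (coordEquiv n y)) := by
  intro φ hφ
  set e := coordEquiv n with he
  have hemb : MeasurableEmbedding e := e.toHomeomorph.measurableEmbedding
  have hint : ∀ F : Config n → ℂ, ∫ y in Metric.ball 0 (1 / 2), F (e y) = ∫ x in unitBox n, F x := by
    intro F
    rw [← unitCube_eq, ← boxMeasure_eq]
    exact measurePreserving_coordEquiv.integral_comp hemb F
  have hsupp : tsupport (φ ∘ e.symm) = e.symm ⁻¹' tsupport φ := by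
    exact tsupport_comp_eq_preimage φ e.symm.toHomeomorph
  have ht : IsTestFunction (unitBox n) (φ ∘ e.symm) := by
    refine ⟨hφ.smooth.comp e.symm.contDiff, hφ.compact.comp_homeomorph e.symm.toHomeomorph, ?_⟩
    rw [hsupp]
    intro x hx
    have := hφ.supp hx
    rw [← coordEquiv_mem_unitBox, ← he, e.apply_symm_apply] at this
    exact this
  have key := h _ ht
  rw [← hint, ← hint] at key
  simp only [Function.comp_apply, e.symm_apply_apply] at key
  rw [← key]
  congr 1 with y
  congr 1
  rw [e.symm.comp_right_fderiv]
  simp [← coordEquiv_single, he]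

/-- The Poincaré inequality on the box. -/
theorem poincare_box {ψ : Config n → ℂ} {G : Fin n × Fin 3 → Config n → ℂ}
    (hψ : MemLp ψ 2 (boxMeasure n)) (hG : ∀ p, MemLp (G p) 2 (boxMeasure n))
    (hweak : ∀ p, HasWeakDirDeriv (unitBox n) ψ (configUnitVec p) (G p)) :
    ∫ x, ‖ψ x - ∫ y, ψ y ∂(boxMeasure n)‖ ^ 2 ∂(boxMeasure n)
      ≤ 12 * n * ∑ p, ∫ x, ‖G p x‖ ^ 2 ∂(boxMeasure n) := by
  have hemb : MeasurableEmbedding (coordEquiv n) := (coordEquiv n).toHomeomorph.measurableEmbedding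
  have hmp := measurePreserving_coordEquiv (n := n)
  have h := poincare_unitCube (hψ.comp_measurePreserving hmp)
    (fun p => (hG p).comp_measurePreserving hmp) (fun p => hasWeakDirDeriv_coordEquiv (hweak p))
  simp only [Function.comp_apply] at h
  rw [hmp.integral_comp hemb ψ,
    hmp.integral_comp hemb fun x => ‖ψ x - ∫ y, ψ y ∂(boxMeasure n)‖ ^ 2] at h
  simp only [fun p => hmp.integral_comp hemb fun x => ‖G p x‖ ^ 2] at h
  refine h.trans (le_of_eq ?_)
  simp only [Fintype.card_prod, Fintype.card_fin]
  push_cast; ring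

end

/-! ### An upper bound on the three-body scattering energy -/

/-- A real test function belongs to `D¹`. -/
theorem IsTestFunction.memD1 {E : Type*} [NormedAddCommGroup E] [NormedSpace ℝ E]
    [FiniteDimensional ℝ E] [MeasureSpace E] [BorelSpace E]
    [(volume : Measure E).IsAddHaarMeasure] {g : E → ℝ} (hg : IsTestFunction Set.univ g)
    {ι : Type*} (e : ι → E) :
    MemD1 e (fun x => ((g x : ℝ) : ℂ)) (fun i x => ((fderiv ℝ g x (e i) : ℝ) : ℂ)) := by
  have hcont : ∀ {φ : E → ℝ}, IsTestFunction Set.univ φ → ∀ v, Continuous fun x => fderiv ℝ φ x v :=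
    fun hφ v => (hφ.smooth.continuous_fderiv (by simp)).clm_apply continuous_const
  have hcs : ∀ {φ : E → ℝ}, IsTestFunction Set.univ φ → ∀ v,
      HasCompactSupport fun x => fderiv ℝ φ x v :=
    fun hφ v => hφ.compact.fderiv_apply (𝕜 := ℝ) _
  have hgi : Integrable (fun x => ((g x : ℝ) : ℂ)) :=
    (hg.smooth.continuous.integrable_of_hasCompactSupport hg.compact).ofReal
  refine ⟨hgi.locallyIntegrable, fun t ht => hgi.measure_norm_gt_lt_top ht, fun i => ?_,
    fun i φ hφ => ?_⟩
  · exact ((hcont hg (e i)).memLp_of_hasCompactSupport (hcs hg (e i))).ofReal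
  · simp only [Measure.restrict_univ, Complex.real_smul, ← Complex.ofReal_mul]
    rw [integral_complex_ofReal, integral_complex_ofReal, ← Complex.ofReal_neg]
    congr 1
    have h := integral_mul_fderiv_eq_neg_fderiv_mul_of_integrable (μ := (volume : Measure E))
      (f := φ) (g := g) (v := e i)
      (((hcont hφ (e i)).mul hg.smooth.continuous).integrable_of_hasCompactSupport
        hg.compact.mul_left)
      ((hφ.smooth.continuous.mul (hcont hg (e i))).integrable_of_hasCompactSupport
        hφ.compact.mul_right)
      ((hφ.smooth.continuous.mul hg.smooth.continuous).integrable_of_hasCompactSupport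
        hφ.compact.mul_right)
      (fun x _ => hφ.smooth.differentiable (by simp) x)
      (fun x _ => hg.smooth.differentiable (by simp) x)
    rw [h, neg_neg]

theorem normSqM_smul (c : ℝ) (z : Fin 2 × Fin 3 → ℂ) :
    normSqM (fun p => (c : ℂ) * z p) = c ^ 2 * normSqM z := by
  simp only [normSqM, Finset.mul_sum]
  refine Finset.sum_congr rfl fun i _ => Finset.sum_congr rfl fun k _ => ?_
  have : ∑ j, (matM i j : ℂ) * ((c : ℂ) * z (j, k)) = (c : ℂ) * ∑ j, (matM i j : ℂ) * z (j, k) := by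
    rw [Finset.mul_sum]
    exact Finset.sum_congr rfl fun j _ => by ring
  rw [this, norm_mul, mul_pow, Complex.norm_real, Real.norm_eq_abs, sq_abs]

/-- The trial function is a fixed bump rescaled to equal `1` on the support of `W`, so the potential
term vanishes. In six dimensions its gradient energy scales as `R⁶ · R⁻²`, uniformly in `W`. -/
theorem exists_threeBodyScatteringEnergy_le : ∃ C : ℝ, 0 < C ∧ ∀ (W : E3 × E3 → ℝ) (R : ℝ), 0 < R →
    (∀ x y : E3, W (x, y) ≠ 0 → √(‖x‖ ^ 2 + ‖y‖ ^ 2) ≤ R) →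
    threeBodyScatteringEnergy W ≤ C * R ^ 4 := by
  have hHaar : (volume : Measure (E3 × E3)).IsAddHaarMeasure :=
    Measure.prod.instIsAddHaarMeasure volume volume
  let f : ContDiffBump (0 : E3 × E3) := ⟨1, 2, by norm_num, by norm_num⟩
  set D : Fin 2 × Fin 3 → E3 × E3 → ℂ := fun p x => ((fderiv ℝ f x (pairUnitVec p) : ℝ) : ℂ) with hD
  have hDc : ∀ p, Continuous (D p) := fun p => Complex.continuous_ofReal.comp
    ((f.contDiff.continuous_fderiv (n := ∞) (by simp)).clm_apply continuous_const)
  have hNc : Continuous fun x => 2 * normSqM (fun p => D p x) := by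
    unfold normSqM
    fun_prop (disch := exact hDc _)
  have hNs : HasCompactSupport fun x => 2 * normSqM (fun p => D p x) := by
    have hK : IsCompact (Metric.closedBall (0 : E3 × E3) 2) := isCompact_closedBall 0 2
    refine HasCompactSupport.intro hK fun x hx => ?_
    have hz : ∀ p, D p x = 0 := by
      intro p
      have : x ∉ tsupport f := by rw [f.tsupport_eq]; exact hx
      have h0 : fderiv ℝ f x = 0 := by
        by_contra h
        exact this (support_fderiv_subset ℝ h)
      simp [hD, h0]
    simp [normSqM, hz]
  have hNi := hNc.integrable_of_hasCompactSupport (μ := (volume : Measure (E3 × E3))) hNs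
  set I := ∫⁻ x, ENNReal.ofReal (2 * normSqM (fun p => D p x)) with hI
  have hIfin : I ≠ ⊤ := (hNi.lintegral_lt_top).ne
  -- Adding `1` only ensures that the constant is positive.
  refine ⟨I.toReal + 1, by positivity, fun W R hR hW => ?_⟩
  set g : E3 × E3 → ℝ := fun x => f (R⁻¹ • x) with hg
  have hgt : IsTestFunction Set.univ g := by
    refine ⟨f.contDiff.comp (contDiff_const_smul _), ?_, Set.subset_univ _⟩
    exact f.hasCompactSupport.comp_smul (inv_ne_zero hR.ne')
  have hfd : ∀ x v, fderiv ℝ g x v = R⁻¹ * fderiv ℝ f (R⁻¹ • x) v := by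
    intro x v
    have := fderiv_comp_smul (𝕜 := ℝ) (f := f) (c := R⁻¹) (x := x)
    rw [hg, this]; simp
  have hle : (⨅ (g : E3 × E3 → ℂ) (G : Fin 2 × Fin 3 → E3 × E3 → ℂ) (_ : MemD1 pairUnitVec g G),
    ∫⁻ x, ENNReal.ofReal (2 * normSqM (fun p => G p x) + W x * ‖1 - g x‖ ^ 2))
      ≤ ENNReal.ofReal (R ^ 4) * I := by
    refine (iInf₂_le_of_le _ _ (iInf_le_of_le (hgt.memD1 pairUnitVec) le_rfl)).trans ?_
    have hpt : ∀ x, ENNReal.ofReal (2 * normSqM (fun p => ((fderiv ℝ g x (pairUnitVec p) : ℝ) : ℂ))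
          + W x * ‖1 - ((g x : ℝ) : ℂ)‖ ^ 2)
        = ENNReal.ofReal (R⁻¹ ^ 2) *
          (fun y => ENNReal.ofReal (2 * normSqM (fun p => D p y))) (R⁻¹ • x) := by
      intro x
      have h1 : W x * ‖1 - ((g x : ℝ) : ℂ)‖ ^ 2 = 0 := by
        by_cases hWx : W x = 0
        · rw [hWx, zero_mul]
        · have hx := hW x.1 x.2 hWx
          -- The norm of the product is the maximum norm, whose ball contains the Euclidean ball
          -- carrying `W`.
          have hn : ‖x‖ ≤ R := by
            rw [Prod.norm_def]
            have h1 : ‖x.1‖ ≤ √(‖x.1‖ ^ 2 + ‖x.2‖ ^ 2) :=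
              Real.le_sqrt_of_sq_le (le_add_of_nonneg_right (sq_nonneg _))
            have h2 : ‖x.2‖ ≤ √(‖x.1‖ ^ 2 + ‖x.2‖ ^ 2) :=
              Real.le_sqrt_of_sq_le (le_add_of_nonneg_left (sq_nonneg _))
            exact max_le (h1.trans hx) (h2.trans hx)
          have : g x = 1 := by
            refine f.one_of_mem_closedBall ?_
            rw [mem_closedBall_zero_iff, norm_smul, norm_inv, Real.norm_of_nonneg hR.le,
              inv_mul_le_iff₀ hR]
            simpa [f] using hn
          rw [this]; simp
      have h2 : (fun p => ((fderiv ℝ g x (pairUnitVec p) : ℝ) : ℂ))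
          = fun p => ((R⁻¹ : ℝ) : ℂ) * D p (R⁻¹ • x) := by
        ext p; rw [hfd, Complex.ofReal_mul]
      rw [h1, add_zero, h2, normSqM_smul, ← ENNReal.ofReal_mul (by positivity)]
      congr 1; ring
    simp_rw [hpt]
    have hmeas : Measurable fun y => ENNReal.ofReal (2 * normSqM (fun p => D p y)) :=
      hNc.measurable.ennreal_ofReal
    rw [lintegral_const_mul' _ _ ENNReal.ofReal_ne_top,
      ← lintegral_map hmeas (measurable_const_smul (R⁻¹)),
      Measure.map_addHaar_smul _ (inv_ne_zero hR.ne'), lintegral_smul_measure, smul_eq_mul,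
      ← mul_assoc, ← ENNReal.ofReal_mul (by positivity)]
    refine le_of_eq ?_
    congr 2
    have : Module.finrank ℝ (E3 × E3) = 6 := by simp
    rw [this, abs_of_pos (by positivity)]
    field_simp
  unfold threeBodyScatteringEnergy
  refine (ENNReal.toReal_mono (ENNReal.mul_ne_top ENNReal.ofReal_ne_top hIfin) hle).trans ?_
  rw [ENNReal.toReal_mul, ENNReal.toReal_ofReal (by positivity)]
  have : 0 < R ^ 4 := by positivity
  nlinarith

section

variable {n : ℕ}

/-! ### Resampling one particle -/

/-- Fubini in the position of one particle, written as an average over a redundant resampling, so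
that no factor has to be split off the product space. -/
theorem lintegral_box_update (i : Fin n) {F : Config n → ENNReal} (hF : Measurable F) :
    ∫⁻ x, F x ∂(boxMeasure n)
      = ∫⁻ a, ∫⁻ z, F (Function.update a i z) ∂cubeMeasure ∂(boxMeasure n) := by
  have hU : MeasurePreserving (fun z : Config n × Config n => Function.update z.1 i (z.2 i))
      ((boxMeasure n).prod (boxMeasure n)) (boxMeasure n) := measurePreserving_update cubeMeasure i
  have hFU : Measurable fun z : Config n × Config n => F (Function.update z.1 i (z.2 i)) :=
    hF.comp hU.measurable
  rw [← hU.lintegral_comp hF, lintegral_prod _ hFU.aemeasurable]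
  refine lintegral_congr fun a => ?_
  have hi : MeasurePreserving (Function.eval i) (boxMeasure n) cubeMeasure :=
    measurePreserving_eval (fun _ => cubeMeasure) i
  have hm : Measurable fun z : E3 => F (Function.update a i z) := hF.comp (measurable_update a)
  exact hi.lintegral_comp hm

/-- The distribution of the distance to an interior point of the cube. -/
theorem lintegral_cube_ball {r : ℝ} {y : E3} (hy : ∀ k, |y k| ≤ 1 / 2 - r) {h : ℝ → ENNReal}
    (hh : Measurable h) :
    ∫⁻ z, (Metric.ball 0 r).indicator (fun z => h ‖z‖) (z - y) ∂cubeMeasure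
      = ∫⁻ z in Metric.ball (0 : E3) r, h ‖z‖ := by
  have hm : Measurable fun z : E3 => (Metric.ball 0 r).indicator (fun z => h ‖z‖) (z - y) :=
    ((hh.comp measurable_norm).indicator measurableSet_ball).comp (measurable_id.sub_const y)
  rw [cubeMeasure, ← lintegral_indicator isOpen_cube.measurableSet,
    ← lintegral_indicator measurableSet_ball,
    ← lintegral_sub_right_eq_self (fun z : E3 => (Metric.ball 0 r).indicator (fun z => h ‖z‖) z) y]
  refine lintegral_congr fun z => ?_
  by_cases hz : z ∈ cube
  · rw [Set.indicator_of_mem hz]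
  · rw [Set.indicator_of_notMem hz, Set.indicator_of_notMem]
    -- The ball of radius `r` about `y` lies in the cube, so the restriction to the cube is
    -- invisible.
    intro hb
    refine hz fun k => ?_
    have h1 : |z k - y k| ≤ ‖z - y‖ := by simpa using PiLp.norm_apply_le (z - y) k
    have h2 : ‖z - y‖ < r := by simpa using hb
    have h3 := abs_sub_abs_le_abs_sub (z k) (y k)
    linarith [hy k]

theorem lintegral_ball_scale {r ℓ : ℝ} (hℓ : 0 < ℓ) {h : ℝ → ENNReal} (hh : Measurable h) :
    ∫⁻ z in Metric.ball (0 : E3) r, h (ℓ * ‖z‖)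
      = ENNReal.ofReal (ℓ ^ 3)⁻¹ * ∫⁻ z in Metric.ball (0 : E3) (r * ℓ), h ‖z‖ := by
  have hm : Measurable fun z : E3 => (Metric.ball (0 : E3) (r * ℓ)).indicator (fun z => h ‖z‖) z :=
    (hh.comp measurable_norm).indicator measurableSet_ball
  rw [← lintegral_indicator measurableSet_ball, ← lintegral_indicator measurableSet_ball]
  have h1 := lintegral_map (μ := (volume : Measure E3)) hm (measurable_const_smul ℓ)
  rw [Measure.map_addHaar_smul _ hℓ.ne', lintegral_smul_measure, smul_eq_mul] at h1
  have h2 : Module.finrank ℝ E3 = 3 := by simp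
  rw [h2, abs_of_pos (by positivity)] at h1
  rw [h1]
  refine lintegral_congr fun z => ?_
  have h3 : ‖ℓ • z‖ = ℓ * ‖z‖ := by rw [norm_smul, Real.norm_of_nonneg hℓ.le]
  by_cases hz : ‖z‖ < r
  · have hz' : ‖ℓ • z‖ < r * ℓ := by rw [h3, mul_comm]; gcongr
    rw [Set.indicator_of_mem (by simpa using hz), Set.indicator_of_mem (by simpa using hz'), h3]
  · have hz' : ¬ ‖ℓ • z‖ < r * ℓ := by
      rw [h3, mul_comm, not_lt]; rw [not_lt] at hz; gcongr
    rw [Set.indicator_of_notMem (by simpa using hz), Set.indicator_of_notMem (by simpa using hz')]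

/-! ### Cutoffs -/

/-- A smooth cutoff that does not depend on the particle `i` and keeps the other particles away
from the boundary. -/
structure IsCutoff (i : Fin n) (r : ℝ) (Θ : Config n → ℝ) : Prop where
  smooth : ContDiff ℝ ∞ Θ
  nonneg : ∀ x, 0 ≤ Θ x
  le_one : ∀ x, Θ x ≤ 1
  update : ∀ x z, Θ (Function.update x i z) = Θ x
  supp : ∀ x, Θ x ≠ 0 → ∀ k, k ≠ i → ∀ c, |x k c| ≤ 1 / 2 - r

variable {i j : Fin n} {r ℓ : ℝ} {Θ : Config n → ℝ}

/-- The cutoff measure near the coincidence of the particles `i` and `j`. -/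
def pairMeasure (i j : Fin n) (r : ℝ) (Θ : Config n → ℝ) : Measure (Config n) :=
  ((boxMeasure n).restrict {x | ‖x i - x j‖ < r}).withDensity fun x => ENNReal.ofReal (Θ x)

theorem measurableSet_near (i j : Fin n) (r : ℝ) : MeasurableSet {x : Config n | ‖x i - x j‖ < r} :=
  measurableSet_lt (by fun_prop) measurable_const

theorem IsCutoff.pairMeasure_le (h : IsCutoff i r Θ) : pairMeasure i j r Θ ≤ boxMeasure n := by
  refine (withDensity_mono (g := 1) (Filter.Eventually.of_forall fun x => ?_)).trans ?_
  · simpa using h.le_one x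
  · rw [withDensity_one]; exact Measure.restrict_le_self

theorem IsCutoff.integral_pairMeasure (h : IsCutoff i r Θ) {E : Type*} [NormedAddCommGroup E]
    [NormedSpace ℝ E] (f : Config n → E) :
    ∫ x, f x ∂(pairMeasure i j r Θ)
      = ∫ x in {x | ‖x i - x j‖ < r}, Θ x • f x ∂(boxMeasure n) := by
  rw [pairMeasure, integral_withDensity_eq_integral_toReal_smul
    (h.smooth.continuous.measurable.ennreal_ofReal) (Filter.Eventually.of_forall fun x => by simp)]
  simp only [ENNReal.toReal_ofReal (h.nonneg _)]

/-- With the other particles fixed, the cutoff is a constant and the ball about `x j` lies in the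
cube, so `x i - x j` is uniformly distributed in the ball of radius `r`. Scaling lengths by `ℓ`
gives the factor `ℓ⁻³`. -/
theorem IsCutoff.map_pairMeasure (h : IsCutoff i r Θ) (hij : i ≠ j) (hℓ : 0 < ℓ) :
    (pairMeasure i j r Θ).map (fun x => ℓ * ‖x i - x j‖)
      = ENNReal.ofReal ((∫ x, Θ x ∂(boxMeasure n)) * (ℓ ^ 3)⁻¹) •
        ((volume : Measure E3).restrict (Metric.ball 0 (r * ℓ))).map norm := by
  have hτ : Measurable fun x : Config n => ℓ * ‖x i - x j‖ := by fun_prop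
  have hΘm : Measurable fun x => ENNReal.ofReal (Θ x) :=
    h.smooth.continuous.measurable.ennreal_ofReal
  refine Measure.ext_of_lintegral _ fun f hf => ?_
  have hfτ : Measurable fun x : Config n => f (ℓ * ‖x i - x j‖) := hf.comp hτ
  rw [lintegral_map hf hτ, lintegral_smul_measure, lintegral_map hf measurable_norm, pairMeasure,
    lintegral_withDensity_eq_lintegral_mul _ hΘm hfτ,
    ← lintegral_indicator (measurableSet_near i j r),
    lintegral_box_update i ((hΘm.mul hfτ).indicator (measurableSet_near i j r))]
  have hΘi : Integrable Θ (boxMeasure n) :=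
    Integrable.of_bound h.smooth.continuous.aestronglyMeasurable 1
      (Filter.Eventually.of_forall fun x => by
        rw [Real.norm_of_nonneg (h.nonneg x)]; exact h.le_one x)
  have hin : ∀ a : Config n, ∫⁻ z, ({x : Config n | ‖x i - x j‖ < r}.indicator
      ((fun x => ENNReal.ofReal (Θ x)) * (fun x => f (ℓ * ‖x i - x j‖))) (Function.update a i z))
        ∂cubeMeasure
      = ENNReal.ofReal (Θ a) * (ENNReal.ofReal (ℓ ^ 3)⁻¹ *
        ∫⁻ z in Metric.ball (0 : E3) (r * ℓ), f ‖z‖) := by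
    intro a
    have e1 : ∀ z : E3, ({x : Config n | ‖x i - x j‖ < r}.indicator
        ((fun x => ENNReal.ofReal (Θ x)) * (fun x => f (ℓ * ‖x i - x j‖))) (Function.update a i z))
        = ENNReal.ofReal (Θ a) *
          (Metric.ball 0 r).indicator (fun z => f (ℓ * ‖z‖)) (z - a j) := by
      intro z
      by_cases hz : ‖z - a j‖ < r
      · rw [Set.indicator_of_mem (by simpa [hij.symm] using hz),
          Set.indicator_of_mem (by simpa using hz)]
        simp [h.update, hij.symm]
      · rw [Set.indicator_of_notMem (by simpa [hij.symm] using hz),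
          Set.indicator_of_notMem (by simpa using hz), mul_zero]
    simp_rw [e1]
    rw [lintegral_const_mul' _ _ ENNReal.ofReal_ne_top]
    by_cases h0 : Θ a = 0
    · simp [h0]
    · rw [lintegral_cube_ball (h := fun t => f (ℓ * t)) (h.supp a h0 j hij.symm) (by fun_prop),
        lintegral_ball_scale hℓ hf]
  simp_rw [hin]
  rw [lintegral_mul_const _ hΘm, ← ofReal_integral_eq_lintegral_ofReal hΘi
    (Filter.Eventually.of_forall h.nonneg), smul_eq_mul,
    ENNReal.ofReal_mul (integral_nonneg h.nonneg), mul_assoc]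

end

/-! ### Radial vector fields in the relative coordinate as test functions -/

section

variable {n : ℕ} {i j : Fin n} {r ℓ : ℝ} {Θ : Config n → ℝ}

theorem configUnitVec_apply_self (i : Fin n) (c : Fin 3) : configUnitVec (i, c) i = unitVec c := by
  simp [configUnitVec]

theorem configUnitVec_apply_of_ne (hij : i ≠ j) (c : Fin 3) : configUnitVec (i, c) j = 0 := by
  simp [configUnitVec, hij.symm]

theorem IsCutoff.fderiv_eq_zero (h : IsCutoff i r Θ) (x : Config n) (c : Fin 3) :
    fderiv ℝ Θ x (configUnitVec (i, c)) = 0 := by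
  have hd : DifferentiableAt ℝ Θ x := h.smooth.differentiable (by simp) x
  rw [← hd.lineDeriv_eq_fderiv]
  refine HasLineDerivAt.lineDeriv ?_
  unfold HasLineDerivAt
  have : (fun t : ℝ => Θ (x + t • configUnitVec (i, c))) = fun _ => Θ x := by
    ext t
    have e : x + t • configUnitVec (i, c) = Function.update x i (x i + t • unitVec c) := by
      ext k : 1
      by_cases hk : k = i
      · subst hk; simp [configUnitVec]
      · simp [configUnitVec, hk]
    rw [e, h.update]
  rw [this]
  exact hasDerivAt_const _ _

/-- The divergence of the radial vector field `ζ(ℓ‖z‖) z`. -/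
theorem fderiv_radialField {ζ : ℝ → ℝ} (hζ : ContDiff ℝ ∞ ζ) {δ : ℝ} (hδ : 0 < δ)
    (hζ0 : ∀ t, t < δ → ζ t = 0) (hℓ : 0 < ℓ) (z : E3) (c : Fin 3) :
    fderiv ℝ (fun z : E3 => ζ (ℓ * ‖z‖) * z c) z (unitVec c)
      = ζ (ℓ * ‖z‖) + deriv ζ (ℓ * ‖z‖) * (ℓ * (z c) ^ 2 / ‖z‖) := by
  have hB : ContDiff ℝ ∞ fun t => ζ (ℓ * t) := hζ.comp (contDiff_const.mul contDiff_id)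
  have hBn := contDiff_comp_norm hB (δ := δ / ℓ) (c := 0) (by positivity) (fun t ht => hζ0 _ (by
    rw [lt_div_iff₀ hℓ] at ht; linarith))
  have hc : DifferentiableAt ℝ (fun z : E3 => z c) z := by fun_prop
  have hcd : fderiv ℝ (fun z : E3 => z c) z (unitVec c) = 1 := by
    have : (fun z : E3 => z c) = (EuclideanSpace.proj c : E3 →L[ℝ] ℝ) := by ext; rfl
    rw [this, ContinuousLinearMap.fderiv]
    simp [unitVec]
  have hp := fderiv_fun_mul (hBn.differentiable (by simp) z) hc
  rw [hp]
  simp only [add_apply, smul_apply, hcd, smul_eq_mul, mul_one]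
  congr 1
  by_cases hz : z = 0
  · subst hz; simp
  · rw [fderiv_comp_norm (B := fun t => ζ (ℓ * t)) (hB.differentiable (by simp) _) hz, inner_unitVec]
    have hd : deriv (fun t => ζ (ℓ * t)) ‖z‖ = ℓ * deriv ζ (ℓ * ‖z‖) := by
      have := (hζ.differentiable (by simp) (ℓ * ‖z‖)).hasDerivAt.comp ‖z‖
        ((hasDerivAt_id ‖z‖).const_mul ℓ)
      simpa [Function.comp_def, mul_comm] using this.deriv
    rw [hd]; ring

theorem sum_sq_eq_norm_sq (z : E3) : ∑ c, (z c) ^ 2 = ‖z‖ ^ 2 := by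
  rw [EuclideanSpace.norm_sq_eq]; simp

/-- The radial vector fields, cut off by `Θ`, are test functions. -/
theorem IsCutoff.isTestFunction (h : IsCutoff i r Θ) (hij : i ≠ j) (hℓ : 0 < ℓ)
    {ζ : ℝ → ℝ} (hζ : ContDiff ℝ ∞ ζ) (hζs : tsupport ζ ⊆ Set.Ioo 0 (r * ℓ)) (c : Fin 3) :
    IsTestFunction (unitBox n) fun x => Θ x * (ζ (ℓ * ‖x i - x j‖) * (x i - x j) c) := by
  obtain ⟨δ, hδ, hζ0⟩ := exists_pos_forall_lt_eq_zero hζs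
  obtain ⟨t₁, ht₁, hsub⟩ := exists_lt_subset_ball (isClosed_tsupport ζ)
    (hζs.trans (fun t ht => by
      rw [mem_ball_zero_iff, Real.norm_of_nonneg ht.1.le]; exact ht.2))
  have hB : ContDiff ℝ ∞ fun t => ζ (ℓ * t) := hζ.comp (contDiff_const.mul contDiff_id)
  have hBn := contDiff_comp_norm hB (δ := δ / ℓ) (c := 0) (by positivity) (fun t ht => hζ0 _ (by
    rw [lt_div_iff₀ hℓ] at ht; linarith))
  have hz : ContDiff ℝ ∞ fun x : Config n => x i - x j :=
    (contDiff_apply ℝ E3 i).sub (contDiff_apply ℝ E3 j)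
  have hsm : ContDiff ℝ ∞ fun x : Config n => Θ x * (ζ (ℓ * ‖x i - x j‖) * (x i - x j) c) := by
    refine h.smooth.mul ((hBn.comp hz).mul ?_)
    exact (EuclideanSpace.proj c : E3 →L[ℝ] ℝ).contDiff.comp hz
  -- A closed set between the support and the open box. It stays inside the box because the relative
  -- distance is at most `t₁/ℓ`, strictly less than `r`.
  set S : Set (Config n) := {x | (∀ k, k ≠ i → ∀ c, |x k c| ≤ 1 / 2 - r) ∧ ℓ * ‖x i - x j‖ ≤ t₁}
    with hS
  have hSc : IsClosed S := by
    have e1 : S = (⋂ k, ⋂ (_ : k ≠ i), ⋂ c, {x : Config n | |x k c| ≤ 1 / 2 - r}) ∩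
      {x : Config n | ℓ * ‖x i - x j‖ ≤ t₁} := by ext; simp [hS]
    rw [e1]
    refine IsClosed.inter ?_ (isClosed_le (by fun_prop) continuous_const)
    exact isClosed_iInter fun k => isClosed_iInter fun _ => isClosed_iInter fun c =>
      isClosed_le (by fun_prop) continuous_const
  have hsupp : tsupport (fun x : Config n => Θ x * (ζ (ℓ * ‖x i - x j‖) * (x i - x j) c)) ⊆ S := by
    refine closure_minimal (fun x hx => ?_) hSc
    have h1 : Θ x ≠ 0 := fun h0 => hx (by simp [h0])
    have h2 : ζ (ℓ * ‖x i - x j‖) ≠ 0 := fun h0 => hx (by simp [h0])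
    refine ⟨h.supp x h1, ?_⟩
    have := hsub (subset_tsupport _ h2)
    rw [mem_ball_zero_iff, Real.norm_of_nonneg (by positivity)] at this
    exact this.le
  have hSbox : S ⊆ unitBox n := by
    rintro x ⟨hx1, hx2⟩
    have hd : ‖x i - x j‖ < r := by
      by_contra hle
      rw [not_lt] at hle
      have : r * ℓ ≤ ℓ * ‖x i - x j‖ := by rw [mul_comm]; gcongr
      linarith
    have hr : 0 < r := (norm_nonneg _).trans_lt hd
    intro k c
    by_cases hk : k = i
    · subst hk
      have h1 : |x k c - x j c| ≤ ‖x k - x j‖ := by simpa using PiLp.norm_apply_le (x k - x j) c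
      have h3 := abs_sub_abs_le_abs_sub (x k c) (x j c)
      linarith [hx1 j hij.symm c]
    · linarith [hx1 k hk c]
  have hbdd : Bornology.IsBounded (unitBox n) := by
    have : unitBox n ⊆ coordEquiv n '' Metric.ball 0 (1 / 2) := by
      intro x hx
      refine ⟨(coordEquiv n).symm x, ?_, by simp⟩
      rw [← coordEquiv_mem_unitBox]; simpa using hx
    exact ((coordEquiv n).lipschitz.isBounded_image Metric.isBounded_ball).subset this
  refine ⟨hsm, ?_, hsupp.trans hSbox⟩
  exact (Metric.isCompact_of_isClosed_isBounded hSc (hbdd.subset hSbox)).of_isClosed_subset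
    (isClosed_tsupport _) hsupp

/-- The component of the gradient in the relative direction of two particles. -/
def radialGrad (i j : Fin n) (G : Fin n × Fin 3 → Config n → ℂ) (x : Config n) : ℂ :=
  ∑ c, (((x i - x j) c / ‖x i - x j‖ : ℝ) : ℂ) * G (i, c) x

theorem norm_radialGrad_sq_le (G : Fin n × Fin 3 → Config n → ℂ) (x : Config n) :
    ‖radialGrad i j G x‖ ^ 2 ≤ ∑ c, ‖G (i, c) x‖ ^ 2 := by
  set z := x i - x j with hz
  have h1 : ‖radialGrad i j G x‖ ≤ ∑ c, |z c / ‖z‖| * ‖G (i, c) x‖ := by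
    refine (norm_sum_le _ _).trans (Finset.sum_le_sum fun c _ => ?_)
    rw [norm_mul, Complex.norm_real, Real.norm_eq_abs]
  have h2 := Finset.sum_mul_sq_le_sq_mul_sq Finset.univ (fun c => |z c / ‖z‖|) fun c => ‖G (i, c) x‖
  have h3 : ∑ c, |z c / ‖z‖| ^ 2 ≤ 1 := by
    simp only [sq_abs, div_pow]
    rw [← Finset.sum_div, sum_sq_eq_norm_sq]
    exact div_self_le_one _
  calc ‖radialGrad i j G x‖ ^ 2 ≤ (∑ c, |z c / ‖z‖| * ‖G (i, c) x‖) ^ 2 := by gcongr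
    _ ≤ _ := h2
    _ ≤ 1 * ∑ c, ‖G (i, c) x‖ ^ 2 := by gcongr
    _ = _ := one_mul _

theorem memLp_radialGrad {μ : Measure (Config n)} {G : Fin n × Fin 3 → Config n → ℂ}
    (hG : ∀ p, MemLp (G p) 2 μ) : MemLp (radialGrad i j G) 2 μ := by
  unfold radialGrad
  refine memLp_finsetSum _ fun c _ => ?_
  have hm : Measurable fun x : Config n => (((x i - x j) c / ‖x i - x j‖ : ℝ) : ℂ) := by fun_prop
  refine (hG (i, c)).mono (hm.aestronglyMeasurable.mul (hG (i, c)).1)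
    (Filter.Eventually.of_forall fun x => ?_)
  rw [norm_mul, Complex.norm_real, Real.norm_eq_abs]
  refine mul_le_of_le_one_left (norm_nonneg _) ?_
  rw [abs_div, abs_norm]
  exact div_le_one_of_le₀ (by simpa using PiLp.norm_apply_le (x i - x j) c) (norm_nonneg _)

/-- Integration by parts in `x i` against the field `Θ ζ(ℓ‖z‖) z`, `z = x i - x j`. The cutoff does
not depend on `x i`, so it is not differentiated, and the divergence is `Θ (3ζ + τζ')` with `τ =
ℓ‖z‖`. The factor `ℓ⁻¹` on the right converts the derivative in `‖z‖` into that in `τ`. -/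
theorem IsCutoff.weak_radial_identity (h : IsCutoff i r Θ) (hij : i ≠ j) (hℓ : 0 < ℓ)
    {ψ : Config n → ℂ} {G : Fin n × Fin 3 → Config n → ℂ}
    (hψ : MemLp ψ 2 (boxMeasure n)) (hG : ∀ p, MemLp (G p) 2 (boxMeasure n))
    (hweak : ∀ p, HasWeakDirDeriv (unitBox n) ψ (configUnitVec p) (G p))
    {ζ : ℝ → ℝ} (hζ : ContDiff ℝ ∞ ζ) (hζs : tsupport ζ ⊆ Set.Ioo 0 (r * ℓ)) :
    ∫ x, ((3 * ζ (ℓ * ‖x i - x j‖) + ℓ * ‖x i - x j‖ * deriv ζ (ℓ * ‖x i - x j‖) : ℝ) : ℂ) * ψ x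
        ∂(pairMeasure i j r Θ)
      = -∫ x, ((ζ (ℓ * ‖x i - x j‖) * (ℓ * ‖x i - x j‖) : ℝ) : ℂ) *
          (((ℓ⁻¹ : ℝ) : ℂ) * radialGrad i j G x) ∂(pairMeasure i j r Θ) := by
  obtain ⟨δ, hδ, hζ0⟩ := exists_pos_forall_lt_eq_zero hζs
  have hout : ∀ x : Config n, x ∉ {x : Config n | ‖x i - x j‖ < r} →
      ζ (ℓ * ‖x i - x j‖) = 0 ∧ deriv ζ (ℓ * ‖x i - x j‖) = 0 := by
    intro x hx
    have hx' : r * ℓ ≤ ℓ * ‖x i - x j‖ := by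
      rw [mul_comm]
      have : r ≤ ‖x i - x j‖ := not_lt.1 hx
      gcongr
    have hnot : ℓ * ‖x i - x j‖ ∉ tsupport ζ := fun hm => absurd (hζs hm).2 (not_lt.2 hx')
    refine ⟨image_eq_zero_of_notMem_tsupport hnot, ?_⟩
    by_contra hne
    exact hnot (support_deriv_subset hne)
  set Ξ : Fin 3 → Config n → ℝ := fun c x => Θ x * (ζ (ℓ * ‖x i - x j‖) * (x i - x j) c) with hΞ
  have ht : ∀ c, IsTestFunction (unitBox n) (Ξ c) := fun c => h.isTestFunction hij hℓ hζ hζs c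
  have hfd : ∀ c x, fderiv ℝ (Ξ c) x (configUnitVec (i, c))
      = Θ x * (ζ (ℓ * ‖x i - x j‖) +
        deriv ζ (ℓ * ‖x i - x j‖) * (ℓ * ((x i - x j) c) ^ 2 / ‖x i - x j‖)) := by
    intro c x
    have hB : ContDiff ℝ ∞ fun t => ζ (ℓ * t) := hζ.comp (contDiff_const.mul contDiff_id)
    have hBn := contDiff_comp_norm hB (δ := δ / ℓ) (c := 0) (by positivity) (fun t ht => hζ0 _ (by
      rw [lt_div_iff₀ hℓ] at ht; linarith))
    have hη : Differentiable ℝ fun z : E3 => ζ (ℓ * ‖z‖) * z c :=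
      (hBn.differentiable (by simp)).mul (by fun_prop)
    let P : Config n →L[ℝ] E3 := ContinuousLinearMap.proj (R := ℝ) (φ := fun _ : Fin n => E3) i -
      ContinuousLinearMap.proj (R := ℝ) (φ := fun _ : Fin n => E3) j
    have hcomp : HasFDerivAt (fun x : Config n => ζ (ℓ * ‖x i - x j‖) * (x i - x j) c)
        ((fderiv ℝ (fun z : E3 => ζ (ℓ * ‖z‖) * z c) (x i - x j)).comp P) x :=
      HasFDerivAt.comp x (g := fun z : E3 => ζ (ℓ * ‖z‖) * z c) (f := P)
        (hη (x i - x j)).hasFDerivAt P.hasFDerivAt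
    have hmul := ((h.smooth.differentiable (by simp) x).hasFDerivAt.mul hcomp).fderiv
    have hPc : P (configUnitVec (i, c)) = unitVec c := by
      simp [P, configUnitVec_apply_self, configUnitVec_apply_of_ne hij]
    change fderiv ℝ (Θ * fun x : Config n => ζ (ℓ * ‖x i - x j‖) * (x i - x j) c) x _ = _
    rw [hmul]
    simp only [add_apply, smul_apply, smul_eq_mul,
      h.fderiv_eq_zero, mul_zero, add_zero, ContinuousLinearMap.comp_apply, hPc,
      fderiv_radialField hζ hδ hζ0 hℓ]
  have hψi : Integrable ψ (boxMeasure n) := hψ.integrable (by norm_num)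
  have hGi : ∀ p, Integrable (G p) (boxMeasure n) := fun p => (hG p).integrable (by norm_num)
  have hI1 : ∀ c, Integrable (fun x => (fderiv ℝ (Ξ c) x (configUnitVec (i, c))) • ψ x)
      (boxMeasure n) := by
    intro c
    have hc1 : Continuous fun x => fderiv ℝ (Ξ c) x (configUnitVec (i, c)) :=
      ((ht c).smooth.continuous_fderiv (by simp)).clm_apply continuous_const
    obtain ⟨C, hC⟩ := ((ht c).compact.fderiv_apply (𝕜 := ℝ)
      (configUnitVec (i, c))).exists_bound_of_continuous hc1
    exact hψi.bdd_smul C hc1.aestronglyMeasurable (Filter.Eventually.of_forall hC)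
  have hI2 : ∀ c, Integrable (fun x => Ξ c x • G (i, c) x) (boxMeasure n) := by
    intro c
    obtain ⟨C, hC⟩ := (ht c).compact.exists_bound_of_continuous (ht c).smooth.continuous
    exact (hGi (i, c)).bdd_smul C (ht c).smooth.continuous.aestronglyMeasurable
      (Filter.Eventually.of_forall hC)
  have key : ∫ x, ∑ c, (fderiv ℝ (Ξ c) x (configUnitVec (i, c))) • ψ x ∂(boxMeasure n)
      = -∫ x, ∑ c, Ξ c x • G (i, c) x ∂(boxMeasure n) := by
    rw [integral_finsetSum _ fun c _ => hI1 c, integral_finsetSum _ fun c _ => hI2 c,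
      ← Finset.sum_neg_distrib]
    refine Finset.sum_congr rfl fun c _ => ?_
    have := hweak (i, c) (Ξ c) (ht c)
    rwa [← boxMeasure_eq] at this
  rw [h.integral_pairMeasure, h.integral_pairMeasure,
    setIntegral_eq_integral_of_forall_compl_eq_zero (fun x hx => by
      simp [(hout x hx).1, (hout x hx).2]),
    setIntegral_eq_integral_of_forall_compl_eq_zero (fun x hx => by simp [(hout x hx).1])]
  convert key using 1
  · congr 1 with x
    rw [← Finset.sum_smul]
    have : ∑ c, fderiv ℝ (Ξ c) x (configUnitVec (i, c)) = Θ x * (3 * ζ (ℓ * ‖x i - x j‖)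
        + ℓ * ‖x i - x j‖ * deriv ζ (ℓ * ‖x i - x j‖)) := by
      simp only [hfd]
      rw [← Finset.mul_sum, Finset.sum_add_distrib, ← Finset.mul_sum, ← Finset.sum_div,
        ← Finset.mul_sum, sum_sq_eq_norm_sq]
      by_cases hz : ‖x i - x j‖ = 0
      · simp [hz]
      · simp; left; field_simp
    rw [this, Complex.real_smul, Complex.real_smul]
    push_cast; ring
  · congr 2 with x
    simp only [radialGrad, Finset.mul_sum, Finset.smul_sum]
    refine Finset.sum_congr rfl fun c _ => ?_
    simp only [hΞ, Complex.real_smul]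
    by_cases hz : ‖x i - x j‖ = 0
    · have : x i - x j = 0 := norm_eq_zero.1 hz
      rw [this]; simp
    · have hz' : ((‖x i - x j‖ : ℝ) : ℂ) ≠ 0 := by exact_mod_cast hz
      have hℓ' : (ℓ : ℂ) ≠ 0 := by exact_mod_cast hℓ.ne'
      push_cast
      field_simp

end

/-! ### The energy of one pair -/

section

variable {n : ℕ} {i j : Fin n} {r ℓ : ℝ} {Θ : Config n → ℝ}

theorem norm_integral_mul_sq_le {X : Type*} [MeasurableSpace X] {μ : Measure X} {f : X → ℝ}
    {g : X → ℂ} (hf : MemLp f 2 μ) (hg : MemLp g 2 μ) :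
    ‖∫ x, (f x : ℂ) * g x ∂μ‖ ^ 2 ≤ (∫ x, f x ^ 2 ∂μ) * ∫ x, ‖g x‖ ^ 2 ∂μ := by
  have h1 : ‖∫ x, (f x : ℂ) * g x ∂μ‖ ≤ ∫ x, ‖f x‖ * ‖g x‖ ∂μ := by
    refine (norm_integral_le_integral_norm _).trans (le_of_eq ?_)
    simp
  have h2 := integral_mul_le_Lp_mul_Lq_of_nonneg (μ := μ) (p := 2) (q := 2)
    (Real.HolderConjugate.two_two) (f := fun x => ‖f x‖) (g := fun x => ‖g x‖)
    (Filter.Eventually.of_forall fun x => norm_nonneg _)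
    (Filter.Eventually.of_forall fun x => norm_nonneg _) (by simpa using hf.norm)
    (by simpa using hg.norm)
  have e1 : ∫ x, ‖f x‖ ^ (2 : ℝ) ∂μ = ∫ x, f x ^ 2 ∂μ := by simp
  have e2 : ∫ x, ‖g x‖ ^ (2 : ℝ) ∂μ = ∫ x, ‖g x‖ ^ 2 ∂μ := by simp
  rw [e1, e2, ← Real.sqrt_eq_rpow, ← Real.sqrt_eq_rpow] at h2
  calc ‖∫ x, (f x : ℂ) * g x ∂μ‖ ^ 2
      ≤ (√(∫ x, f x ^ 2 ∂μ) * √(∫ x, ‖g x‖ ^ 2 ∂μ)) ^ 2 := by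
        have := h1.trans h2
        gcongr
    _ = _ := by
        rw [mul_pow, Real.sq_sqrt (integral_nonneg fun x => sq_nonneg _),
          Real.sq_sqrt (integral_nonneg fun x => by positivity)]

theorem exists_annulus_density {L : ℝ} (hL : 0 < L) : ∃ w : ℝ → ℝ, ContDiff ℝ ∞ w ∧
    (∀ t, 0 ≤ w t) ∧ (∀ t, t ∉ Set.Icc (5 * L / 8) (7 * L / 8) → w t = 0) ∧ (∫ t, w t = 1) ∧
    ∀ t, w t ≤ 8 / L := by
  -- The bump equals one on an interval of length `L/8`, which bounds its normalized version by
  -- `8/L`.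
  let f : ContDiffBump (3 * L / 4) := ⟨L / 16, L / 8, by positivity, by linarith⟩
  refine ⟨f.normed volume, f.contDiff_normed, f.nonneg_normed, fun t ht => ?_,
    f.integral_normed, fun t => ?_⟩
  · have : t ∉ Function.support (f.normed volume) := by
      rw [f.support_normed_eq, Real.ball_eq_Ioo]
      intro hm
      refine ht ⟨?_, ?_⟩
      · have := hm.1; simp only [f] at this; linarith
      · have := hm.2; simp only [f] at this; linarith
    simpa using this
  · refine (f.normed_le_div_measure_closedBall_rIn volume t).trans (le_of_eq ?_)
    rw [measureReal_def, Real.volume_closedBall, ENNReal.toReal_ofReal (by simp [f]; positivity)]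
    simp only [f]
    field_simp
    norm_num

/-- A bound on the energy of a pair of particles in terms of the mean of the wave function. -/
theorem IsCutoff.pair_energy (h : IsCutoff i r Θ) (hij : i ≠ j) (hr : 0 < r) (hℓ : 0 < ℓ)
    {V : E3 → ℝ} (hV0 : ∀ x, 0 ≤ V x) (hVi : Integrable V)
    (hVr : ∀ x y : E3, ‖x‖ = ‖y‖ → V x = V y) {R₀ : ℝ} (hR : R₀ < r * ℓ / 2)
    (hVs : ∀ x, V x ≠ 0 → ‖x‖ ≤ R₀)
    {ψ : Config n → ℂ} {G : Fin n × Fin 3 → Config n → ℂ}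
    (hψ : MemLp ψ 2 (boxMeasure n)) (hG : ∀ p, MemLp (G p) 2 (boxMeasure n))
    (hweak : ∀ p, HasWeakDirDeriv (unitBox n) ψ (configUnitVec p) (G p))
    (hint : Integrable (fun x => V (ℓ • (x i - x j)) * ‖ψ x‖ ^ 2) (boxMeasure n))
    (hθ : 0 < ∫ x, Θ x ∂(boxMeasure n)) (c : ℂ) :
    ∃ m : ℂ, ‖m - c‖ ^ 2 * ((∫ x, Θ x ∂(boxMeasure n)) * r ^ 3)
        ≤ 2 * ∫ x, ‖ψ x - c‖ ^ 2 ∂(boxMeasure n) ∧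
      4 * Real.pi * scatteringLength V / ℓ * ((∫ x, Θ x ∂(boxMeasure n)) * ‖m‖ ^ 2)
        ≤ ∫ x in {x | ‖x i - x j‖ < r}, Θ x * (∑ c, ‖G (i, c) x‖ ^ 2 +
          1 / 2 * (ℓ ^ 2 * V (ℓ • (x i - x j)) * ‖ψ x‖ ^ 2)) ∂(boxMeasure n) := by
  set θ := ∫ x, Θ x ∂(boxMeasure n) with hθd
  set M := pairMeasure i j r Θ with hM
  set L := r * ℓ with hLd
  have hL : 0 < L := by positivity
  have hMle : M ≤ boxMeasure n := h.pairMeasure_le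
  have hfin : IsFiniteMeasure M := isFiniteMeasure_of_le _ hMle
  obtain ⟨w, hw, hw0, hws, hw1, hwb⟩ := exists_annulus_density hL
  set τ : Config n → ℝ := fun x => ℓ * ‖x i - x j‖ with hτd
  have hτ : Measurable τ := by fun_prop
  set θ' := θ * (ℓ ^ 3)⁻¹ with hθ'd
  have hθ' : 0 < θ' := by positivity
  have hmap : M.map τ = ENNReal.ofReal θ' •
    ((volume : Measure E3).restrict (Metric.ball 0 L)).map norm := h.map_pairMeasure hij hℓ
  have hVτ : ∀ x, V (τ x • unitVec 0) = V (ℓ • (x i - x j)) := fun x => hVr _ _ (by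
    rw [norm_smul, norm_smul, hτd]
    simp [unitVec])
  have hQ : MemLp (fun x => ((ℓ⁻¹ : ℝ) : ℂ) * radialGrad i j G x) 2 M :=
    ((memLp_radialGrad hG).const_mul _).mono_measure hMle
  have hψM : MemLp ψ 2 M := hψ.mono_measure hMle
  have hGM : ∀ p, MemLp (G p) 2 M := fun p => (hG p).mono_measure hMle
  have hintM : Integrable (fun x => V (ℓ • (x i - x j)) * ‖ψ x‖ ^ 2) M := hint.mono_measure hMle
  have hne : Nonempty (Config n) := ⟨0⟩
  have key := scatteringLength_mul_le hV0 hVi hVr hL hR hVs hw hw0 hws hw1 M hτ hθ' hmap hψM hQ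
    (by simpa only [hVτ] using hintM)
    (fun ζ hζ _ hζs => h.weak_radial_identity hij hℓ hψ hG hweak hζ hζs)
  simp only [hVτ] at key
  set u : ℝ → ℝ := fun t => w t / (4 * Real.pi * t ^ 2) with hu
  have hum : Measurable u := hw.continuous.measurable.div (by fun_prop)
  have hpi := Real.pi_pos
  have hu0 : ∀ t, 0 ≤ u t := fun t => div_nonneg (hw0 t) (by positivity)
  -- On the annulus `t ≥ 5L/8`, hence `u ≤ (8/L) / (4π(5L/8)²)`, which is about `1.63/L³`.
  have hub : ∀ t, u t ≤ 2 * (L ^ 3)⁻¹ := by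
    intro t
    by_cases ht : t ∈ Set.Icc (5 * L / 8) (7 * L / 8)
    · have h5 : 5 * L / 8 ≤ t := ht.1
      have ht2 : (5 * L / 8) ^ 2 ≤ t ^ 2 := by gcongr
      have htp : 0 < t := by linarith
      rw [hu]
      simp only
      rw [div_le_iff₀ (by positivity)]
      calc w t ≤ 8 / L := hwb t
        _ ≤ 2 * (L ^ 3)⁻¹ * (4 * 3.14 * (5 * L / 8) ^ 2) := by
          rw [div_eq_mul_inv]
          have : 2 * (L ^ 3)⁻¹ * (4 * 3.14 * (5 * L / 8) ^ 2) = 9.8125 * L⁻¹ := by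
            field_simp; norm_num
          rw [this]
          have : 0 < L⁻¹ := by positivity
          linarith
        _ ≤ _ := by gcongr; exact Real.pi_gt_d2.le
    · rw [hu]; simp only; rw [hws t ht, zero_div]; positivity
  have huτ : MemLp (fun x => u (τ x)) 2 M := MemLp.of_bound (hum.comp hτ).aestronglyMeasurable
    (2 * (L ^ 3)⁻¹) (Filter.Eventually.of_forall fun x => by
      rw [Real.norm_of_nonneg (hu0 _)]; exact hub _)
  have hmom : ∫ x, u (τ x) ∂M = θ' := by
    rw [← integral_map (f := u) hτ.aemeasurable hum.aestronglyMeasurable, hmap,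
      integral_smul_measure, integral_map measurable_norm.aemeasurable hum.aestronglyMeasurable,
      setIntegral_ball_comp_norm, ENNReal.toReal_ofReal hθ'.le]
    have e : ∫ t in Set.Ioo 0 L, t ^ 2 • u t = (4 * Real.pi)⁻¹ := by
      have e1 : ∫ t in Set.Ioo 0 L, t ^ 2 • u t = ∫ t in Set.Ioo 0 L, (4 * Real.pi)⁻¹ * w t := by
        refine setIntegral_congr_fun measurableSet_Ioo fun t ht => ?_
        have : t ≠ 0 := ht.1.ne'
        simp only [hu, smul_eq_mul]
        field_simp
      rw [e1, integral_const_mul, setIntegral_eq_integral_of_forall_compl_eq_zero, hw1, mul_one]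
      intro t ht
      refine hws t fun hm => ht ⟨?_, ?_⟩
      · linarith [hm.1]
      · linarith [hm.2]
    rw [e]
    simp only [smul_eq_mul]
    field_simp
  have hsq : ∫ x, u (τ x) ^ 2 ∂M ≤ 2 * (L ^ 3)⁻¹ * θ' := by
    rw [← hmom, ← integral_const_mul]
    refine integral_mono huτ.integrable_sq ((huτ.integrable (by norm_num)).const_mul _) fun x => ?_
    simp only [sq]
    exact mul_le_mul_of_nonneg_right (hub _) (hu0 _)
  set I := ∫ x, ((u (τ x) : ℝ) : ℂ) * ψ x ∂M with hI
  -- Since `u ∘ τ` has total mass `θ'`, this is a weighted mean of `ψ` over the annulus. Its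
  -- distance to `c` is bounded by Cauchy–Schwarz with the second moment `hsq`.
  refine ⟨((θ'⁻¹ : ℝ) : ℂ) * I, ?_, ?_⟩
  · have hψc : MemLp (fun x => ψ x - c) 2 M := hψM.sub (memLp_const c)
    have hcs := norm_integral_mul_sq_le huτ hψc
    have huτc : MemLp (fun x => ((u (τ x) : ℝ) : ℂ)) 2 M := huτ.ofReal
    have hI2 : ∫ x, ((u (τ x) : ℝ) : ℂ) * (ψ x - c) ∂M = I - (θ' : ℂ) * c := by
      have hi1 : Integrable (fun x => ((u (τ x) : ℝ) : ℂ) * ψ x) M := huτc.integrable_mul hψM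
      simp only [mul_sub]
      rw [integral_sub hi1 ((huτc.integrable (by norm_num)).mul_const c),
        integral_mul_const, integral_complex_ofReal, hmom]
    rw [hI2] at hcs
    have hDle : ∫ x, ‖ψ x - c‖ ^ 2 ∂M ≤ ∫ x, ‖ψ x - c‖ ^ 2 ∂(boxMeasure n) :=
      integral_mono_measure hMle (Filter.Eventually.of_forall fun x => by positivity)
        ((hψ.sub (memLp_const c)).norm.integrable_sq)
    have hD0 : 0 ≤ ∫ x, ‖ψ x - c‖ ^ 2 ∂M := integral_nonneg fun x => by positivity
    have e : ((θ'⁻¹ : ℝ) : ℂ) * I - c = ((θ'⁻¹ : ℝ) : ℂ) * (I - (θ' : ℂ) * c) := by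
      have : (θ' : ℂ) ≠ 0 := by exact_mod_cast hθ'.ne'
      push_cast; field_simp
    rw [e, norm_mul, mul_pow, Complex.norm_real, Real.norm_of_nonneg (by positivity)]
    have e2 : θ * r ^ 3 = θ' * L ^ 3 := by rw [hθ'd, hLd]; field_simp
    rw [e2]
    calc θ'⁻¹ ^ 2 * ‖I - (θ' : ℂ) * c‖ ^ 2 * (θ' * L ^ 3)
        ≤ θ'⁻¹ ^ 2 * ((2 * (L ^ 3)⁻¹ * θ') * ∫ x, ‖ψ x - c‖ ^ 2 ∂(boxMeasure n)) * (θ' * L ^ 3) := by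
          gcongr
          exact hcs.trans (mul_le_mul hsq hDle hD0 (by positivity))
      _ = _ := by field_simp
  · have e1 : 4 * Real.pi * scatteringLength V / ℓ * (θ * ‖((θ'⁻¹ : ℝ) : ℂ) * I‖ ^ 2)
        = ℓ ^ 2 / 2 * (8 * Real.pi * scatteringLength V * (‖I‖ ^ 2 / θ')) := by
      rw [norm_mul, mul_pow, Complex.norm_real, Real.norm_of_nonneg (by positivity)]
      rw [hθ'd]; field_simp; ring
    rw [e1]
    calc ℓ ^ 2 / 2 * (8 * Real.pi * scatteringLength V * (‖I‖ ^ 2 / θ'))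
        ≤ ℓ ^ 2 / 2 * ∫ x, (2 * ‖((ℓ⁻¹ : ℝ) : ℂ) * radialGrad i j G x‖ ^ 2
          + V (ℓ • (x i - x j)) * ‖ψ x‖ ^ 2) ∂M := by gcongr
      _ = ∫ x, ℓ ^ 2 / 2 * (2 * ‖((ℓ⁻¹ : ℝ) : ℂ) * radialGrad i j G x‖ ^ 2
          + V (ℓ • (x i - x j)) * ‖ψ x‖ ^ 2) ∂M := (integral_const_mul _ _).symm
      _ ≤ ∫ x, (∑ c, ‖G (i, c) x‖ ^ 2 + 1 / 2 * (ℓ ^ 2 * V (ℓ • (x i - x j)) * ‖ψ x‖ ^ 2)) ∂M := by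
        refine integral_mono ?_ ?_ fun x => ?_
        · exact ((hQ.norm.integrable_sq.const_mul 2).add hintM).const_mul _
        · refine (integrable_finsetSum _ fun c _ => (hGM (i, c)).norm.integrable_sq).add ?_
          refine (hintM.const_mul (1 / 2 * ℓ ^ 2)).congr (Filter.Eventually.of_forall fun x => ?_)
          simp only; ring
        · simp only
          have := norm_radialGrad_sq_le (i := i) (j := j) G x
          rw [norm_mul, mul_pow, Complex.norm_real, Real.norm_of_nonneg (by positivity)]
          have e : ℓ ^ 2 / 2 * (2 * (ℓ⁻¹ ^ 2 * ‖radialGrad i j G x‖ ^ 2)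
            + V (ℓ • (x i - x j)) * ‖ψ x‖ ^ 2) = ‖radialGrad i j G x‖ ^ 2 +
              1 / 2 * (ℓ ^ 2 * V (ℓ • (x i - x j)) * ‖ψ x‖ ^ 2) := by field_simp
          rw [e]; gcongr
      _ = _ := by rw [h.integral_pairMeasure]; rfl

end

/-! ### Construction and mass of the cutoffs -/

section

variable {n : ℕ}

/-- A union bound for smooth cutoffs: the mass lost by a product is at most the sum of the losses of
its factors. -/
theorem one_sub_prod_le_sum {ι : Type*} (s : Finset ι) {u : ι → ℝ} (h0 : ∀ a, 0 ≤ u a)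
    (h1 : ∀ a, u a ≤ 1) : 1 - ∏ a ∈ s, u a ≤ ∑ a ∈ s, (1 - u a) := by
  classical
  induction s using Finset.induction_on with
  | empty => simp
  | insert a s ha ih =>
    rw [Finset.prod_insert ha, Finset.sum_insert ha]
    have hp0 : 0 ≤ ∏ a ∈ s, u a := Finset.prod_nonneg fun a _ => h0 a
    have hp1 : ∏ a ∈ s, u a ≤ 1 := Finset.prod_le_one (fun a _ => h0 a) fun a _ => h1 a
    nlinarith [h0 a, h1 a]

theorem integral_box_coord {f : ℝ → ℝ} (hf : Continuous f) (hs : ∀ t, 1 / 2 ≤ |t| → f t = 0)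
    (j : Fin n) (c : Fin 3) : ∫ x, f (x j c) ∂(boxMeasure n) = ∫ t, f t := by
  rw [← measurePreserving_coordEquiv.integral_comp
    (coordEquiv n).toHomeomorph.measurableEmbedding fun x : Config n => f (x j c)]
  exact integral_unitCube_eval (p := (j, c)) hf.measurable hs

theorem integral_box_sub_le {f : E3 → ℝ} (hf : Continuous f) (hf0 : ∀ z, 0 ≤ f z)
    (hfi : Integrable f) {j k : Fin n} (hjk : j ≠ k) :
    ∫ x, f (x j - x k) ∂(boxMeasure n) ≤ ∫ z, f z := by
  have hm : Measurable fun x : Config n => ENNReal.ofReal (f (x j - x k)) :=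
    (hf.measurable.comp ((measurable_pi_apply j).sub (measurable_pi_apply k))).ennreal_ofReal
  rw [integral_eq_lintegral_of_nonneg_ae (Filter.Eventually.of_forall fun x => hf0 _)
    (hf.comp ((continuous_apply j).sub (continuous_apply k))).aestronglyMeasurable,
    integral_eq_lintegral_of_nonneg_ae (Filter.Eventually.of_forall hf0) hf.aestronglyMeasurable]
  refine ENNReal.toReal_mono hfi.lintegral_lt_top.ne ?_
  rw [lintegral_box_update j hm]
  have hin : ∀ a : Config n, ∫⁻ z, ENNReal.ofReal (f (Function.update a j z j -
      Function.update a j z k)) ∂cubeMeasure ≤ ∫⁻ z, ENNReal.ofReal (f z) := by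
    intro a
    simp only [Function.update_self, Function.update_of_ne hjk.symm]
    refine (lintegral_mono' Measure.restrict_le_self le_rfl).trans (le_of_eq ?_)
    exact lintegral_sub_right_eq_self (fun z : E3 => ENNReal.ofReal (f z)) (a k)
  refine (lintegral_mono hin).trans ?_
  simp

/-- There are cutoffs of almost full mass that keep the particles other than `i` separated. -/
theorem exists_cutoff (i : Fin n) {r : ℝ} (hr : 0 < r) (hr' : r < 1 / 4) :
    ∃ Θ : Config n → ℝ, IsCutoff i r Θ ∧
      (∀ x, Θ x ≠ 0 → ∀ j k, j ≠ i → k ≠ i → j ≠ k → 2 * r ≤ ‖x j - x k‖) ∧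
      1 - ∫ x, Θ x ∂(boxMeasure n) ≤ 12 * n * r + 114 * n ^ 2 * r ^ 3 := by
  -- `f` removes a boundary layer in each coordinate, `1 - β` removes the configurations with two
  -- particles closer than `2r`; the extra width `r` leaves room for smoothness.
  let f : ContDiffBump (0 : ℝ) := ⟨1 / 2 - 2 * r, 1 / 2 - r, by linarith, by linarith⟩
  let β : ContDiffBump (0 : E3) := ⟨2 * r, 3 * r, by linarith, by linarith⟩
  set s := (Finset.univ : Finset (Fin n)).erase i with hs
  set P := s ×ˢ (Finset.univ : Finset (Fin 3)) with hP
  set A : Config n → ℝ := fun x => ∏ p ∈ P, f (x p.1 p.2) with hA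
  set B : Config n → ℝ := fun x => ∏ q ∈ s.offDiag, (1 - β (x q.1 - x q.2)) with hB
  have hA0 : ∀ x, 0 ≤ A x := fun x => Finset.prod_nonneg fun p _ => f.nonneg
  have hA1 : ∀ x, A x ≤ 1 := fun x => Finset.prod_le_one (fun p _ => f.nonneg) fun p _ => f.le_one
  have hb0 : ∀ z, 0 ≤ 1 - β z := fun z => sub_nonneg.2 β.le_one
  have hb1 : ∀ z, 1 - β z ≤ 1 := fun z => sub_le_self _ β.nonneg
  have hB0 : ∀ x, 0 ≤ B x := fun x => Finset.prod_nonneg fun q _ => hb0 _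
  have hB1 : ∀ x, B x ≤ 1 := fun x => Finset.prod_le_one (fun q _ => hb0 _) fun q _ => hb1 _
  have hAs : ContDiff ℝ ∞ A := contDiff_prod fun p _ =>
    f.contDiff.comp ((EuclideanSpace.proj p.2 : E3 →L[ℝ] ℝ).contDiff.comp
      (contDiff_apply ℝ E3 p.1))
  have hBs : ContDiff ℝ ∞ B := contDiff_prod fun q _ =>
    contDiff_const.sub (β.contDiff.comp ((contDiff_apply ℝ E3 q.1).sub (contDiff_apply ℝ E3 q.2)))
  have hcut : IsCutoff i r fun x => A x * B x := by
    refine ⟨hAs.mul hBs, fun x => mul_nonneg (hA0 x) (hB0 x),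
      fun x => mul_le_one₀ (hA1 x) (hB0 x) (hB1 x), fun x z => ?_, fun x hx k hk c => ?_⟩
    · have e1 : A (Function.update x i z) = A x := Finset.prod_congr rfl fun p hp => by
        have : p.1 ≠ i := Finset.ne_of_mem_erase (Finset.mem_product.1 hp).1
        rw [Function.update_of_ne this]
      have e2 : B (Function.update x i z) = B x := Finset.prod_congr rfl fun q hq => by
        have hq' := Finset.mem_offDiag.1 hq
        rw [Function.update_of_ne (Finset.ne_of_mem_erase hq'.1),
          Function.update_of_ne (Finset.ne_of_mem_erase hq'.2.1)]
      simp only [e1, e2]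
    · have h1 : A x ≠ 0 := left_ne_zero_of_mul hx
      have h2 : f (x k c) ≠ 0 := Finset.prod_ne_zero_iff.1 h1 (k, c) (by simp [hP, hs, hk])
      by_contra hlt
      refine h2 (f.zero_of_le_dist ?_)
      rw [dist_zero_right]
      exact (not_le.1 hlt).le
  refine ⟨_, hcut, fun x hx j k hj hk hjk => ?_, ?_⟩
  · have h1 : B x ≠ 0 := right_ne_zero_of_mul hx
    have h2 : 1 - β (x j - x k) ≠ 0 := Finset.prod_ne_zero_iff.1 h1 (j, k) (by
      rw [Finset.mem_offDiag]; simp [hs, hj, hk, hjk])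
    by_contra hlt
    refine h2 ?_
    rw [β.one_of_mem_closedBall, sub_self]
    rw [mem_closedBall_zero_iff]
    exact (not_le.1 hlt).le
  · have hcb : ∀ {F : Config n → ℝ}, Continuous F → (∀ x, 0 ≤ F x) → (∀ x, F x ≤ 1) →
        Integrable F (boxMeasure n) := fun hF h0 h1 =>
      Integrable.of_bound hF.aestronglyMeasurable 1 (Filter.Eventually.of_forall fun x => by
        rw [Real.norm_of_nonneg (h0 x)]; exact h1 x)
    have hfc : ∀ p : Fin n × Fin 3, Continuous fun x : Config n => f (x p.1 p.2) := fun p =>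
      f.continuous.comp (by fun_prop)
    have hβc : ∀ q : Fin n × Fin n, Continuous fun x : Config n => β (x q.1 - x q.2) := fun q =>
      β.continuous.comp (by fun_prop)
    have hfi : ∀ p : Fin n × Fin 3, Integrable (fun x : Config n => f (x p.1 p.2)) (boxMeasure n) :=
      fun p => hcb (hfc p) (fun x => f.nonneg) (fun x => f.le_one)
    have hβi : ∀ q : Fin n × Fin n, Integrable (fun x : Config n => β (x q.1 - x q.2))
      (boxMeasure n) := fun q => hcb (hβc q) (fun x => β.nonneg) (fun x => β.le_one)
    have hΘi := hcb hcut.smooth.continuous hcut.nonneg hcut.le_one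
    have hpt : ∀ x : Config n, 1 - A x * B x
        ≤ ∑ p ∈ P, (1 - f (x p.1 p.2)) + ∑ q ∈ s.offDiag, β (x q.1 - x q.2) := by
      intro x
      have h1 := one_sub_prod_le_sum P (u := fun p => f (x p.1 p.2)) (fun p => f.nonneg)
        (fun p => f.le_one)
      have h2 := one_sub_prod_le_sum s.offDiag (u := fun q => 1 - β (x q.1 - x q.2))
        (fun q => hb0 _) (fun q => hb1 _)
      simp only [sub_sub_cancel] at h2
      have h3 : 1 - A x * B x ≤ (1 - A x) + (1 - B x) := by
        nlinarith [hA1 x, hB1 x]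
      exact h3.trans (add_le_add h1 h2)
    have e0 : 1 - ∫ x, A x * B x ∂(boxMeasure n) = ∫ x, (1 - A x * B x) ∂(boxMeasure n) := by
      rw [integral_sub (integrable_const _) hΘi]; simp
    have i1 : ∀ p : Fin n × Fin 3, Integrable (fun x : Config n => 1 - f (x p.1 p.2)) (boxMeasure n) :=
      fun p => (integrable_const _).sub (hfi p)
    -- The plateau of `f` has length `1 - 4r`. There are at most `3n` coordinates, which gives the
    -- term `12 n r`.
    have hfb : ∀ p : Fin n × Fin 3, ∫ x, (1 - f (x p.1 p.2)) ∂(boxMeasure n) ≤ 4 * r := by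
      intro p
      rw [integral_sub (integrable_const _) (hfi p),
        integral_box_coord f.continuous (fun t ht => f.zero_of_le_dist (by
          rw [dist_zero_right, Real.norm_eq_abs]; exact le_trans (by simp only [f]; linarith) ht))]
      have := f.measure_closedBall_le_integral (volume : Measure ℝ)
      rw [measureReal_def, Real.volume_closedBall,
        ENNReal.toReal_ofReal (by simp only [f]; linarith)] at this
      simp only [f] at this
      simp only [integral_const, probReal_univ, smul_eq_mul, mul_one]
      linarith
    -- The ball of radius `3r` has volume `36π r³ < 114 r³`; at most `n²` ordered pairs contribute.
    have hβb : ∀ q ∈ s.offDiag, ∫ x, β (x q.1 - x q.2) ∂(boxMeasure n) ≤ 114 * r ^ 3 := by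
      intro q hq
      refine (integral_box_sub_le β.continuous (fun z => β.nonneg) β.integrable
        (Finset.mem_offDiag.1 hq).2.2).trans ?_
      refine (β.integral_le_measure_closedBall volume).trans ?_
      rw [measureReal_def, Measure.addHaar_closedBall_eq_addHaar_ball, ← measureReal_def,
        volume_real_ball_radius β.rOut_pos]
      simp only [β]
      have : 0 < r ^ 3 := by positivity
      nlinarith [Real.pi_lt_d2]
    rw [e0]
    refine (integral_mono (g := fun x : Config n => ∑ p ∈ P, (1 - f (x p.1 p.2)) +
      ∑ q ∈ s.offDiag, β (x q.1 - x q.2)) ((integrable_const _).sub hΘi)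
      ((integrable_finsetSum _ fun p _ => i1 p).add (integrable_finsetSum _ fun q _ => hβi q))
      hpt).trans ?_
    rw [integral_add (integrable_finsetSum _ fun p _ => i1 p)
      (integrable_finsetSum _ fun q _ => hβi q), integral_finsetSum _ fun p _ => i1 p,
      integral_finsetSum _ fun q _ => hβi q]
    have c1 := Finset.sum_le_card_nsmul P _ _ fun p _ => hfb p
    have c2 := Finset.sum_le_card_nsmul s.offDiag _ _ hβb
    have hsn : (s.card : ℝ) ≤ n := by
      have : s.card ≤ n := (Finset.card_le_univ s).trans (by simp)
      exact_mod_cast this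
    have hPn : (P.card : ℝ) ≤ 3 * n := by
      rw [hP, Finset.card_product]; simp; linarith
    have hOn : (s.offDiag.card : ℝ) ≤ n ^ 2 := by
      have h1 : s.offDiag.card ≤ s.card * s.card := by
        rw [Finset.offDiag_card]; exact Nat.sub_le _ _
      have h2 : (s.offDiag.card : ℝ) ≤ s.card * s.card := by exact_mod_cast h1
      nlinarith [(Nat.cast_nonneg s.card : (0 : ℝ) ≤ s.card)]
    rw [nsmul_eq_mul] at c1 c2
    have d1 : (P.card : ℝ) * (4 * r) ≤ 3 * n * (4 * r) := by gcongr
    have d2 : (s.offDiag.card : ℝ) * (114 * r ^ 3) ≤ n ^ 2 * (114 * r ^ 3) := by gcongr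
    linarith

end

/-! ### Summation over pairs and comparison with the constant function -/

section

variable {n : ℕ} {V : E3 → ℝ} {W : E3 × E3 → ℝ} {R₀ ℓ : ℝ}

theorem scatteringLength_nonneg (V : E3 → ℝ) : 0 ≤ scatteringLength V :=
  div_nonneg ENNReal.toReal_nonneg (by positivity)

/-- `V` is only almost everywhere measurable, so its pullback needs that null sets pull back to null
sets; this holds for a surjective linear map. -/
theorem aestronglyMeasurable_pair {V : E3 → ℝ} (hV : Integrable V) (hℓ : 0 < ℓ) {i j : Fin n}
    (hij : i ≠ j) :
    AEStronglyMeasurable (fun x : Config n => V (ℓ • (x i - x j))) (boxMeasure n) := by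
  let P : Config n →ₗ[ℝ] E3 := ℓ • (LinearMap.proj (R := ℝ) (φ := fun _ : Fin n => E3) i -
    LinearMap.proj (R := ℝ) (φ := fun _ : Fin n => E3) j)
  have hsurj : Function.Surjective P := by
    intro z
    refine ⟨Pi.single i (ℓ⁻¹ • z), ?_⟩
    simp [P, hij.symm, smul_smul, hℓ.ne']
  obtain ⟨c, -, hc⟩ := P.exists_map_addHaar_eq_smul_addHaar (volume : Measure (Config n))
    (volume : Measure E3) hsurj
  have hq : Measure.QuasiMeasurePreserving P (volume : Measure (Config n)) volume :=
    ⟨P.continuous_of_finiteDimensional.measurable, by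
      rw [hc]; exact Measure.smul_absolutelyContinuous⟩
  rw [boxMeasure_eq]
  exact (hV.aestronglyMeasurable.comp_quasiMeasurePreserving hq).restrict

theorem IsAdmissible.V_swap (hadm : IsAdmissible V W R₀) (x y : E3) :
    V (ℓ • (x - y)) = V (ℓ • (y - x)) :=
  hadm.V_radial _ _ (by rw [norm_smul, norm_smul, norm_sub_rev])

theorem IsAdmissible.sum_pair_le (hadm : IsAdmissible V W R₀) (x : Config n) :
    ∑ i, ∑ j ∈ Finset.Ioi i, ℓ ^ 2 * V (ℓ • (x i - x j)) ≤ rescaledInteraction V W ℓ x := by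
  refine le_add_of_nonneg_right ?_
  refine Finset.sum_nonneg fun i _ => Finset.sum_nonneg fun j _ => Finset.sum_nonneg fun k _ => ?_
  exact mul_nonneg (sq_nonneg _) (hadm.W_nonneg _)

theorem IsAdmissible.pair_le (hadm : IsAdmissible V W R₀) (x : Config n) {i j : Fin n}
    (hij : i ≠ j) : ℓ ^ 2 * V (ℓ • (x i - x j)) ≤ rescaledInteraction V W ℓ x := by
  have hnn : ∀ i j : Fin n, 0 ≤ ℓ ^ 2 * V (ℓ • (x i - x j)) := fun i j =>
    mul_nonneg (sq_nonneg _) (hadm.V_nonneg _)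
  have key : ∀ i j : Fin n, i < j → ℓ ^ 2 * V (ℓ • (x i - x j)) ≤ rescaledInteraction V W ℓ x := by
    intro i j h
    refine le_trans ?_ (hadm.sum_pair_le x)
    refine le_trans ?_ (Finset.single_le_sum (f := fun i => ∑ j ∈ Finset.Ioi i,
      ℓ ^ 2 * V (ℓ • (x i - x j))) (fun i _ => Finset.sum_nonneg fun j _ => hnn i j)
      (Finset.mem_univ i))
    exact Finset.single_le_sum (f := fun j => ℓ ^ 2 * V (ℓ • (x i - x j))) (fun j _ => hnn i j)
      (Finset.mem_Ioi.2 h)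
  rcases lt_or_gt_of_ne hij with h | h
  · exact key i j h
  · rw [hadm.V_swap]; exact key j i h

theorem sum_erase_eq_two_mul_sum_Ioi {f : Fin n → Fin n → ℝ} (hf : ∀ i j, f i j = f j i) :
    ∑ i, ∑ j ∈ Finset.univ.erase i, f i j = 2 * ∑ i, ∑ j ∈ Finset.Ioi i, f i j := by
  have h1 : ∀ i : Fin n, ∑ j ∈ Finset.univ.erase i, f i j
      = ∑ j ∈ Finset.Ioi i, f i j + ∑ j ∈ Finset.Iio i, f i j := by
    intro i
    rw [← Finset.sum_union]
    · congr 1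
      ext j
      simp only [Finset.mem_erase, Finset.mem_univ, and_true, Finset.mem_union, Finset.mem_Ioi,
        Finset.mem_Iio]
      exact ⟨fun h => (lt_or_gt_of_ne h).symm, fun h => h.elim (fun h => h.ne') fun h => h.ne⟩
    · rw [Finset.disjoint_left]
      intro j h1 h2
      exact absurd (Finset.mem_Ioi.1 h1) (not_lt.2 (Finset.mem_Iio.1 h2).le)
  have h2 : ∑ i, ∑ j ∈ Finset.Iio i, f i j = ∑ i, ∑ j ∈ Finset.Ioi i, f i j := by
    rw [Finset.sum_comm' (t' := Finset.univ) (s' := fun j => Finset.Ioi j) (by simp)]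
    exact Finset.sum_congr rfl fun i _ => Finset.sum_congr rfl fun j _ => hf j i
  simp only [h1, Finset.sum_add_distrib]
  rw [h2]; ring

/-- Around separated points, at most one of the balls contains a given point. -/
theorem sum_indicator_le {r : ℝ} {Θ : Config n → ℝ} {i : Fin n} (h : IsCutoff i r Θ)
    (hsep : ∀ x, Θ x ≠ 0 → ∀ j k, j ≠ i → k ≠ i → j ≠ k → 2 * r ≤ ‖x j - x k‖) (x : Config n) :
    ∑ j ∈ Finset.univ.erase i, {x : Config n | ‖x i - x j‖ < r}.indicator Θ x ≤ 1 := by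
  by_cases h0 : Θ x = 0
  · rw [Finset.sum_eq_zero]
    · exact zero_le_one
    · intro j _
      simp [Set.indicator, h0]
  by_cases hex : ∃ j, j ≠ i ∧ ‖x i - x j‖ < r
  · obtain ⟨j, hj, hjr⟩ := hex
    rw [Finset.sum_eq_single j]
    · exact (Set.indicator_le_self' (fun _ _ => h.nonneg _) x).trans (h.le_one x)
    · intro k hk hkj
      refine Set.indicator_of_notMem (fun hkr => ?_) _
      have hk' : k ≠ i := Finset.ne_of_mem_erase hk
      have h1 := hsep x h0 j k hj hk' hkj.symm
      have h2 : ‖x j - x k‖ ≤ ‖x i - x j‖ + ‖x i - x k‖ := by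
        have : x j - x k = (x i - x k) - (x i - x j) := by abel
        rw [this, add_comm]; exact norm_sub_le _ _
      have h3 : ‖x i - x k‖ < r := hkr
      linarith
    · intro hj'
      exact absurd (Finset.mem_erase.2 ⟨hj, Finset.mem_univ j⟩) hj'
  · push Not at hex
    rw [Finset.sum_eq_zero]
    · exact zero_le_one
    · intro j hj
      exact Set.indicator_of_notMem (show x ∉ {x : Config n | ‖x i - x j‖ < r} from
        not_lt.2 (hex j (Finset.ne_of_mem_erase hj))) _

/-- All terms of the interaction are nonnegative, so each single pair term is dominated by the
total, which is integrable on the form domain. -/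
theorem integrable_pair (hadm : IsAdmissible V W R₀) (hℓ : 0 < ℓ) {ψ : Config n → ℂ}
    {G : Fin n × Fin 3 → Config n → ℂ} (hdom : MemFormDomain V W ℓ ψ G) {i j : Fin n}
    (hij : i ≠ j) :
    Integrable (fun x => V (ℓ • (x i - x j)) * ‖ψ x‖ ^ 2) (boxMeasure n) := by
  have hψ : MemLp ψ 2 (boxMeasure n) := boxMeasure_eq (n := n) ▸ hdom.memLp
  have hI : Integrable (fun x => rescaledInteraction V W ℓ x * ‖ψ x‖ ^ 2) (boxMeasure n) :=
    boxMeasure_eq (n := n) ▸ hdom.interaction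
  refine (hI.const_mul (ℓ ^ 2)⁻¹).mono'
    ((aestronglyMeasurable_pair hadm.V_integrable hℓ hij).mul (hψ.1.norm.pow 2))
    (Filter.Eventually.of_forall fun x => ?_)
  rw [Real.norm_of_nonneg (mul_nonneg (hadm.V_nonneg _) (by positivity)), ← mul_assoc]
  gcongr
  rw [le_inv_mul_iff₀ (by positivity)]
  exact hadm.pair_le x hij

/-- The sum of the pair energies is bounded by the quadratic form. -/
theorem sum_pair_energy_le (hadm : IsAdmissible V W R₀) (hℓ : 0 < ℓ) {ψ : Config n → ℂ}
    {G : Fin n × Fin 3 → Config n → ℂ} (hdom : MemFormDomain V W ℓ ψ G) {r : ℝ}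
    {Θ : Fin n → Config n → ℝ} (hΘ : ∀ i, IsCutoff i r (Θ i))
    (hsep : ∀ i x, Θ i x ≠ 0 → ∀ j k, j ≠ i → k ≠ i → j ≠ k → 2 * r ≤ ‖x j - x k‖) :
    ∑ i, ∑ j ∈ Finset.univ.erase i, ∫ x in {x | ‖x i - x j‖ < r}, Θ i x *
        (∑ c, ‖G (i, c) x‖ ^ 2 + 1 / 2 * (ℓ ^ 2 * V (ℓ • (x i - x j)) * ‖ψ x‖ ^ 2)) ∂(boxMeasure n)
      ≤ rescaledForm V W ℓ ψ G := by
  have hψ : MemLp ψ 2 (boxMeasure n) := boxMeasure_eq (n := n) ▸ hdom.memLp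
  have hI : Integrable (fun x => rescaledInteraction V W ℓ x * ‖ψ x‖ ^ 2) (boxMeasure n) :=
    boxMeasure_eq (n := n) ▸ hdom.interaction
  have hG : ∀ p, MemLp (G p) 2 (boxMeasure n) := fun p => boxMeasure_eq (n := n) ▸ hdom.grad_memLp p
  have hg : ∀ i : Fin n, Integrable (fun x => ∑ c, ‖G (i, c) x‖ ^ 2) (boxMeasure n) := fun i =>
    integrable_finsetSum _ fun c _ => (hG (i, c)).norm.integrable_sq
  have hT : Integrable (fun x => ∑ p, ‖G p x‖ ^ 2) (boxMeasure n) :=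
    integrable_finsetSum _ fun p _ => (hG p).norm.integrable_sq
  have hv : ∀ i j : Fin n, i ≠ j → Integrable (fun x =>
      1 / 2 * (ℓ ^ 2 * V (ℓ • (x i - x j)) * ‖ψ x‖ ^ 2)) (boxMeasure n) := fun i j hij =>
    ((integrable_pair hadm hℓ hdom hij).const_mul (1 / 2 * ℓ ^ 2)).congr
      (Filter.Eventually.of_forall fun x => by simp only; ring)
  set F : Fin n → Fin n → Config n → ℝ := fun i j => {x : Config n | ‖x i - x j‖ < r}.indicator
    fun x => Θ i x * (∑ c, ‖G (i, c) x‖ ^ 2 + 1 / 2 * (ℓ ^ 2 * V (ℓ • (x i - x j)) * ‖ψ x‖ ^ 2))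
    with hF
  have hFi : ∀ i, ∀ j ∈ Finset.univ.erase i, Integrable (F i j) (boxMeasure n) := by
    intro i j hj
    refine Integrable.indicator ?_ (measurableSet_near i j r)
    refine ((hg i).add (hv i j (Finset.ne_of_mem_erase hj).symm)).bdd_mul (c := 1)
      (hΘ i).smooth.continuous.aestronglyMeasurable (Filter.Eventually.of_forall fun x => ?_)
    rw [Real.norm_of_nonneg ((hΘ i).nonneg x)]; exact (hΘ i).le_one x
  have e1 : ∀ i j : Fin n, ∫ x in {x | ‖x i - x j‖ < r}, Θ i x *
        (∑ c, ‖G (i, c) x‖ ^ 2 + 1 / 2 * (ℓ ^ 2 * V (ℓ • (x i - x j)) * ‖ψ x‖ ^ 2)) ∂(boxMeasure n)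
      = ∫ x, F i j x ∂(boxMeasure n) := fun i j =>
    (integral_indicator (measurableSet_near i j r)).symm
  simp only [e1]
  have e2 : ∑ i, ∑ j ∈ Finset.univ.erase i, ∫ x, F i j x ∂(boxMeasure n)
      = ∫ x, ∑ i, ∑ j ∈ Finset.univ.erase i, F i j x ∂(boxMeasure n) := by
    rw [integral_finsetSum _ fun i _ => integrable_finsetSum _ fun j hj => hFi i j hj]
    exact Finset.sum_congr rfl fun i _ => (integral_finsetSum _ fun j hj => hFi i j hj).symm
  rw [e2, rescaledForm, ← boxMeasure_eq, ← integral_add hT hI]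
  refine integral_mono (integrable_finsetSum _ fun i _ => integrable_finsetSum _ fun j hj =>
    hFi i j hj) (hT.add hI) fun x => ?_
  simp only
  -- Particle `i` is in at most one of the disjoint balls, so its kinetic energy is used at most
  -- once. The potential terms are nonnegative and are kept without cutoff.
  have hFle : ∀ i, ∑ j ∈ Finset.univ.erase i, F i j x ≤ ∑ c, ‖G (i, c) x‖ ^ 2 +
      ∑ j ∈ Finset.univ.erase i, 1 / 2 * (ℓ ^ 2 * V (ℓ • (x i - x j)) * ‖ψ x‖ ^ 2) := by
    intro i
    have hg0 : 0 ≤ ∑ c, ‖G (i, c) x‖ ^ 2 := Finset.sum_nonneg fun c _ => by positivity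
    have hstep : ∀ j, F i j x ≤ {x : Config n | ‖x i - x j‖ < r}.indicator (Θ i) x *
        ∑ c, ‖G (i, c) x‖ ^ 2 + 1 / 2 * (ℓ ^ 2 * V (ℓ • (x i - x j)) * ‖ψ x‖ ^ 2) := by
      intro j
      have hv0 : 0 ≤ 1 / 2 * (ℓ ^ 2 * V (ℓ • (x i - x j)) * ‖ψ x‖ ^ 2) := by
        have := hadm.V_nonneg (ℓ • (x i - x j)); positivity
      by_cases hx : x ∈ {x : Config n | ‖x i - x j‖ < r}
      · simp only [hF, Set.indicator_of_mem hx]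
        have := (hΘ i).le_one x
        nlinarith
      · simp only [hF, Set.indicator_of_notMem hx]
        linarith
    refine (Finset.sum_le_sum fun j _ => hstep j).trans ?_
    rw [Finset.sum_add_distrib, ← Finset.sum_mul]
    gcongr
    exact mul_le_of_le_one_left hg0 (sum_indicator_le (hΘ i) (hsep i) x)
  refine (Finset.sum_le_sum fun i _ => hFle i).trans ?_
  rw [Finset.sum_add_distrib, Fintype.sum_prod_type]
  gcongr
  -- Every unordered pair occurs twice, once for each of its particles, which restores the halved
  -- potential.
  rw [sum_erase_eq_two_mul_sum_Ioi fun i j => by rw [hadm.V_swap]]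
  have e3 : 2 * ∑ i, ∑ j ∈ Finset.Ioi i, 1 / 2 * (ℓ ^ 2 * V (ℓ • (x i - x j)) * ‖ψ x‖ ^ 2)
      = (∑ i, ∑ j ∈ Finset.Ioi i, ℓ ^ 2 * V (ℓ • (x i - x j))) * ‖ψ x‖ ^ 2 := by
    simp only [← Finset.mul_sum, ← Finset.sum_mul]; ring
  rw [e3]
  gcongr
  exact hadm.sum_pair_le x

/-- From `|m| ≥ |c| - |m - c|` and Young's inequality for the cross term. If `|c| ≤ |m - c|`, the
left side is not positive. -/
theorem norm_sq_ge (m c : ℂ) {κ : ℝ} (hκ : 0 < κ) :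
    (1 - κ) * ‖c‖ ^ 2 - κ⁻¹ * ‖m - c‖ ^ 2 ≤ ‖m‖ ^ 2 := by
  have h1 : ‖c‖ ≤ ‖m‖ + ‖m - c‖ := by
    have : c = m - (m - c) := by abel
    calc ‖c‖ = ‖m - (m - c)‖ := by rw [← this]
      _ ≤ _ := norm_sub_le _ _
  set a := ‖m‖
  set b := ‖m - c‖
  set s := ‖c‖
  have ha : 0 ≤ a := norm_nonneg _
  have hb : 0 ≤ b := norm_nonneg _
  have hs : 0 ≤ s := norm_nonneg _
  have h2 : 2 * s * b ≤ κ * s ^ 2 + κ⁻¹ * b ^ 2 := by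
    have h := sq_nonneg (κ * s - b)
    have e : κ * s ^ 2 + κ⁻¹ * b ^ 2 - 2 * s * b = κ⁻¹ * (κ * s - b) ^ 2 := by field_simp; ring
    have : 0 ≤ κ⁻¹ * (κ * s - b) ^ 2 := by positivity
    linarith
  by_cases hsb : s ≤ b
  · nlinarith [mul_nonneg hs hb, mul_nonneg hs (sub_nonneg.2 hsb), sq_nonneg a]
  · have : (s - b) ^ 2 ≤ a ^ 2 := by
      have h3 : 0 ≤ s - b := by linarith
      have : s - b ≤ a := by linarith
      gcongr
    nlinarith [sq_nonneg b]

theorem integral_norm_sub_integral_sq {X : Type*} [MeasurableSpace X] {μ : Measure X}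
    [IsProbabilityMeasure μ] {ψ : X → ℂ} (hψ : MemLp ψ 2 μ) :
    ∫ x, ‖ψ x - ∫ y, ψ y ∂μ‖ ^ 2 ∂μ = ∫ x, ‖ψ x‖ ^ 2 ∂μ - ‖∫ y, ψ y ∂μ‖ ^ 2 := by
  set c := ∫ y, ψ y ∂μ with hc
  have hψi : Integrable ψ μ := hψ.integrable (by norm_num)
  have hpt : ∀ x, ‖ψ x - c‖ ^ 2
      = ‖ψ x‖ ^ 2 + ‖c‖ ^ 2 - 2 * RCLike.re (ψ x * (starRingEnd ℂ) c) := by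
    intro x
    rw [← Complex.normSq_eq_norm_sq, ← Complex.normSq_eq_norm_sq, ← Complex.normSq_eq_norm_sq,
      Complex.normSq_sub]
    rfl
  have hi : Integrable (fun x => ψ x * (starRingEnd ℂ) c) μ := hψi.mul_const _
  have hcc : RCLike.re (c * (starRingEnd ℂ) c) = ‖c‖ ^ 2 := by
    rw [Complex.mul_conj, Complex.normSq_eq_norm_sq]; exact Complex.ofReal_re _
  have hi2 : Integrable (fun x => ‖ψ x‖ ^ 2 + ‖c‖ ^ 2) μ :=
    hψ.norm.integrable_sq.add (integrable_const _)
  simp only [hpt]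
  rw [integral_sub hi2 (hi.re.const_mul 2), integral_add hψ.norm.integrable_sq (integrable_const _),
    integral_const_mul, integral_re hi, integral_mul_const, ← hc, hcc]
  simp only [integral_const, probReal_univ, one_smul]
  ring

/-- Combining the kinetic bound `D ≤ 12 n T` with the interaction bound on the mean. -/
theorem energy_arithmetic {n : ℕ} {e r κ η S D T F : ℝ} (he0 : 0 ≤ e) (hr : 0 < r)
    (hr4 : r < 1 / 4) (hκ : 0 < κ) (hκ1 : κ < 1) (hη0 : 0 ≤ η) (hη1 : η < 1)
    (hD : 36 * e * n ^ 3 ≤ κ ^ 2 * r ^ 3) (hS0 : 0 ≤ S) (hD0 : 0 ≤ D) (hT0 : 0 ≤ T)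
    (hpoin : D ≤ 12 * n * T) (hTF : T ≤ F)
    (hsum : (n : ℝ) * ((n : ℝ) - 1) *
      (e * ((1 - κ) * ((1 - η) * (S - D)) - κ⁻¹ * (2 * D / r ^ 3))) ≤ F) :
    e * ((n : ℝ) * ((n : ℝ) - 1)) * (1 - η - 2 * κ) * S ≤ F := by
  set q := (1 - κ) * ((1 - η) * (S - D)) - κ⁻¹ * (2 * D / r ^ 3) with hq
  have hN0 : 0 ≤ (n : ℝ) * ((n : ℝ) - 1) := by
    rcases Nat.eq_zero_or_pos n with h | h
    · simp [h]
    · have : (1 : ℝ) ≤ n := by exact_mod_cast h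
      exact mul_nonneg (by linarith) (by linarith)
  have hNn : (n : ℝ) * ((n : ℝ) - 1) ≤ n ^ 2 := by
    nlinarith [(Nat.cast_nonneg n : (0 : ℝ) ≤ n)]
  set N₂ := (n : ℝ) * ((n : ℝ) - 1)
  have hκr : 0 < κ * r ^ 3 := by positivity
  have hκr1 : κ * r ^ 3 ≤ 1 := mul_le_one₀ hκ1.le (by positivity)
    (pow_le_one₀ hr.le (by linarith))
  have hDκ : D ≤ D / (κ * r ^ 3) := le_div_self hD0 hκr hκr1
  have e1 : κ⁻¹ * (2 * D / r ^ 3) = 2 * (D / (κ * r ^ 3)) := by field_simp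
  -- The deficit is twice `D/(κr³)` from `|m - c|²`, plus `D` itself from `|c|² = S - D`. Poincaré
  -- and `hD` convert it into the fraction `κ` of the kinetic energy; `36 = 3 · 12`.
  have hDT : N₂ * e * (3 * (D / (κ * r ^ 3))) ≤ κ * T := by
    have h1 : N₂ * e * (3 * (D / (κ * r ^ 3)))
        ≤ n ^ 2 * e * (3 * ((12 * n * T) / (κ * r ^ 3))) := by gcongr
    have h2 : n ^ 2 * e * (3 * ((12 * n * T) / (κ * r ^ 3))) = 36 * e * n ^ 3 * (T / (κ * r ^ 3)) := by
      ring
    have h3 : 36 * e * n ^ 3 * (T / (κ * r ^ 3)) ≤ κ ^ 2 * r ^ 3 * (T / (κ * r ^ 3)) := by gcongr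
    have h4 : κ ^ 2 * r ^ 3 * (T / (κ * r ^ 3)) = κ * T := by field_simp
    linarith
  rw [e1] at hq
  set B := D / (κ * r ^ 3)
  have hB0 : 0 ≤ B := hD0.trans hDκ
  have hq1 : (1 - η - 2 * κ) * S - 3 * B ≤ (1 - κ) * q := by
    have hq2 : (1 - κ) * (1 - η) * S - 3 * B ≤ q := by
      have e2 : (1 - κ) * (1 - η) * D ≤ D :=
        mul_le_of_le_one_left hD0 (mul_le_one₀ (by linarith) (by linarith) (by linarith))
      rw [hq]; linarith
    have h3 : (1 - κ) * ((1 - κ) * (1 - η) * S - 3 * B) ≤ (1 - κ) * q :=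
      mul_le_mul_of_nonneg_left hq2 (by linarith)
    have h4 : (1 - η - 2 * κ) * S ≤ (1 - κ) * ((1 - κ) * (1 - η)) * S := by
      refine mul_le_mul_of_nonneg_right ?_ hS0
      have h5 : (1 - κ) ^ 2 ≤ 1 := pow_le_one₀ (by linarith) (by linarith)
      linarith [mul_nonneg hη0 (sub_nonneg.2 h5), sq_nonneg κ]
    have h6 : 0 ≤ κ * B := by positivity
    linarith
  have h5 : N₂ * e * ((1 - η - 2 * κ) * S - 3 * B) ≤ N₂ * e * ((1 - κ) * q) := by
    gcongr
  -- The energy is split as `(1 - κ) F + κ F`: the first part is bounded by the pair sum, the second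
  -- by `κ T`, which pays for the deficit.
  have h6 : (1 - κ) * (N₂ * (e * q)) ≤ (1 - κ) * F :=
    mul_le_mul_of_nonneg_left hsum (by linarith)
  have h7 : κ * T ≤ κ * F := by gcongr
  linarith

/-- The quadratic form is bounded below by the energy of the constant function. -/
theorem rescaledForm_ge (hadm : IsAdmissible V W R₀) (hℓ : 0 < ℓ) {r κ η : ℝ} (hr : 0 < r)
    (hr4 : r < 1 / 4) (hκ : 0 < κ) (hκ1 : κ < 1) (hR : R₀ < r * ℓ / 2)
    (hη : 12 * n * r + 114 * n ^ 2 * r ^ 3 ≤ η) (hη1 : η < 1)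
    (hD : 36 * (4 * Real.pi * scatteringLength V / ℓ) * n ^ 3 ≤ κ ^ 2 * r ^ 3)
    {ψ : Config n → ℂ} {G : Fin n × Fin 3 → Config n → ℂ} (hdom : MemFormDomain V W ℓ ψ G) :
    4 * Real.pi * scatteringLength V / ℓ * ((n : ℝ) * ((n : ℝ) - 1)) * (1 - η - 2 * κ) *
      ∫ x in unitBox n, ‖ψ x‖ ^ 2 ≤ rescaledForm V W ℓ ψ G := by
  have hψ : MemLp ψ 2 (boxMeasure n) := boxMeasure_eq (n := n) ▸ hdom.memLp
  have hG : ∀ p, MemLp (G p) 2 (boxMeasure n) := fun p => boxMeasure_eq (n := n) ▸ hdom.grad_memLp p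
  set e := 4 * Real.pi * scatteringLength V / ℓ with he
  have he0 : 0 ≤ e := by
    have := scatteringLength_nonneg V
    have := Real.pi_pos
    positivity
  have hη0 : 0 ≤ η := le_trans (by positivity) hη
  rw [← boxMeasure_eq]
  set S := ∫ x, ‖ψ x‖ ^ 2 ∂(boxMeasure n) with hS
  set c := ∫ x, ψ x ∂(boxMeasure n) with hc
  set D := ∫ x, ‖ψ x - c‖ ^ 2 ∂(boxMeasure n) with hDd
  set T := ∑ p, ∫ x, ‖G p x‖ ^ 2 ∂(boxMeasure n) with hT
  have hD0 : 0 ≤ D := integral_nonneg fun x => by positivity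
  have hS0 : 0 ≤ S := integral_nonneg fun x => by positivity
  have hT0 : 0 ≤ T := Finset.sum_nonneg fun p _ => integral_nonneg fun x => by positivity
  have hpoin : D ≤ 12 * n * T := poincare_box hψ hG hdom.weak
  have hSD : ‖c‖ ^ 2 = S - D := by linarith [integral_norm_sub_integral_sq hψ]
  have hTform : T ≤ rescaledForm V W ℓ ψ G := by
    rw [rescaledForm, ← boxMeasure_eq, hT,
      ← integral_finsetSum _ fun p _ => (hG p).norm.integrable_sq]
    -- The whole interaction, including `W`, is dropped here.
    refine le_add_of_nonneg_right (integral_nonneg fun x => mul_nonneg ?_ (by positivity))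
    refine le_trans ?_ (hadm.sum_pair_le x)
    exact Finset.sum_nonneg fun i _ => Finset.sum_nonneg fun j _ =>
      mul_nonneg (sq_nonneg _) (hadm.V_nonneg _)
  -- Each particle has its own cutoff, as it must not depend on the position of that particle.
  choose Θ hΘ hsep hmass using fun i : Fin n => exists_cutoff i hr hr4
  have hθ : ∀ i, 1 - η ≤ ∫ x, Θ i x ∂(boxMeasure n) := fun i => by linarith [hmass i]
  set q := (1 - κ) * ((1 - η) * (S - D)) - κ⁻¹ * (2 * D / r ^ 3) with hq
  have hpair : ∀ i, ∀ j ∈ Finset.univ.erase i, e * q ≤ ∫ x in {x | ‖x i - x j‖ < r}, Θ i x *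
      (∑ c, ‖G (i, c) x‖ ^ 2 + 1 / 2 * (ℓ ^ 2 * V (ℓ • (x i - x j)) * ‖ψ x‖ ^ 2))
        ∂(boxMeasure n) := by
    intro i j hj
    have hij : i ≠ j := (Finset.ne_of_mem_erase hj).symm
    have hθi := hθ i
    set θ := ∫ x, Θ i x ∂(boxMeasure n) with hθd
    have hθ0 : 0 < θ := by linarith
    obtain ⟨m, hm1, hm2⟩ := (hΘ i).pair_energy hij hr hℓ hadm.V_nonneg hadm.V_integrable
      hadm.V_radial hR hadm.V_supp hψ hG hdom.weak (integrable_pair hadm hℓ hdom hij) hθ0 c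
    refine le_trans ?_ hm2
    gcongr
    rw [← hθd] at hm1 ⊢
    have h1 := norm_sq_ge m c hκ
    have h2 : θ * ‖m - c‖ ^ 2 ≤ 2 * D / r ^ 3 := by
      rw [le_div_iff₀ (by positivity)]; linarith
    have h3 : (1 - η) * (S - D) ≤ θ * ‖c‖ ^ 2 := by rw [← hSD]; gcongr
    calc q ≤ (1 - κ) * (θ * ‖c‖ ^ 2) - κ⁻¹ * (θ * ‖m - c‖ ^ 2) := by
          rw [hq]
          have : 0 ≤ 1 - κ := by linarith
          gcongr
      _ = θ * ((1 - κ) * ‖c‖ ^ 2 - κ⁻¹ * ‖m - c‖ ^ 2) := by ring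
      _ ≤ _ := by gcongr
  have hsum : (n : ℝ) * ((n : ℝ) - 1) * (e * q) ≤ rescaledForm V W ℓ ψ G := by
    refine le_trans ?_ (sum_pair_energy_le hadm hℓ hdom hΘ hsep)
    refine le_trans (le_of_eq ?_) (Finset.sum_le_sum fun i _ => Finset.sum_le_sum fun j hj =>
      hpair i j hj)
    simp only [Finset.sum_const, Finset.card_erase_of_mem (Finset.mem_univ _), Finset.card_univ,
      Fintype.card_fin, nsmul_eq_mul]
    rcases Nat.eq_zero_or_pos n with h | h
    · subst h; simp
    · rw [Nat.cast_sub h]; push_cast; ring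
  exact energy_arithmetic he0 hr hr4 hκ hκ1 hη0 hη1 hD hS0 hD0 hT0 hpoin hTform hsum

end

/-! ### Length scales and error terms -/

theorem threeBodyScatteringEnergy_nonneg (W : E3 × E3 → ℝ) : 0 ≤ threeBodyScatteringEnergy W :=
  ENNReal.toReal_nonneg

/-- The bounds on the scales `𝔞 / ℓ` and `ρ ℓ³`. -/
theorem scale_bounds {α c₁ c₂ a ρ ℓ : ℝ} (hα : 1 / 3 < α) (hα' : α < 12 / 35) (hc₁ : 0 < c₁)
    (ha : 0 < a) (hρ : 0 < ρ) (hY : ρ * a ^ 3 ≤ 1)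
    (h1 : c₁ * (a * (ρ * a ^ 3) ^ (-α)) ≤ ℓ) (h2 : ℓ ≤ c₂ * (a * (ρ * a ^ 3) ^ (-α))) :
    (a / ℓ) ^ (1 / 8 : ℝ) ≤ c₁⁻¹ ^ (1 / 8 : ℝ) * (ρ * a ^ 3) ^ (1 / 100 : ℝ) ∧
      (a / ℓ) ^ (1 / 8 : ℝ) * (ρ * ℓ ^ 3)
        ≤ c₂ ^ 3 * c₁⁻¹ ^ (1 / 8 : ℝ) * (ρ * a ^ 3) ^ (1 / 100 : ℝ) := by
  set Y := ρ * a ^ 3 with hYd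
  have hY0 : 0 < Y := by positivity
  have hYα : 0 < Y ^ (-α) := Real.rpow_pos_of_pos hY0 _
  have hℓ : 0 < ℓ := lt_of_lt_of_le (by positivity) h1
  have hε : a / ℓ ≤ c₁⁻¹ * Y ^ α := by
    rw [div_le_iff₀ hℓ]
    calc a = c₁⁻¹ * Y ^ α * (c₁ * (a * Y ^ (-α))) := by
          have : Y ^ α * Y ^ (-α) = 1 := by rw [← Real.rpow_add hY0]; simp
          calc a = a * 1 := (mul_one a).symm
            _ = a * (Y ^ α * Y ^ (-α)) := by rw [this]
            _ = _ := by field_simp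
      _ ≤ _ := by gcongr
  have hr : (a / ℓ) ^ (1 / 8 : ℝ) ≤ c₁⁻¹ ^ (1 / 8 : ℝ) * Y ^ (α / 8) := by
    calc (a / ℓ) ^ (1 / 8 : ℝ) ≤ (c₁⁻¹ * Y ^ α) ^ (1 / 8 : ℝ) := by gcongr
      _ = c₁⁻¹ ^ (1 / 8 : ℝ) * Y ^ (α / 8) := by
        rw [Real.mul_rpow (by positivity) (by positivity), ← Real.rpow_mul hY0.le]
        congr 2; ring
  have hN : ρ * ℓ ^ 3 ≤ c₂ ^ 3 * Y ^ (1 - 3 * α) := by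
    calc ρ * ℓ ^ 3 ≤ ρ * (c₂ * (a * Y ^ (-α))) ^ 3 := by gcongr
      _ = c₂ ^ 3 * (Y * (Y ^ (-α)) ^ 3) := by rw [hYd]; ring
      _ = c₂ ^ 3 * Y ^ (1 - 3 * α) := by
        rw [← Real.rpow_natCast (Y ^ (-α)) 3, ← Real.rpow_mul hY0.le]
        nth_rewrite 1 [← Real.rpow_one Y]
        rw [← Real.rpow_add hY0]
        congr 2; push_cast; ring
  refine ⟨hr.trans ?_, ?_⟩
  -- `α/8 > 1/24 > 1/100`.
  · exact mul_le_mul_of_nonneg_left (Real.rpow_le_rpow_of_exponent_ge hY0 hY (by linarith))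
      (by positivity)
  · calc (a / ℓ) ^ (1 / 8 : ℝ) * (ρ * ℓ ^ 3)
        ≤ (c₁⁻¹ ^ (1 / 8 : ℝ) * Y ^ (α / 8)) * (c₂ ^ 3 * Y ^ (1 - 3 * α)) := by gcongr
      _ = c₂ ^ 3 * c₁⁻¹ ^ (1 / 8 : ℝ) * Y ^ (α / 8 + (1 - 3 * α)) := by
        rw [Real.rpow_add hY0]; ring
      _ ≤ _ := by
        have hc2 : 0 ≤ c₂ ^ 3 := by
          have : 0 < c₂ * (a * Y ^ (-α)) := hℓ.trans_le h2
          have : 0 < c₂ := pos_of_mul_pos_left this (by positivity)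
          positivity
        -- `α/8 + 1 - 3α > 1/70 > 1/100` for `α < 12/35`.
        exact mul_le_mul_of_nonneg_left (Real.rpow_le_rpow_of_exponent_ge hY0 hY (by linarith))
          (by positivity)

/-- The lower bound in terms of `r = (𝔞 / ℓ)^{1/8}`, `N = ρ ℓ³` and a small parameter `X`. -/
theorem hamiltonianGE_of_scales {V : E3 → ℝ} {W : E3 × E3 → ℝ} {R₀ a ρ ℓ K B B' X C₃ r : ℝ} {n : ℕ}
    (hadm : IsAdmissible V W R₀) (ha : 0 < a) (hρ : 0 < ρ) (hℓ : 0 < ℓ) (hK : 0 < K)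
    (haV : scatteringLength V ≤ a) (hRK : R₀ ≤ K * a) (hn : (n : ℝ) ≤ 10 * ρ * ℓ ^ 3)
    (hC₃ : 0 < C₃) (hW : threeBodyScatteringEnergy W ≤ C₃ * R₀ ^ 4)
    (hr0 : 0 < r) (hr8 : r ^ 8 = a / ℓ) (hrX : r ≤ B * X) (hrN : r * (ρ * ℓ ^ 3) ≤ B' * X)
    (hYX : ρ * a ^ 3 ≤ X) (hX1 : 8 * (B * X) ≤ 1) (hX2 : 4 * K * (B * X) ≤ 1)
    (hX3 : 600000 * (B' * X) ≤ 1) :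
    RescaledHamiltonianGE V W n ℓ
      (4 * Real.pi * scatteringLength V / ℓ * ((n : ℝ) * ((n : ℝ) - 1)) +
        threeBodyScatteringEnergy W / (6 * ℓ ^ 4) * ((n : ℝ) * ((n : ℝ) - 1) * ((n : ℝ) - 2)) -
        (1600 * (1260 * B' + 2 * B) + 167 * C₃ * K ^ 4) * (ρ ^ 2 * a * ℓ ^ 5 * X)) := by
  intro ψ G hdom
  have hR0 := hadm.R₀_pos
  have hn0 : (0 : ℝ) ≤ n := Nat.cast_nonneg n
  have hr8' : r ≤ 1 / 8 := by linarith
  set N := ρ * ℓ ^ 3 with hNd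
  have hN0 : 0 < N := by positivity
  have hnN : (n : ℝ) ≤ 10 * N := by rw [hNd]; linarith
  have hnr : n * r ≤ 10 * (B' * X) := by
    calc (n : ℝ) * r ≤ 10 * N * r := by gcongr
      _ ≤ _ := by linarith
  have hnr0 : 0 ≤ n * r := by positivity
  have haℓ : a = r ^ 8 * ℓ := by rw [hr8]; field_simp
  have hV0 := scatteringLength_nonneg V
  have hpi := Real.pi_pos
  have hpi4 := Real.pi_lt_four
  have he : 4 * Real.pi * scatteringLength V / ℓ ≤ 16 * r ^ 8 := by
    rw [hr8, div_le_iff₀ hℓ]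
    have : 16 * (a / ℓ) * ℓ = 4 * 4 * a := by field_simp; norm_num
    rw [this]; gcongr
  set e := 4 * Real.pi * scatteringLength V / ℓ with hed
  have he0 : 0 ≤ e := by positivity
  have hη : 12 * n * r + 114 * n ^ 2 * r ^ 3 ≤ 1260 * (B' * X) := by
    have h1 : 114 * (n : ℝ) ^ 2 * r ^ 3 ≤ 114 * (n * r) := by
      have e1 : 114 * (n : ℝ) ^ 2 * r ^ 3 = 114 * (n * r) * ((n * r) * r) := by ring
      rw [e1]
      exact mul_le_of_le_one_right (by positivity)
        (mul_le_one₀ (by linarith) hr0.le (by linarith))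
    linarith
  have hR : R₀ < r * ℓ / 2 := by
    have h1 : r ^ 7 ≤ r := pow_le_of_le_one hr0.le (by linarith) (by norm_num)
    have h2 : K * r ^ 7 ≤ 1 / 4 := by
      have : K * r ^ 7 ≤ K * (B * X) := by gcongr; exact h1.trans hrX
      linarith
    calc R₀ ≤ K * a := hRK
      _ = K * r ^ 7 * (r * ℓ) := by rw [haℓ]; ring
      _ ≤ 1 / 4 * (r * ℓ) := by gcongr
      _ < r * ℓ / 2 := by
        have : 0 < r * ℓ := by positivity
        linarith
  -- This fixes the exponent in `r⁸ = 𝔞/ℓ`: with `κ = r` the requirement is `r⁸ n³ ≪ r⁵`, that is,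
  -- `n r` small.
  have hD : 36 * e * n ^ 3 ≤ r ^ 2 * r ^ 3 := by
    have h3 : (n * r) ^ 3 ≤ (10 * (B' * X)) := by
      calc (n * r) ^ 3 ≤ n * r := pow_le_of_le_one hnr0 (by linarith) (by norm_num)
        _ ≤ _ := hnr
    calc 36 * e * (n : ℝ) ^ 3 ≤ 36 * (16 * r ^ 8) * n ^ 3 := by gcongr
      _ = 576 * (n * r) ^ 3 * (r ^ 2 * r ^ 3) := by ring
      _ ≤ 1 * (r ^ 2 * r ^ 3) := by gcongr; linarith
      _ = _ := one_mul _
  have hform := rescaledForm_ge hadm hℓ hr0 (by linarith) hr0 (by linarith) hR hη (by linarith) hD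
    hdom
  refine le_trans ?_ hform
  have hS0 : 0 ≤ ∫ x in unitBox n, ‖ψ x‖ ^ 2 := integral_nonneg fun x => by positivity
  refine mul_le_mul_of_nonneg_right ?_ hS0
  rw [← hed]
  have hnn : (n : ℝ) * ((n : ℝ) - 1) ≤ 100 * N ^ 2 := by nlinarith
  have hX0 : 0 < X := lt_of_lt_of_le (by positivity) hYX
  have hBX : 0 ≤ 1260 * (B' * X) + 2 * (B * X) := by
    have : 0 ≤ B' * X := le_trans (by positivity) hrN
    linarith
  have hee : ρ ^ 2 * a * ℓ ^ 5 = N ^ 2 * r ^ 8 := by rw [hNd, hr8]; field_simp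
  have hpair : e * ((n : ℝ) * ((n : ℝ) - 1)) * (1260 * (B' * X) + 2 * r)
      ≤ 16 * r ^ 8 * (100 * N ^ 2) * (1260 * (B' * X) + 2 * (B * X)) := by
    have h0 : 0 ≤ 1260 * (B' * X) + 2 * r := by
      have : 0 ≤ B' * X := le_trans (by positivity) hrN
      positivity
    calc e * ((n : ℝ) * ((n : ℝ) - 1)) * (1260 * (B' * X) + 2 * r)
        ≤ e * (100 * N ^ 2) * (1260 * (B' * X) + 2 * r) := by gcongr
      _ ≤ _ := by gcongr
  -- In the variables `r` and `N` the three-body energy is of order `r³² N³ = N² r⁸ (N r²⁴)`, and `N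
  -- r²⁴ = ρ 𝔞³` is the diluteness parameter, at most `X`. So the three-body term is part of the
  -- error.
  have hthree : threeBodyScatteringEnergy W / (6 * ℓ ^ 4) *
      ((n : ℝ) * ((n : ℝ) - 1) * ((n : ℝ) - 2)) ≤ 167 * C₃ * K ^ 4 * (N ^ 2 * r ^ 8 * X) := by
    have hb0 := threeBodyScatteringEnergy_nonneg W
    have h1 : threeBodyScatteringEnergy W / (6 * ℓ ^ 4) ≤ C₃ * K ^ 4 * r ^ 32 / 6 := by
      rw [div_le_div_iff₀ (by positivity) (by norm_num)]
      have : threeBodyScatteringEnergy W ≤ C₃ * (K * (r ^ 8 * ℓ)) ^ 4 := by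
        refine hW.trans ?_
        rw [← haℓ]; gcongr
      have e2 : C₃ * (K * (r ^ 8 * ℓ)) ^ 4 * 6 = C₃ * K ^ 4 * r ^ 32 * (6 * ℓ ^ 4) := by ring
      linarith
    have h2 : (n : ℝ) * ((n : ℝ) - 1) * ((n : ℝ) - 2) ≤ 1000 * N ^ 3 := by
      calc (n : ℝ) * ((n : ℝ) - 1) * ((n : ℝ) - 2) ≤ n ^ 3 := by
            rcases Nat.eq_zero_or_pos n with h | h
            · simp [h]
            · have : (1 : ℝ) ≤ n := by exact_mod_cast h
              nlinarith
        _ ≤ (10 * N) ^ 3 := by gcongr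
        _ = _ := by ring
    have h3 : N * r ^ 24 = ρ * a ^ 3 := by rw [hNd, haℓ]; ring
    calc threeBodyScatteringEnergy W / (6 * ℓ ^ 4) * ((n : ℝ) * ((n : ℝ) - 1) * ((n : ℝ) - 2))
        ≤ threeBodyScatteringEnergy W / (6 * ℓ ^ 4) * (1000 * N ^ 3) := by gcongr
      _ ≤ C₃ * K ^ 4 * r ^ 32 / 6 * (1000 * N ^ 3) := by gcongr
      _ = 1000 / 6 * (C₃ * K ^ 4) * (N ^ 2 * r ^ 8 * (N * r ^ 24)) := by ring
      _ ≤ 167 * (C₃ * K ^ 4) * (N ^ 2 * r ^ 8 * X) := by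
        rw [h3]; gcongr; norm_num
      _ = _ := by ring
  rw [hee]
  linarith

end BoseGas

end

/-! ### Choice of the constants -/

theorem mainTheorem3 :
    ∃ ν : ℝ, 0 < ν ∧
      ∀ α : ℝ, 1 / 3 < α → α < 12 / 35 →
      ∀ c₁ c₂ K : ℝ, 0 < c₁ → 0 < c₂ → 0 < K →
      ∃ C Y₀ : ℝ, 0 < C ∧ 0 < Y₀ ∧
        ∀ (V : BoseGas.E3 → ℝ) (W : BoseGas.E3 × BoseGas.E3 → ℝ) (R₀ ρ ℓ : ℝ) (n : ℕ),
          BoseGas.IsAdmissible V W R₀ →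
          0 < ρ →
          R₀ ≤ K * BoseGas.effLength V W ρ →
          BoseGas.diluteness V W ρ ≤ Y₀ →
          c₁ * (BoseGas.effLength V W ρ * BoseGas.diluteness V W ρ ^ (-α)) ≤ ℓ →
          ℓ ≤ c₂ * (BoseGas.effLength V W ρ * BoseGas.diluteness V W ρ ^ (-α)) →
          (n : ℝ) ≤ 10 * ρ * ℓ ^ 3 →
          BoseGas.RescaledHamiltonianGE V W n ℓ
            (4 * Real.pi * BoseGas.scatteringLength V / ℓ * ((n : ℝ) * ((n : ℝ) - 1)) +
              BoseGas.threeBodyScatteringEnergy W / (6 * ℓ ^ 4) *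
                ((n : ℝ) * ((n : ℝ) - 1) * ((n : ℝ) - 2)) -
              C * (ρ ^ 2 * BoseGas.effLength V W ρ * ℓ ^ 5 * BoseGas.diluteness V W ρ ^ ν)) := by
  -- Any exponent up to `1/70` would satisfy the two inequalities between powers of `Y`.
  refine ⟨1 / 100, by norm_num, fun α hα hα' c₁ c₂ K hc₁ hc₂ hK => ?_⟩
  obtain ⟨C₃, hC₃, hthree⟩ := BoseGas.exists_threeBodyScatteringEnergy_le
  set B := c₁⁻¹ ^ (1 / 8 : ℝ) with hB
  have hB0 : 0 < B := by positivity
  set B' := c₂ ^ 3 * B with hB'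
  have hB'0 : 0 < B' := by positivity
  -- The summands of `M` are the coefficients in the smallness conditions on `X = Y ^ (1/100)`. With
  -- `Y₀ = M⁻¹ ^ 100` one has `M X ≤ 1`, hence all conditions at once, and also `Y ≤ 1`.
  set M := 1 + 8 * B + 4 * K * B + 600000 * B' with hM
  have hM1 : 1 ≤ M := by
    have : 0 < K * B := by positivity
    linarith
  have hM0 : 0 < M := by linarith
  refine ⟨1600 * (1260 * B' + 2 * B) + 167 * C₃ * K ^ 4, M⁻¹ ^ 100, by positivity, by positivity,
    fun V W R₀ ρ ℓ n hadm hρ hRK hY h1 h2 hn => ?_⟩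
  set a := BoseGas.effLength V W ρ with ha
  have hYd : BoseGas.diluteness V W ρ = ρ * a ^ 3 := rfl
  rw [hYd] at hY h1 h2 ⊢
  -- Positivity of the effective length comes from `0 < R₀ ≤ K 𝔞`.
  have ha0 : 0 < a := pos_of_mul_pos_right (hadm.R₀_pos.trans_le hRK) hK.le
  have hY0 : 0 < ρ * a ^ 3 := by positivity
  have hY1 : ρ * a ^ 3 ≤ 1 := hY.trans (pow_le_one₀ (by positivity) (inv_le_one_of_one_le₀ hM1))
  have hℓ : 0 < ℓ := by
    have : 0 < (ρ * a ^ 3) ^ (-α) := Real.rpow_pos_of_pos hY0 _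
    exact lt_of_lt_of_le (by positivity) h1
  obtain ⟨hr, hrN⟩ := BoseGas.scale_bounds hα hα' hc₁ ha0 hρ hY1 h1 h2
  set X := (ρ * a ^ 3) ^ (1 / 100 : ℝ) with hX
  have hX0 : 0 < X := Real.rpow_pos_of_pos hY0 _
  have hXM : X ≤ M⁻¹ := by
    calc X ≤ (M⁻¹ ^ 100) ^ (1 / 100 : ℝ) := by rw [hX]; gcongr
      _ = M⁻¹ := by
        rw [← Real.rpow_natCast, ← Real.rpow_mul (by positivity)]; norm_num
  have hMX : M * X ≤ 1 := by
    calc M * X ≤ M * M⁻¹ := by gcongr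
      _ = 1 := mul_inv_cancel₀ hM0.ne'
  have p1 : 0 < B * X := by positivity
  have p2 : 0 < K * B * X := by positivity
  have p3 : 0 < B' * X := by positivity
  have hexp : M * X = X + 8 * (B * X) + 4 * (K * B * X) + 600000 * (B' * X) := by
    rw [hM]; ring
  refine BoseGas.hamiltonianGE_of_scales hadm ha0 hρ hℓ hK (le_max_left _ _) hRK hn hC₃
    (hthree W R₀ hadm.R₀_pos hadm.W_supp) (r := (a / ℓ) ^ (1 / 8 : ℝ))
    (Real.rpow_pos_of_pos (by positivity) _) ?_ hr hrN ?_ (by linarith) (by linarith) (by linarith)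
  · rw [← Real.rpow_natCast, ← Real.rpow_mul (by positivity)]; norm_num
  · calc ρ * a ^ 3 = (ρ * a ^ 3) ^ (1 : ℝ) := (Real.rpow_one _).symm
      _ ≤ X := Real.rpow_le_rpow_of_exponent_ge hY0 hY1 (by norm_num)
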